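/- Let $\lambda,\beta,\epsilon>0$ be real and $\gamma\ge 1$ an integer with $\epsilon<\gamma^2\beta/4$. For $r>0$ let $(Y^r,X^r)$ be the continuous-time Markov chain on $\mathbb Z\times\mathbb Z_{\ge 0}$ driven by the following events, when the current state is $(Y,X)$: at rate $\lambda r$ (customer arrival) the state becomes $(Y-1,\,X+\gamma)$; at rate $\beta X$ (acceptance of an invitation) it becomes $(Y+1,\,X-(\gamma\wedge X))$; at rate $\epsilon|Y|$ (additional event) it becomes $(Y,\,X-\operatorname{sgn}Y)$, except that it does not change if $X=0$ and $Y>0$. Put $(\bar Y^r,\bar X^r)=r^{-1}(Y^r,\,X^r-\lambda r/\beta)$. For a finite family of real functions on $[0,\infty)$, a point $t$ is called regular if the maximum and the minimum of every non-empty subfamily have a (two-sided) derivative at $t$. Let $r\to\infty$ (along a sequence, through all positive reals, or more generally along any filter on an index set), and let the initial states be deterministic with $(\bar Y^r(0),\bar X^r(0))\to(y_0,x_0)\in\mathbb R^2$, where $x_0\ge-\lambda/\beta$. Then there is a unique locally Lipschitz trajectory $(y,x):[0,\infty)\to\mathbb R^2$ with $(y(0),x(0))=(y_0,x_0)$ such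 that $x(t)\ge-\lambda/\beta$ for all $t\ge0$ and, at every regular point $t$ of $\{y,x\}$, $$y'(t)=\beta x(t),\quad x'(t)=-\gamma\beta x(t)-\epsilon y(t)\qquad\text{if }x(t)>-\lambda/\beta,$$ $$y'(t)=-\lambda,\quad x'(t)=[\gamma\lambda-\epsilon y(t)]\vee0\qquad\text{if }x(t)=-\lambda/\beta.$$ Lebesgue-almost all $t\ge0$ are regular points of it. Moreover, the processes $(Y^r,X^r)$ for all $r$ under consideration can be constructed on a common probability space so that, with probability $1$, $(\bar Y^r,\bar X^r)\to(y,x)$ uniformly on compact subsets of $[0,\infty)$ as $r\to\infty$. -/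

import Mathlib

open Set Filter Topology MeasureTheory
open scoped NNReal ENNReal

noncomputable section

/-! ### Continuous-time Markov chains -/

/-- The total rate of leaving the state `s`; `q s s'` is the rate of jumping from `s` to `s'`
(with `q s s = 0`). -/
def exitRate {S : Type*} (q : S → S → ℝ) (s : S) : ℝ := ∑' s', q s s'

/-- `Z` is a (non-explosive) continuous-time Markov chain with jump rates `q` and deterministic
initial state `s₀`, through its jump chain `J` and holding times `H`: `J` is a discrete-time Markov
chain started at `s₀` with transition probabilities `q s s' / exitRate q s`; given `J`, the holding
times are independent and `H i` is exponential of rate `exitRate q (J i)`; the jump times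
`H 0 + ⋯ + H (n - 1)` tend to infinity, and `Z` equals `J n` between the `n`-th and the `(n+1)`-st
jump time. (For rates without absorbing states: `0 < exitRate q s` for all `s`.) -/
structure IsCTMC {Ω S : Type*} [MeasurableSpace Ω] [MeasurableSpace S] (μ : Measure Ω)
    (q : S → S → ℝ) (s₀ : S) (Z : ℝ≥0 → Ω → S) : Prop where
  measurable : ∀ t, Measurable (Z t)
  jumpChain_holdingTimes : ∃ (J : ℕ → Ω → S) (H : ℕ → Ω → ℝ),
    (∀ n, Measurable (J n)) ∧ (∀ n, Measurable (H n)) ∧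
    (∀ᵐ ω ∂μ, J 0 ω = s₀) ∧
    (∀ (n : ℕ) (s : ℕ → S) (t : ℕ → ℝ), s 0 = s₀ → (∀ i, 0 ≤ t i) →
      μ {ω | (∀ i ≤ n, J i ω = s i) ∧ ∀ i < n, t i < H i ω} =
        ENNReal.ofReal (∏ i ∈ Finset.range n,
          (q (s i) (s (i + 1)) / exitRate q (s i)) * Real.exp (-(exitRate q (s i) * t i)))) ∧
    (∀ᵐ ω ∂μ, Tendsto (fun n => ∑ i ∈ Finset.range n, H i ω) atTop atTop) ∧
    (∀ᵐ ω ∂μ, ∀ (n : ℕ) (t : ℝ≥0), ∑ i ∈ Finset.range n, H i ω ≤ t →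
      (t : ℝ) < ∑ i ∈ Finset.range (n + 1), H i ω → Z t ω = J n ω)

/-! ### The invitation scheme

A state is a pair `(Y, X)`: `Y` is the agent queue minus the customer queue, `X` is the number of
pending invitations. -/

/-- New state after a customer arrival. -/
def afterArrival (γ : ℕ) (s : ℤ × ℕ) : ℤ × ℕ := (s.1 - 1, s.2 + γ)

/-- New state after the acceptance of an invitation. -/
def afterAcceptance (γ : ℕ) (s : ℤ × ℕ) : ℤ × ℕ := (s.1 + 1, s.2 - min γ s.2)

/-- New state after an additional event: `X` changes by `-sgn Y`, except that it stays at `0` if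
`X = 0` and `Y > 0`. -/
def afterAdditional (s : ℤ × ℕ) : ℤ × ℕ :=
  (s.1, if s.1 < 0 then s.2 + 1 else if 0 < s.1 then s.2 - 1 else s.2)

/-- The jump rates: customers arrive at rate `Λ`, invitations are accepted at rate `β X`, and
additional events occur at rate `ε |Y|`. (An event that does not change the state is no jump.) -/
def invitationRate (Λ β ε : ℝ) (γ : ℕ) (s s' : ℤ × ℕ) : ℝ :=
  if s' = s then 0 else
    (if s' = afterArrival γ s then Λ else 0) +
    (if s' = afterAcceptance γ s then β * (s.2 : ℝ) else 0) +
    (if s' = afterAdditional s then ε * |(s.1 : ℝ)| else 0)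

/-- The centered fluid scaling `r⁻¹ (Y, X - lam r / β)`. -/
def fluidScale (lam β r : ℝ) (s : ℤ × ℕ) : ℝ × ℝ :=
  (r⁻¹ * (s.1 : ℝ), r⁻¹ * ((s.2 : ℝ) - lam * r / β))

/-! ### Fluid trajectories -/

/-- `t` is a regular point of the family `f` of functions of time `t ≥ 0`: all maxima and minima of
subfamilies have a (two-sided) derivative at `t`; in particular `t > 0`. -/
def IsRegularPoint {κ : Type*} (f : κ → ℝ → ℝ) (t : ℝ) : Prop :=
  0 < t ∧ ∀ (A : Finset κ) (hA : A.Nonempty),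
    DifferentiableAt ℝ (fun u => A.sup' hA fun k => f k u) t ∧
    DifferentiableAt ℝ (fun u => A.inf' hA fun k => f k u) t

/-- `(y, x)`, considered on `[0, ∞)`, is a locally Lipschitz trajectory with `x ≥ -lam/β` which at
its regular points follows the linear ODE in the interior and the boundary dynamics at
`x = -lam/β`. -/
structure IsFluidTrajectory (lam β γ ε : ℝ) (y x : ℝ → ℝ) : Prop where
  locallyLipschitz_y : LocallyLipschitzOn (Ici 0) y
  locallyLipschitz_x : LocallyLipschitzOn (Ici 0) x
  bound : ∀ t, 0 ≤ t → -(lam / β) ≤ x t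
  interior : ∀ t, IsRegularPoint ![y, x] t → -(lam / β) < x t →
    HasDerivAt y (β * x t) t ∧ HasDerivAt x (-(γ * β * x t) - ε * y t) t
  boundary : ∀ t, IsRegularPoint ![y, x] t → x t = -(lam / β) →
    HasDerivAt y (-lam) t ∧ HasDerivAt x (max (γ * lam - ε * y t) 0) t

end

open Set Filter Topology MeasureTheory
open scoped NNReal ENNReal

noncomputable section

/-! All systems are driven by the same random data: four independent streams of standard exponential
clocks, one for each kind of event (arrival, acceptance, effective additional event with `Y > 0`,
additional event with `Y < 0`). In a given state each clock runs at the rate of its event, and the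
first to ring decides the jump. By memorylessness the residual clocks after a ring are fresh again
(`clockLaw_advanceClocks`), so the construction yields the required Markov chain
(`clockLaw_clockChain`, `isCTMC_clockProcess`). Since the streams do not depend on `r`, they provide
the common probability space.

The only probabilistic input to the convergence is the strong law for the four streams. On that
single event of probability one everything is deterministic, which is why an arbitrary filter is
harmless. The number of events of kind `i` is the renewal count of stream `i` at its internal time,
the integrated rate; the two differ by at most `δ * a + C δ` at internal time `a`
(`RegularClocks.exists_bound`). An a priori bound (`IsClockPath.le_pathBound`) excludes explosion
and makes the internal times `O(r)`, so the error is `o(r)`.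

With `w = x + lam / β` the fluid equation is a reflected one: `y' = β w - lam` and `w = U + R`,
where `U' = γ lam - γ β w - ε y` and `R` is the running maximum of `max 0 (-U)`. For the chain, the
role of `R` is played by the invitations missing at acceptances with `X < γ` and by the additional
events suppressed at `X = 0`. Both only increase, and only while `X < γ`, so the scaled chain solves
the reflected equation up to a small error (`IsClockPath.nearFluid`).

The running maximum is Lipschitz in the sup norm, so Grönwall's inequality shows that approximate
solutions are close (`NearFluid.dist_le`). This one estimate gives the convergence, the uniqueness,
and also the existence: the scaled chains of a single realization form a Cauchy sequence
(`exists_nearFluid`). Finally, the reflected equation is equivalent to the description through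
derivatives at regular points (`IsFluidTrajectory.nearFluid`, `isFluidTrajectory_of_nearFluid`). -/

/-! ### The standard exponential law -/

open ProbabilityTheory in
instance isProbabilityMeasure_expMeasure_one : IsProbabilityMeasure (expMeasure 1) :=
  isProbabilityMeasure_expMeasure one_pos

theorem lintegral_expMeasure_one (g : ℝ → ℝ≥0∞) (hg : Measurable g) :
    ∫⁻ x, g x ∂(ProbabilityTheory.expMeasure 1) =
      ∫⁻ x in Ioi 0, ENNReal.ofReal (Real.exp (-x)) * g x := by
  have h1 : ProbabilityTheory.expMeasure 1 =
      volume.withDensity (ProbabilityTheory.exponentialPDF 1) := rfl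
  have hm : Measurable (ProbabilityTheory.exponentialPDF 1) :=
    (ProbabilityTheory.measurable_exponentialPDFReal 1).ennreal_ofReal
  rw [h1, lintegral_withDensity_eq_lintegral_mul _ hm hg,
    ← lintegral_indicator measurableSet_Ioi]
  refine lintegral_congr_ae ?_
  have h0 : ∀ᵐ x : ℝ, x ≠ 0 := by simp [ae_iff]
  filter_upwards [h0] with x hx
  rcases lt_or_gt_of_ne hx with h | h
  · simp [ProbabilityTheory.exponentialPDF_of_neg h, not_lt.2 h.le]
  · simp [ProbabilityTheory.exponentialPDF_of_nonneg h.le, h]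

/-- The memoryless property of the exponential distribution. -/
theorem lintegral_expMeasure_one_sub (g : ℝ → ℝ≥0∞) (hg : Measurable g) {a : ℝ} (ha : 0 ≤ a) :
    ∫⁻ x, (Ioi a).indicator (fun x => g (x - a)) x ∂(ProbabilityTheory.expMeasure 1) =
      ENNReal.ofReal (Real.exp (-a)) * ∫⁻ x, g x ∂(ProbabilityTheory.expMeasure 1) := by
  have hg' : Measurable ((Ioi a).indicator fun x => g (x - a)) :=
    Measurable.indicator (by fun_prop) measurableSet_Ioi
  -- Both sides become Lebesgue integrals over the whole line; translation by `a` matches them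
  -- because `exp (-x) = exp (-a) * exp (-(x - a))`.
  rw [lintegral_expMeasure_one _ hg', lintegral_expMeasure_one _ hg,
    ← lintegral_const_mul _ (by fun_prop),
    ← lintegral_indicator measurableSet_Ioi, ← lintegral_indicator measurableSet_Ioi,
    ← lintegral_sub_right_eq_self ((Ioi 0).indicator fun x =>
      ENNReal.ofReal (Real.exp (-a)) * (ENNReal.ofReal (Real.exp (-x)) * g x)) a]
  refine lintegral_congr fun x => ?_
  by_cases hx : a < x
  · have h1 : 0 < x := ha.trans_lt hx
    have h2 : x - a ∈ Ioi (0 : ℝ) := by simp [hx]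
    rw [indicator_of_mem (show x ∈ Ioi (0 : ℝ) from h1), indicator_of_mem h2,
      indicator_of_mem (show x ∈ Ioi a from hx), ← mul_assoc,
      ← ENNReal.ofReal_mul (Real.exp_pos _).le, ← Real.exp_add]
    congr 3; ring
  · have h2 : x - a ∉ Ioi (0 : ℝ) := by simpa using not_lt.1 hx
    rw [indicator_of_notMem h2]
    by_cases h1 : 0 < x
    · rw [indicator_of_mem (show x ∈ Ioi (0 : ℝ) from h1),
        indicator_of_notMem (show x ∉ Ioi a from hx), mul_zero]
    · rw [indicator_of_notMem (show x ∉ Ioi (0 : ℝ) from h1)]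

theorem lintegral_exp_mul_Ioi {c : ℝ} (hc : 0 < c) (a : ℝ) :
    ∫⁻ x in Ioi a, ENNReal.ofReal (Real.exp (-(c * x))) =
      ENNReal.ofReal (c⁻¹ * Real.exp (-(c * a))) := by
  rw [← ofReal_integral_eq_lintegral_ofReal]
  · congr 1
    have := integral_exp_mul_Ioi (a := -c) (by linarith) a
    simp only [neg_mul] at this
    rw [this]; field_simp
  · have := exp_neg_integrableOn_Ioi a hc
    simp only [neg_mul] at this
    exact this
  · exact ae_of_all _ fun x => (Real.exp_pos _).le

/-! ### Streams of exponential clocks -/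

/-- The stream with head `u` and tail `v`. -/
def consStream (u : ℝ) (v : ℕ → ℝ) : ℕ → ℝ := fun k => Nat.casesOn k u v

@[simp] theorem consStream_zero (u : ℝ) (v : ℕ → ℝ) : consStream u v 0 = u := rfl

@[simp] theorem consStream_succ (u : ℝ) (v : ℕ → ℝ) (k : ℕ) : consStream u v (k + 1) = v k := rfl

/-- The stream without its head. -/
def shiftStream (x : ℕ → ℝ) : ℕ → ℝ := fun k => x (k + 1)

@[simp] theorem shiftStream_apply (x : ℕ → ℝ) (k : ℕ) : shiftStream x k = x (k + 1) := rfl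

/-- The stream whose head has been decreased by `a`. -/
def ageStream (a : ℝ) (x : ℕ → ℝ) : ℕ → ℝ := consStream (x 0 - a) (shiftStream x)

@[simp] theorem shiftStream_consStream (u : ℝ) (v : ℕ → ℝ) : shiftStream (consStream u v) = v := rfl

theorem measurable_consStream : Measurable fun p : ℝ × (ℕ → ℝ) => consStream p.1 p.2 := by
  refine measurable_pi_lambda _ fun k => ?_
  cases k with
  | zero => exact measurable_fst
  | succ k => exact (measurable_pi_apply k).comp measurable_snd

theorem measurable_shiftStream : Measurable shiftStream :=
  measurable_pi_lambda _ fun k => measurable_pi_apply (k + 1)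

theorem measurable_ageStream : Measurable fun p : ℝ × (ℕ → ℝ) => ageStream p.1 p.2 :=
  measurable_consStream.comp (((measurable_pi_apply 0).comp measurable_snd |>.sub
    measurable_fst).prodMk (measurable_shiftStream.comp measurable_snd))

/-- The law of a stream of independent standard exponential variables. -/
def streamLaw : Measure (ℕ → ℝ) := Measure.infinitePi fun _ => ProbabilityTheory.expMeasure 1

instance : IsProbabilityMeasure streamLaw := by unfold streamLaw; infer_instance

/-- An infinite product law is determined by finite boxes. Padding a box with `univ` to an initial
segment of coordinates makes it split into a condition on the head and one on the tail. This permits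
Fubini in the head. -/
theorem map_consStream :
    (((ProbabilityTheory.expMeasure 1).prod streamLaw).map fun p => consStream p.1 p.2) =
      streamLaw := by
  refine Measure.eq_infinitePi _ fun s t ht => ?_
  classical
  set t' : ℕ → Set ℝ := fun i => if i ∈ s then t i else univ with ht'
  have hm : ∀ i, MeasurableSet (t' i) := fun i => by
    simp only [ht']; split_ifs; exacts [ht i, .univ]
  obtain ⟨N, hN⟩ : ∃ N, ∀ i ∈ s, i < N + 1 :=
    ⟨s.sup id, fun i hi => Nat.lt_succ_of_le (Finset.le_sup (f := id) hi)⟩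
  have hs : s ⊆ Finset.range (N + 1) := fun i hi => Finset.mem_range.2 (hN i hi)
  have e1 : (Set.pi (s : Set ℕ) t) = Set.pi (Finset.range (N + 1) : Set ℕ) t' := by
    ext x
    simp only [Set.mem_pi, Finset.mem_coe, ht']
    constructor
    · intro h i hi
      split_ifs with h'
      exacts [h i h', trivial]
    · intro h i hi
      simpa [hi] using h i (hs hi)
  have e2 : ∏ i ∈ s, ProbabilityTheory.expMeasure 1 (t i) =
      ∏ i ∈ Finset.range (N + 1), ProbabilityTheory.expMeasure 1 (t' i) := by
    rw [← Finset.prod_subset hs (f := fun i => ProbabilityTheory.expMeasure 1 (t' i))]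
    · exact Finset.prod_congr rfl fun i hi => by simp [ht', hi]
    · intro i _ hi; simp [ht', hi]
  have e3 : (fun p : ℝ × (ℕ → ℝ) => consStream p.1 p.2) ⁻¹'
      (Set.pi (Finset.range (N + 1) : Set ℕ) t') =
      t' 0 ×ˢ Set.pi (Finset.range N : Set ℕ) fun i => t' (i + 1) := by
    ext p
    simp only [mem_preimage, Set.mem_pi, Finset.mem_coe, Finset.mem_range, mem_prod]
    constructor
    · intro h
      exact ⟨h 0 (by omega), fun i hi => h (i + 1) (by omega)⟩
    · rintro ⟨h0, h⟩ i hi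
      cases i with
      | zero => exact h0
      | succ i => exact h i (by omega)
  rw [e1, e2, Measure.map_apply measurable_consStream
    (.pi (Finset.countable_toSet _) fun i _ => hm i), e3, Measure.prod_prod, streamLaw,
    Measure.infinitePi_pi _ fun i _ => hm _, Finset.prod_range_succ', mul_comm]

theorem lintegral_streamLaw (g : (ℕ → ℝ) → ℝ≥0∞) (hg : Measurable g) :
    ∫⁻ x, g x ∂streamLaw =
      ∫⁻ u, ∫⁻ v, g (consStream u v) ∂streamLaw ∂(ProbabilityTheory.expMeasure 1) := by
  conv_lhs => rw [← map_consStream]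
  rw [lintegral_map hg measurable_consStream]
  exact lintegral_prod _ (hg.comp measurable_consStream).aemeasurable

/-- Only the head is aged, so after integrating out the tail this is the memoryless property of one
exponential variable. -/
theorem streamLaw_ageStream {a : ℝ} (ha : 0 ≤ a) {B : Set (ℕ → ℝ)} (hB : MeasurableSet B) :
    streamLaw {x | a < x 0 ∧ ageStream a x ∈ B} =
      ENNReal.ofReal (Real.exp (-a)) * streamLaw B := by
  have hage : Measurable (ageStream a) := measurable_ageStream.comp measurable_prodMk_left
  have hm : MeasurableSet {x : ℕ → ℝ | a < x 0 ∧ ageStream a x ∈ B} :=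
    (measurableSet_lt measurable_const (measurable_pi_apply 0)).inter (hage hB)
  have hBm : Measurable (B.indicator (1 : (ℕ → ℝ) → ℝ≥0∞)) := measurable_one.indicator hB
  rw [← lintegral_indicator_one hm, ← lintegral_indicator_one hB,
    lintegral_streamLaw _ (measurable_one.indicator hm), lintegral_streamLaw _ hBm,
    ← lintegral_expMeasure_one_sub
      (fun u => ∫⁻ v, B.indicator 1 (consStream u v) ∂streamLaw)
      (hBm.comp measurable_consStream).lintegral_prod_right' ha]
  refine lintegral_congr fun u => ?_
  by_cases hu : a < u
  · rw [indicator_of_mem (show u ∈ Ioi a from hu)]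
    refine lintegral_congr fun v => ?_
    simp only [indicator, ageStream, mem_ofPred_eq, consStream_zero, shiftStream_consStream,
      Pi.one_apply]
    split_ifs <;> simp_all
  · rw [indicator_of_notMem (show u ∉ Ioi a from hu)]
    simp [indicator, hu]

/-! ### Competing clocks -/

/-- The law of independent streams of standard exponential clocks, one stream for each event. -/
def clockLaw (m : ℕ) : Measure (Fin (m + 1) → ℕ → ℝ) := Measure.pi fun _ => streamLaw

instance (m : ℕ) : IsProbabilityMeasure (clockLaw m) := by unfold clockLaw; infer_instance

/-- The streams after the event `j` has occurred when the clocks run with speeds `q`. -/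
def advanceClocks {m : ℕ} (q : Fin (m + 1) → ℝ) (j : Fin (m + 1)) (w : Fin (m + 1) → ℕ → ℝ) :
    Fin (m + 1) → ℕ → ℝ :=
  fun i => if i = j then shiftStream (w j) else ageStream (q i * (w j 0 / q j)) (w i)

theorem measurable_advanceClocks {m : ℕ} (q : Fin (m + 1) → ℝ) (j : Fin (m + 1)) :
    Measurable (advanceClocks q j) := by
  refine measurable_pi_lambda _ fun i => ?_
  unfold advanceClocks
  by_cases h : i = j
  · simp only [h, if_true]
    exact measurable_shiftStream.comp (measurable_pi_apply j)
  · simp only [h, if_false]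
    refine measurable_ageStream.comp (Measurable.prodMk ?_ (measurable_pi_apply i))
    fun_prop

/-- The clock `j` rings strictly before all the others when the clocks run with speeds `q`. -/
def RingsFirst {m : ℕ} (q : Fin (m + 1) → ℝ) (j : Fin (m + 1)) (w : Fin (m + 1) → ℕ → ℝ) : Prop :=
  0 < q j ∧ ∀ i, i ≠ j → q i * w j 0 < q j * w i 0

theorem measurableSet_ringsFirst {m : ℕ} (q : Fin (m + 1) → ℝ) (j : Fin (m + 1)) :
    MeasurableSet {w | RingsFirst q j w} := by
  have h : ∀ i, MeasurableSet {w : Fin (m + 1) → ℕ → ℝ | i ≠ j → q i * w j 0 < q j * w i 0} := by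
    intro i
    by_cases hi : i = j
    · simp [hi]
    · simpa [hi] using measurableSet_lt (by fun_prop) (by fun_prop)
  have e : {w | RingsFirst q j w} = {_w | 0 < q j} ∩
      ⋂ i, {w : Fin (m + 1) → ℕ → ℝ | i ≠ j → q i * w j 0 < q j * w i 0} := by
    ext w; simp [RingsFirst]
  rw [e]
  exact (MeasurableSet.const _).inter (MeasurableSet.iInter h)

/-- Condition on the head `u` of stream `j`. The other streams must survive to age `q i * u / q j`,
independently, and `streamLaw_ageStream` gives each a factor `exp (-(q i * u / q j))` and a fresh
residual. With the density `exp (-u)` the exponents add up to `-(∑ i, q i) / q j * u`, which is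
integrated over `u > q j * t`. -/
theorem clockLaw_advanceClocks_box {m : ℕ} (q : Fin (m + 1) → ℝ) (hq : ∀ i, 0 ≤ q i)
    {j : Fin (m + 1)} (hj : 0 < q j) {t : ℝ} (ht : 0 ≤ t) (B : Fin (m + 1) → Set (ℕ → ℝ))
    (hB : ∀ i, MeasurableSet (B i)) :
    clockLaw m {w | RingsFirst q j w ∧ t < w j 0 / q j ∧ advanceClocks q j w ∈ Set.pi univ B} =
      ENNReal.ofReal (q j / (∑ i, q i) * Real.exp (-((∑ i, q i) * t))) *
        ∏ i, streamLaw (B i) := by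
  set D : Fin m → ℝ → Set (ℕ → ℝ) := fun i u =>
    {z | q (j.succAbove i) * u / q j < z 0 ∧ ageStream (q (j.succAbove i) * u / q j) z ∈
      B (j.succAbove i)} with hD
  set E : Set ((ℕ → ℝ) × (Fin m → ℕ → ℝ)) :=
    {p | q j * t < p.1 0 ∧ shiftStream p.1 ∈ B j ∧ ∀ i, p.2 i ∈ D i (p.1 0)} with hE
  have hEm : MeasurableSet E := by
    have h1 : MeasurableSet {p : (ℕ → ℝ) × (Fin m → ℕ → ℝ) | q j * t < p.1 0} :=
      measurableSet_lt (by fun_prop) (by fun_prop)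
    have h2 : MeasurableSet {p : (ℕ → ℝ) × (Fin m → ℕ → ℝ) | shiftStream p.1 ∈ B j} :=
      (measurable_shiftStream.comp measurable_fst) (hB j)
    have h3 : ∀ i, MeasurableSet {p : (ℕ → ℝ) × (Fin m → ℕ → ℝ) |
        q (j.succAbove i) * p.1 0 / q j < p.2 i 0} := fun i =>
      measurableSet_lt (by fun_prop) (by fun_prop)
    have h4 : ∀ i, MeasurableSet {p : (ℕ → ℝ) × (Fin m → ℕ → ℝ) |
        ageStream (q (j.succAbove i) * p.1 0 / q j) (p.2 i) ∈ B (j.succAbove i)} := by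
      intro i
      have : Measurable fun p : (ℕ → ℝ) × (Fin m → ℕ → ℝ) =>
          ageStream (q (j.succAbove i) * p.1 0 / q j) (p.2 i) :=
        measurable_ageStream.comp (Measurable.prodMk (by fun_prop) (by fun_prop))
      exact this (hB _)
    convert h1.inter (h2.inter (MeasurableSet.iInter fun i => (h3 i).inter (h4 i))) using 1
    ext p; simp [hE, hD]
  have hpre : {w | RingsFirst q j w ∧ t < w j 0 / q j ∧ advanceClocks q j w ∈ Set.pi univ B} =
      (MeasurableEquiv.piFinSuccAbove (fun _ => ℕ → ℝ) j) ⁻¹' E := by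
    ext w
    simp only [mem_ofPred_eq, RingsFirst, Set.mem_pi, mem_univ, forall_true_left, mem_preimage, hE,
      hD, MeasurableEquiv.piFinSuccAbove_apply, Fin.removeNth, Fin.insertNthEquiv_symm_apply,
      j.forall_iff_succAbove, advanceClocks, if_true, ne_eq, not_true_eq_false, false_implies,
      true_and, Fin.succAbove_ne, not_false_eq_true, if_false, hj, lt_div_iff₀ hj,
      div_lt_iff₀ hj, mul_div_assoc']
    constructor
    · rintro ⟨h1, h2, h3, h4⟩
      exact ⟨by linarith, h3, fun i => ⟨by linarith [h1 i], h4 i⟩⟩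
    · rintro ⟨h2, h3, h4⟩
      exact ⟨fun i => by linarith [(h4 i).1], by linarith, h3, fun i => (h4 i).2⟩
  have hQ : 0 < ∑ i, q i := hj.trans_le (Finset.single_le_sum (fun i _ => hq i) (Finset.mem_univ j))
  rw [hpre, clockLaw,
    (measurePreserving_piFinSuccAbove (fun _ => streamLaw) j).measure_preimage
      hEm.nullMeasurableSet, Measure.prod_apply hEm]
  set R : ℝ := ∑ i : Fin m, q (j.succAbove i) with hR
  have hsum : ∑ i, q i = q j + R := Fin.sum_univ_succAbove _ j
  have hin : ∀ x : ℕ → ℝ, 0 ≤ x 0 → (Measure.pi fun _ : Fin m => streamLaw) (Prod.mk x ⁻¹' E) =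
      (Ioi (q j * t)).indicator (fun u => ENNReal.ofReal (Real.exp (-(R / q j * u)))) (x 0) *
        ((B j).indicator 1 (shiftStream x) * ∏ i, streamLaw (B (j.succAbove i))) := by
    intro x hx
    by_cases h1 : q j * t < x 0
    swap
    · simp [hE, h1]
    by_cases h2 : shiftStream x ∈ B j
    swap
    · simp [hE, h2]
    have : Prod.mk x ⁻¹' E = Set.pi univ fun i => D i (x 0) := by
      ext v; simp [hE, h1, h2]
    rw [this, Measure.pi_pi]
    simp only [hD]
    have h0 : ∀ i, 0 ≤ q (j.succAbove i) * x 0 / q j := fun i =>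
      div_nonneg (mul_nonneg (hq _) hx) hj.le
    simp only [fun i => streamLaw_ageStream (h0 i) (hB (j.succAbove i)), Finset.prod_mul_distrib]
    rw [← ENNReal.ofReal_prod_of_nonneg fun i _ => (Real.exp_pos _).le, ← Real.exp_sum]
    rw [indicator_of_mem (show x 0 ∈ Ioi (q j * t) from h1), indicator_of_mem h2]
    simp only [Pi.one_apply, one_mul]
    congr 3
    rw [Finset.sum_neg_distrib, hR, Finset.sum_div, Finset.sum_mul]
    congr 1
    exact Finset.sum_congr rfl fun i _ => by ring
  have hmeas : Measurable fun x : ℕ → ℝ =>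
      (Ioi (q j * t)).indicator (fun u => ENNReal.ofReal (Real.exp (-(R / q j * u)))) (x 0) *
        ((B j).indicator 1 (shiftStream x) * ∏ i, streamLaw (B (j.succAbove i))) := by
    refine Measurable.mul (Measurable.comp (Measurable.indicator (by fun_prop) measurableSet_Ioi)
      (measurable_pi_apply 0)) (Measurable.mul_const ?_ _)
    exact (measurable_one.indicator (hB j)).comp measurable_shiftStream
  rw [lintegral_streamLaw _ (measurable_measure_prodMk_left hEm)]
  have hprod : ∏ i, streamLaw (B i) = streamLaw (B j) * ∏ i, streamLaw (B (j.succAbove i)) :=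
    Fin.prod_univ_succAbove _ j
  have hstep : ∀ u : ℝ, 0 < u →
      ∫⁻ v, (Measure.pi fun _ : Fin m => streamLaw) (Prod.mk (consStream u v) ⁻¹' E) ∂streamLaw =
      (Ioi (q j * t)).indicator (fun u => ENNReal.ofReal (Real.exp (-(R / q j * u)))) u *
        ∏ i, streamLaw (B i) := by
    intro u hu
    simp only [fun v => hin (consStream u v) (by simpa using hu.le), consStream_zero,
      shiftStream_consStream]
    rw [lintegral_const_mul _ (Measurable.mul_const (measurable_one.indicator (hB j)) _),
      lintegral_mul_const _ (measurable_one.indicator (hB j)), lintegral_indicator_one (hB j),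
      hprod]
  have hmE : Measurable fun u : ℝ => ∫⁻ v, (Measure.pi fun _ : Fin m => streamLaw)
      (Prod.mk (consStream u v) ⁻¹' E) ∂streamLaw :=
    Measurable.lintegral_prod_right'
      (f := fun p : ℝ × (ℕ → ℝ) => (Measure.pi fun _ : Fin m => streamLaw)
        (Prod.mk (consStream p.1 p.2) ⁻¹' E))
      ((measurable_measure_prodMk_left hEm).comp measurable_consStream)
  rw [lintegral_expMeasure_one _ hmE, setLIntegral_congr_fun measurableSet_Ioi (g := fun u =>
      (Ioi (q j * t)).indicator (fun u => ENNReal.ofReal (Real.exp (-((∑ i, q i) / q j * u)))) u *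
        ∏ i, streamLaw (B i))]
  · rw [lintegral_mul_const _ (Measurable.indicator (by fun_prop) measurableSet_Ioi),
      lintegral_indicator measurableSet_Ioi, Measure.restrict_restrict measurableSet_Ioi,
      inter_eq_left.2 (Ioi_subset_Ioi (mul_nonneg hj.le ht)), lintegral_exp_mul_Ioi (by positivity)]
    congr 3
    · field_simp
    · congr 2; field_simp
  · intro u hu
    simp only [hstep u hu]
    rw [← mul_assoc]
    congr 1
    by_cases h1 : q j * t < u
    · rw [indicator_of_mem (show u ∈ Ioi (q j * t) from h1),
        indicator_of_mem (show u ∈ Ioi (q j * t) from h1),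
        ← ENNReal.ofReal_mul (Real.exp_pos _).le, ← Real.exp_add, hsum]
      congr 2; field_simp; ring
    · rw [indicator_of_notMem (show u ∉ Ioi (q j * t) from h1),
        indicator_of_notMem (show u ∉ Ioi (q j * t) from h1), mul_zero]

/-- When the clock `j` rings first, the residual clocks are again independent and exponential. -/
theorem clockLaw_advanceClocks {m : ℕ} (q : Fin (m + 1) → ℝ) (hq : ∀ i, 0 ≤ q i)
    {j : Fin (m + 1)} (hj : 0 < q j) {t : ℝ} (ht : 0 ≤ t) {B : Set (Fin (m + 1) → ℕ → ℝ)}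
    (hB : MeasurableSet B) :
    clockLaw m {w | RingsFirst q j w ∧ t < w j 0 / q j ∧ advanceClocks q j w ∈ B} =
      ENNReal.ofReal (q j / (∑ i, q i) * Real.exp (-((∑ i, q i) * t))) * clockLaw m B := by
  set c := ENNReal.ofReal (q j / (∑ i, q i) * Real.exp (-((∑ i, q i) * t))) with hc
  set A : Set (Fin (m + 1) → ℕ → ℝ) := {w | RingsFirst q j w ∧ t < w j 0 / q j} with hA
  have hAm : MeasurableSet A := by
    have h : MeasurableSet {w : Fin (m + 1) → ℕ → ℝ | t < w j 0 / q j} :=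
      measurableSet_lt (by fun_prop) (by fun_prop)
    exact (measurableSet_ringsFirst q j).inter h
  have key : ∀ B : Set (Fin (m + 1) → ℕ → ℝ), MeasurableSet B →
      ((clockLaw m).restrict A).map (advanceClocks q j) B =
        clockLaw m {w | RingsFirst q j w ∧ t < w j 0 / q j ∧ advanceClocks q j w ∈ B} := by
    intro B hB
    rw [Measure.map_apply (measurable_advanceClocks q j) hB,
      Measure.restrict_apply (measurable_advanceClocks q j hB)]
    congr 1
    ext w; simp only [hA, mem_inter_iff, mem_preimage, mem_ofPred_eq]; tauto
  suffices h : ((clockLaw m).restrict A).map (advanceClocks q j) = c • clockLaw m by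
    rw [← key B hB, h]; rfl
  have : IsFiniteMeasure (c • clockLaw m) := ⟨by
    rw [Measure.smul_apply, measure_univ]; simp [hc]⟩
  refine ext_of_generate_finite _ generateFrom_pi.symm isPiSystem_pi ?_ ?_
  · rintro _ ⟨s, hs, rfl⟩
    have hs' : ∀ i, MeasurableSet (s i) := fun i => hs i (mem_univ i)
    rw [key _ (MeasurableSet.univ_pi hs'), clockLaw_advanceClocks_box q hq hj ht s hs',
      Measure.smul_apply, clockLaw, Measure.pi_pi, smul_eq_mul]
  · have := clockLaw_advanceClocks_box q hq hj ht (fun _ => univ) fun _ => .univ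
    rw [Set.pi_univ univ] at this
    rw [key _ .univ, this, Measure.smul_apply]
    simp [hc]

open Classical in
/-- The jump rates of the chain in which the event `j` occurs at rate `rate j s` and leads from
`s` to `next j s`. -/
def eventJumpRate {S : Type*} {m : ℕ} (rate : Fin (m + 1) → S → ℝ) (next : Fin (m + 1) → S → S)
    (s s' : S) : ℝ := ∑ j, if s' = next j s then rate j s else 0

theorem exitRate_eventJumpRate {S : Type*} {m : ℕ} (rate : Fin (m + 1) → S → ℝ)
    (next : Fin (m + 1) → S → S) (s : S) :
    exitRate (eventJumpRate rate next) s = ∑ j, rate j s := by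
  classical
  have h : HasSum (eventJumpRate rate next s) (∑ j, rate j s) :=
    hasSum_sum fun j _ => by
      have := hasSum_ite_eq (next j s) (rate j s)
      convert this
  exact h.tsum_eq

/-- A clock that rings first when the clocks run with speeds `q`. -/
def firstRing {m : ℕ} (q : Fin (m + 1) → ℝ) (w : Fin (m + 1) → ℕ → ℝ) : Fin (m + 1) :=
  Classical.epsilon fun j => 0 < q j ∧ ∀ i, q i * w j 0 ≤ q j * w i 0

theorem measurable_firstRing {m : ℕ} (q : Fin (m + 1) → ℝ) : Measurable (firstRing q) := by
  classical
  have h : Measurable fun (w : Fin (m + 1) → ℕ → ℝ) (j : Fin (m + 1)) =>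
      (0 < q j ∧ ∀ i, q i * w j 0 ≤ q j * w i 0) := by
    refine measurable_pi_lambda _ fun j => measurable_to_prop ?_
    have h1 : MeasurableSet ({_w : Fin (m + 1) → ℕ → ℝ | 0 < q j} ∩
        ⋂ i, {w | q i * w j 0 ≤ q j * w i 0}) :=
      (MeasurableSet.const _).inter (MeasurableSet.iInter fun i =>
        measurableSet_le (by fun_prop) (by fun_prop))
    convert h1 using 1
    ext w; simp
  -- The choice depends on `w` only through the set of minimal clocks, an element of a finite space.
  exact (measurable_of_countable (Classical.epsilon : (Fin (m + 1) → Prop) → Fin (m + 1))).comp h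

/-- Minimize `w j 0 / q j` over the running clocks. In cross-multiplied form the comparison with a
clock of speed `0` holds trivially. -/
theorem firstRing_spec {m : ℕ} {q : Fin (m + 1) → ℝ} (hq : ∀ i, 0 ≤ q i) (hQ : 0 < ∑ i, q i)
    {w : Fin (m + 1) → ℕ → ℝ} (hw : ∀ i, 0 ≤ w i 0) :
    0 < q (firstRing q w) ∧ ∀ i, q i * w (firstRing q w) 0 ≤ q (firstRing q w) * w i 0 := by
  classical
  refine Classical.epsilon_spec (p := fun j => 0 < q j ∧ ∀ i, q i * w j 0 ≤ q j * w i 0) ?_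
  obtain ⟨k, hk⟩ : ∃ k, 0 < q k := by
    by_contra! h
    exact hQ.not_ge (Finset.sum_nonpos fun i _ => h i)
  obtain ⟨j, hj, hmin⟩ := (Finset.univ.filter fun j => 0 < q j).exists_min_image
    (fun j => w j 0 / q j) ⟨k, by simpa using hk⟩
  simp only [Finset.mem_filter, Finset.mem_univ, true_and] at hj hmin
  refine ⟨j, hj, fun i => ?_⟩
  rcases (hq i).eq_or_lt with h | h
  · rw [← h, zero_mul]; exact mul_nonneg hj.le (hw i)
  · have := hmin i h
    rw [div_le_div_iff₀ hj h] at this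
    linarith

theorem firstRing_eq_of_ringsFirst {m : ℕ} {q : Fin (m + 1) → ℝ} {j : Fin (m + 1)}
    {w : Fin (m + 1) → ℕ → ℝ} (h : RingsFirst q j w) : firstRing q w = j := by
  have h1 := Classical.epsilon_spec (p := fun j => 0 < q j ∧ ∀ i, q i * w j 0 ≤ q j * w i 0)
    ⟨j, h.1, fun i => by
      by_cases hi : i = j
      · rw [hi]
      · exact (h.2 i hi).le⟩
  by_contra hne
  exact absurd (h1.2 j) (not_le.2 (h.2 _ hne))

/-- Ties need no separate treatment: the events that `j` rings strictly first are disjoint and have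
probabilities at least `q j / ∑ i, q i`, which already sum to one. -/
theorem ae_exists_ringsFirst {m : ℕ} {q : Fin (m + 1) → ℝ} (hq : ∀ i, 0 ≤ q i)
    (hQ : 0 < ∑ i, q i) : ∀ᵐ w ∂clockLaw m, ∃ j, RingsFirst q j w := by
  have hdis : Pairwise (Function.onFun Disjoint fun j => {w | RingsFirst q j w}) := by
    intro i j hij
    refine disjoint_left.2 fun w hi hj => hij ?_
    exact (firstRing_eq_of_ringsFirst hi).symm.trans (firstRing_eq_of_ringsFirst hj)
  have h1 : (1 : ℝ≥0∞) ≤ clockLaw m (⋃ j, {w | RingsFirst q j w}) := by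
    rw [measure_iUnion hdis fun j => measurableSet_ringsFirst q j, tsum_fintype]
    calc (1 : ℝ≥0∞) = ∑ j, ENNReal.ofReal (q j / ∑ i, q i) := by
          rw [← ENNReal.ofReal_sum_of_nonneg fun i _ => div_nonneg (hq i) hQ.le,
            ← Finset.sum_div, div_self hQ.ne', ENNReal.ofReal_one]
      _ ≤ _ := by
          refine Finset.sum_le_sum fun j _ => ?_
          rcases (hq j).eq_or_lt with h | h
          · simp [← h]
          · have := clockLaw_advanceClocks q hq h le_rfl MeasurableSet.univ
            rw [measure_univ, mul_one, mul_zero, neg_zero, Real.exp_zero, mul_one] at this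
            rw [← this]
            exact measure_mono fun w hw => hw.1
  have h2 : clockLaw m (⋃ j, {w | RingsFirst q j w}) = 1 := le_antisymm prob_le_one h1
  have h3 := (prob_compl_eq_zero_iff
    (MeasurableSet.iUnion fun j => measurableSet_ringsFirst q j)).2 h2
  rw [ae_iff]
  convert h3 using 2
  ext w; simp

/-! ### The Markov chain built from competing clocks -/

section Chain

variable {S : Type*} {m : ℕ} (rate : Fin (m + 1) → S → ℝ) (next : Fin (m + 1) → S → S)

/-- The event that occurs first. -/
def clockEvent (p : S × (Fin (m + 1) → ℕ → ℝ)) : Fin (m + 1) :=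
  firstRing (fun i => rate i p.1) p.2

/-- The time until the first event. -/
def clockHold (p : S × (Fin (m + 1) → ℕ → ℝ)) : ℝ :=
  p.2 (clockEvent rate p) 0 / rate (clockEvent rate p) p.1

/-- The state and the clocks right after the first event. -/
def clockStep (p : S × (Fin (m + 1) → ℕ → ℝ)) : S × (Fin (m + 1) → ℕ → ℝ) :=
  (next (clockEvent rate p) p.1, advanceClocks (fun i => rate i p.1) (clockEvent rate p) p.2)

/-- The jump chain driven by competing clocks. -/
def clockChain (s : S) (n : ℕ) (w : Fin (m + 1) → ℕ → ℝ) : S :=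
  ((clockStep rate next)^[n] (s, w)).1

/-- The holding times of the chain driven by competing clocks. -/
def clockHolding (s : S) (n : ℕ) (w : Fin (m + 1) → ℕ → ℝ) : ℝ :=
  clockHold rate ((clockStep rate next)^[n] (s, w))

theorem clockChain_succ (s : S) (n : ℕ) (w : Fin (m + 1) → ℕ → ℝ) :
    clockChain rate next s (n + 1) w =
      clockChain rate next (clockStep rate next (s, w)).1 n (clockStep rate next (s, w)).2 := by
  simp [clockChain, Function.iterate_succ_apply]

theorem clockHolding_succ (s : S) (n : ℕ) (w : Fin (m + 1) → ℕ → ℝ) :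
    clockHolding rate next s (n + 1) w =
      clockHolding rate next (clockStep rate next (s, w)).1 n (clockStep rate next (s, w)).2 := by
  simp [clockHolding, Function.iterate_succ_apply]

variable [MeasurableSpace S] [DiscreteMeasurableSpace S] [Countable S]

theorem measurable_clockEvent : Measurable (clockEvent (m := m) rate) :=
  measurable_from_prod_countable_right fun s => measurable_firstRing fun i => rate i s

theorem measurable_clockHold : Measurable (clockHold (m := m) rate) := by
  have h : Measurable fun p : (Fin (m + 1) × S) × (Fin (m + 1) → ℕ → ℝ) =>
      p.2 p.1.1 0 / rate p.1.1 p.1.2 :=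
    measurable_from_prod_countable_right fun p => by dsimp only; fun_prop
  exact h.comp (((measurable_clockEvent rate).prodMk measurable_fst).prodMk measurable_snd)

theorem measurable_clockStep : Measurable (clockStep (m := m) rate next) := by
  have h : Measurable fun p : (Fin (m + 1) × S) × (Fin (m + 1) → ℕ → ℝ) =>
      (next p.1.1 p.1.2, advanceClocks (fun i => rate i p.1.2) p.1.1 p.2) :=
    measurable_from_prod_countable_right fun p =>
      (measurable_const (a := next p.1 p.2)).prodMk
        (measurable_advanceClocks (fun i => rate i p.2) p.1)
  exact h.comp (((measurable_clockEvent rate).prodMk measurable_fst).prodMk measurable_snd)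

theorem measurable_clockChain (s : S) (n : ℕ) : Measurable (clockChain rate next s n) :=
  measurable_fst.comp (((measurable_clockStep rate next).iterate n).comp measurable_prodMk_left)

theorem measurable_clockHolding (s : S) (n : ℕ) : Measurable (clockHolding rate next s n) :=
  (measurable_clockHold rate).comp
    (((measurable_clockStep rate next).iterate n).comp measurable_prodMk_left)

/-- The jump chain and the holding times of the chain driven by competing exponential clocks
have the law of a continuous-time Markov chain. -/
theorem clockLaw_clockChain (hrate : ∀ i s, 0 ≤ rate i s) (hpos : ∀ s, 0 < ∑ i, rate i s) (n : ℕ)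
    (s : ℕ → S) (t : ℕ → ℝ) (ht : ∀ i, 0 ≤ t i) :
    clockLaw m {w | (∀ i ≤ n, clockChain rate next (s 0) i w = s i) ∧
        ∀ i < n, t i < clockHolding rate next (s 0) i w} =
      ENNReal.ofReal (∏ i ∈ Finset.range n,
        (eventJumpRate rate next (s i) (s (i + 1)) / exitRate (eventJumpRate rate next) (s i)) *
          Real.exp (-(exitRate (eventJumpRate rate next) (s i) * t i))) := by
  classical
  induction n generalizing s t with
  | zero =>
    have : {w : Fin (m + 1) → ℕ → ℝ | (∀ i ≤ 0, clockChain rate next (s 0) i w = s i) ∧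
        ∀ i < 0, t i < clockHolding rate next (s 0) i w} = univ := by
      ext w; simp [clockChain]
    rw [this]; simp
  | succ n ih =>
    set q : Fin (m + 1) → ℝ := fun i => rate i (s 0) with hqdef
    have hq : ∀ i, 0 ≤ q i := fun i => hrate i _
    have hQ : 0 < ∑ i, q i := hpos _
    set F : Set (Fin (m + 1) → ℕ → ℝ) :=
      {w | (∀ i ≤ n + 1, clockChain rate next (s 0) i w = s i) ∧
        ∀ i < n + 1, t i < clockHolding rate next (s 0) i w} with hF
    set G : Set (Fin (m + 1) → ℕ → ℝ) :=
      {w | (∀ i ≤ n, clockChain rate next (s 1) i w = s (i + 1)) ∧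
        ∀ i < n, t (i + 1) < clockHolding rate next (s 1) i w} with hG
    have hmeas : ∀ (n : ℕ) (s₀ : S) (s : ℕ → S) (t : ℕ → ℝ), MeasurableSet
        {w | (∀ i ≤ n, clockChain rate next s₀ i w = s i) ∧
          ∀ i < n, t i < clockHolding rate next s₀ i w} := by
      intro n s₀ s t
      have h : MeasurableSet ((⋂ i ∈ Iic n, {w | clockChain rate next s₀ i w = s i}) ∩
          ⋂ i ∈ Iio n, {w | t i < clockHolding rate next s₀ i w}) := by
        refine (MeasurableSet.biInter (to_countable _) fun i _ => ?_).inter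
          (MeasurableSet.biInter (to_countable _) fun i _ => ?_)
        · exact measurable_clockChain rate next s₀ i (measurableSet_singleton (s i))
        · exact measurableSet_lt measurable_const (measurable_clockHolding rate next s₀ i)
      convert h using 1
      ext w; simp
    -- First-step decomposition: once `j` rings first, `F` is a condition on the first holding time
    -- together with the event `G` of the induction hypothesis, evaluated at the advanced clocks.
    have hstep : ∀ j w, RingsFirst q j w → (w ∈ F ↔
        next j (s 0) = s 1 ∧ t 0 < w j 0 / q j ∧ advanceClocks q j w ∈ G) := by
      intro j w hj
      have e : clockEvent rate (s 0, w) = j := firstRing_eq_of_ringsFirst hj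
      have e1 : clockStep rate next (s 0, w) = (next j (s 0), advanceClocks q j w) := by
        simp only [clockStep, e, hqdef]
      have e2 : clockHolding rate next (s 0) 0 w = w j 0 / q j := by
        simp [clockHolding, clockHold, e, hqdef]
      simp only [hF, hG, mem_ofPred_eq]
      constructor
      · rintro ⟨h1, h2⟩
        have h3 : next j (s 0) = s 1 := by
          have := h1 1 (by omega)
          rwa [clockChain_succ, e1] at this
        refine ⟨h3, by rw [← e2]; exact h2 0 (by omega), fun i hi => ?_, fun i hi => ?_⟩
        · have := h1 (i + 1) (by omega)
          rwa [clockChain_succ, e1, h3] at this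
        · have := h2 (i + 1) (by omega)
          rwa [clockHolding_succ, e1, h3] at this
      · rintro ⟨h3, h4, h5, h6⟩
        refine ⟨fun i hi => ?_, fun i hi => ?_⟩
        · cases i with
          | zero => rfl
          | succ i =>
            rw [clockChain_succ, e1, h3]
            exact h5 i (by omega)
        · cases i with
          | zero => rw [e2]; exact h4
          | succ i =>
            rw [clockHolding_succ, e1, h3]
            exact h6 i (by omega)
    have hG' : clockLaw m G = _ := ih (fun i => s (i + 1)) (fun i => t (i + 1)) fun i => ht _
    have hcover : clockLaw m F = clockLaw m (⋃ j, F ∩ {w | RingsFirst q j w}) := by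
      refine measure_congr ?_
      filter_upwards [ae_exists_ringsFirst hq hQ] with w hw
      have : w ∈ F ↔ w ∈ ⋃ j, F ∩ {w | RingsFirst q j w} := by
        simp only [mem_iUnion, mem_inter_iff, mem_ofPred_eq, exists_and_left, hw, and_true]
      exact propext this
    have hdis : Pairwise (Function.onFun Disjoint fun j => F ∩ {w | RingsFirst q j w}) := by
      intro i j hij
      refine disjoint_left.2 fun w hi hj => hij ?_
      exact (firstRing_eq_of_ringsFirst hi.2).symm.trans (firstRing_eq_of_ringsFirst hj.2)
    -- Several events may lead to the same state `s 1`; summing these terms over `j` assembles the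
    -- jump rate.
    have hterm : ∀ j, clockLaw m (F ∩ {w | RingsFirst q j w}) =
        ENNReal.ofReal ((if s 1 = next j (s 0) then q j else 0) / (∑ i, q i) *
          Real.exp (-((∑ i, q i) * t 0))) * clockLaw m G := by
      intro j
      rcases (hq j).eq_or_lt with h0 | h0
      · have : F ∩ {w | RingsFirst q j w} = ∅ := by
          ext w
          simp only [mem_inter_iff, mem_ofPred_eq, mem_empty_iff_false, iff_false, not_and]
          exact fun _ h => h0.not_lt h.1
        rw [this]; simp [← h0]
      · by_cases h1 : s 1 = next j (s 0)
        · rw [if_pos h1, ← clockLaw_advanceClocks q hq h0 (ht 0) (hmeas _ _ _ _)]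
          congr 1
          ext w
          simp only [mem_inter_iff, mem_ofPred_eq]
          constructor
          · rintro ⟨h2, h3⟩
            exact ⟨h3, ((hstep j w h3).1 h2).2⟩
          · rintro ⟨h2, h3⟩
            exact ⟨(hstep j w h2).2 ⟨h1.symm, h3⟩, h2⟩
        · have : F ∩ {w | RingsFirst q j w} = ∅ := by
            ext w
            simp only [mem_inter_iff, mem_ofPred_eq, mem_empty_iff_false, iff_false, not_and]
            exact fun h2 h3 => h1 ((hstep j w h3).1 h2).1.symm
          rw [this]; simp [h1]
    rw [hcover, measure_iUnion hdis fun j => (hmeas _ _ _ _).inter (measurableSet_ringsFirst q j),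
      tsum_fintype, Finset.sum_congr rfl fun j _ => hterm j, ← Finset.sum_mul,
      ← ENNReal.ofReal_sum_of_nonneg, ← Finset.sum_mul, ← Finset.sum_div, hG',
      ← ENNReal.ofReal_mul, Finset.prod_range_succ', mul_comm, exitRate_eventJumpRate]
    · rfl
    · refine mul_nonneg (div_nonneg (Finset.sum_nonneg fun j _ => ?_) hQ.le) (Real.exp_pos _).le
      split_ifs
      exacts [hq j, le_rfl]
    · intro j _
      refine mul_nonneg (div_nonneg ?_ hQ.le) (Real.exp_pos _).le
      split_ifs
      exacts [hq j, le_rfl]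

end Chain

/-! ### The process with given jump chain and holding times -/

/-- The number of jumps up to time `t` when the holding times are `H`. -/
def jumpIndex (H : ℕ → ℝ) (t : ℝ) : ℕ := sInf {n | t < ∑ i ∈ Finset.range (n + 1), H i}

theorem jumpIndex_eq {H : ℕ → ℝ} (hH : ∀ n, 0 ≤ H n) {n : ℕ} {t : ℝ}
    (h1 : ∑ i ∈ Finset.range n, H i ≤ t) (h2 : t < ∑ i ∈ Finset.range (n + 1), H i) :
    jumpIndex H t = n := by
  refine le_antisymm (Nat.sInf_le h2) (le_csInf ⟨n, h2⟩ fun k (hk : t < _) => ?_)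
  by_contra! hkn
  exact absurd (h1.trans_lt hk) (not_lt.2 (Finset.sum_le_sum_of_subset_of_nonneg
    (Finset.range_subset_range.2 hkn) fun i _ _ => hH i))

theorem measurable_jumpIndex {Ω : Type*} [MeasurableSpace Ω] {H : ℕ → Ω → ℝ}
    (hH : ∀ n, Measurable (H n)) (t : ℝ) : Measurable fun w => jumpIndex (fun n => H n w) t := by
  classical
  -- The second alternative makes `Nat.find` return `0` when no partial sum exceeds `t`, in
  -- agreement with `sInf ∅ = 0`.
  have hex : ∀ w, ∃ n, t < ∑ i ∈ Finset.range (n + 1), H i w ∨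
      ∀ k, ∑ i ∈ Finset.range (k + 1), H i w ≤ t := by
    intro w
    by_cases h : ∃ n, t < ∑ i ∈ Finset.range (n + 1), H i w
    · obtain ⟨n, hn⟩ := h; exact ⟨n, Or.inl hn⟩
    · exact ⟨0, Or.inr (by simpa using h)⟩
  have hsum : ∀ n, Measurable fun w => ∑ i ∈ Finset.range n, H i w := fun n =>
    Finset.measurable_sum _ fun i _ => hH i
  have hm : ∀ n, MeasurableSet {w | t < ∑ i ∈ Finset.range (n + 1), H i w ∨
      ∀ k, ∑ i ∈ Finset.range (k + 1), H i w ≤ t} := by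
    intro n
    have h : MeasurableSet ({w | t < ∑ i ∈ Finset.range (n + 1), H i w} ∪
        ⋂ k, {w | ∑ i ∈ Finset.range (k + 1), H i w ≤ t}) :=
      (measurableSet_lt measurable_const (hsum _)).union
        (MeasurableSet.iInter fun k => measurableSet_le (hsum _) measurable_const)
    convert h using 1
    ext w; simp
  convert measurable_find hex hm using 2 with w
  by_cases h : ∃ n, t < ∑ i ∈ Finset.range (n + 1), H i w
  · obtain ⟨k, hk⟩ := h
    have hne : ({n | t < ∑ i ∈ Finset.range (n + 1), H i w} : Set ℕ).Nonempty := ⟨k, hk⟩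
    refine le_antisymm (Nat.sInf_le ?_) (Nat.find_min' _ (Or.inl (Nat.sInf_mem hne)))
    rcases Nat.find_spec (hex w) with h' | h'
    · exact h'
    · exact absurd hk (not_lt.2 (h' k))
  · have h' : ∀ k, ∑ i ∈ Finset.range (k + 1), H i w ≤ t := by simpa using h
    have e : {n | t < ∑ i ∈ Finset.range (n + 1), H i w} = ∅ := by
      ext n; simpa using h' n
    rw [jumpIndex, e, Nat.sInf_empty]
    exact ((Nat.find_eq_zero _).2 (Or.inr h')).symm

section ClockProcess

variable {S : Type*} {m : ℕ} (rate : Fin (m + 1) → S → ℝ) (next : Fin (m + 1) → S → S)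

/-- The continuous-time process driven by competing clocks. -/
def clockProcess (s : S) (t : ℝ≥0) (w : Fin (m + 1) → ℕ → ℝ) : S :=
  clockChain rate next s (jumpIndex (fun n => clockHolding rate next s n w) t) w

theorem isCTMC_clockProcess [MeasurableSpace S] [DiscreteMeasurableSpace S] [Countable S]
    (hrate : ∀ i s, 0 ≤ rate i s) (hpos : ∀ s, 0 < ∑ i, rate i s) (s₀ : S)
    (hnonneg : ∀ᵐ w ∂clockLaw m, ∀ n, 0 ≤ clockHolding rate next s₀ n w)
    (htop : ∀ᵐ w ∂clockLaw m,
      Tendsto (fun n => ∑ i ∈ Finset.range n, clockHolding rate next s₀ i w) atTop atTop) :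
    IsCTMC (clockLaw m) (eventJumpRate rate next) s₀ (clockProcess rate next s₀) where
  measurable t := by
    have h : Measurable fun p : ℕ × (Fin (m + 1) → ℕ → ℝ) => clockChain rate next s₀ p.1 p.2 :=
      measurable_from_prod_countable_right fun n => measurable_clockChain rate next s₀ n
    exact h.comp ((measurable_jumpIndex (fun n => measurable_clockHolding rate next s₀ n) t).prodMk
      measurable_id)
  jumpChain_holdingTimes := by
    refine ⟨clockChain rate next s₀, clockHolding rate next s₀, measurable_clockChain rate next s₀,
      measurable_clockHolding rate next s₀, ae_of_all _ fun w => rfl, ?_, htop, ?_⟩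
    · rintro n s t rfl ht
      exact clockLaw_clockChain rate next hrate hpos n s t ht
    · filter_upwards [hnonneg] with w hw n t h1 h2
      rw [clockProcess, jumpIndex_eq hw h1 h2]

/-! ### Event counts and internal times -/

/-- The number of events `i` among the first `n` events of the sequence `e`. -/
def eventCount (e : ℕ → Fin (m + 1)) (i : Fin (m + 1)) (n : ℕ) : ℕ :=
  ∑ k ∈ Finset.range n, if e k = i then 1 else 0

theorem eventCount_succ (e : ℕ → Fin (m + 1)) (i : Fin (m + 1)) (n : ℕ) :
    eventCount e i (n + 1) = eventCount e i n + if e n = i then 1 else 0 :=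
  Finset.sum_range_succ _ _

theorem sum_eventCount (e : ℕ → Fin (m + 1)) (n : ℕ) : ∑ i, eventCount e i n = n := by
  simp only [eventCount]
  rw [Finset.sum_comm]
  simp

/-- The time that the clock `i` has consumed up to the `n`-th jump. -/
def internalTime (J : ℕ → S) (H : ℕ → ℝ) (i : Fin (m + 1)) (n : ℕ) : ℝ :=
  ∑ k ∈ Finset.range n, rate i (J k) * H k

theorem internalTime_succ (J : ℕ → S) (H : ℕ → ℝ) (i : Fin (m + 1)) (n : ℕ) :
    internalTime rate J H i (n + 1) = internalTime rate J H i n + rate i (J n) * H n :=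
  Finset.sum_range_succ _ _

/-- A realization of the chain driven by the clocks `w`: the states `J`, the holding times `H` and
the events `e`. -/
structure IsClockPath (w : Fin (m + 1) → ℕ → ℝ) (J : ℕ → S) (H : ℕ → ℝ) (e : ℕ → Fin (m + 1)) :
    Prop where
  hold_nonneg : ∀ n, 0 ≤ H n
  rate_pos : ∀ n, 0 < rate (e n) (J n)
  state_succ : ∀ n, J (n + 1) = next (e n) (J n)
  clock_le : ∀ i n, ∑ k ∈ Finset.range (eventCount e i n), w i k ≤ internalTime rate J H i n
  le_clock : ∀ i n, internalTime rate J H i (n + 1) ≤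
    ∑ k ∈ Finset.range (eventCount e i n + 1), w i k

/-- The invariant `inv`: the residual head of clock `i` is the partial sum of `w i` through the next
ring minus the internal time spent so far, it lies between `0` and the full clock, and the rest of
the stream is untouched. Weak inequalities suffice, so ties and zero clocks are allowed. -/
theorem isClockPath_clockChain (hrate : ∀ i s, 0 ≤ rate i s) (hpos : ∀ s, 0 < ∑ i, rate i s)
    (s₀ : S) {w : Fin (m + 1) → ℕ → ℝ} (hw : ∀ i k, 0 ≤ w i k) :
    IsClockPath rate next w (fun n => clockChain rate next s₀ n w)
      (fun n => clockHolding rate next s₀ n w)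
      (fun n => clockEvent rate ((clockStep rate next)^[n] (s₀, w))) := by
  set p : ℕ → S × (Fin (m + 1) → ℕ → ℝ) := fun n => (clockStep rate next)^[n] (s₀, w) with hp
  set J : ℕ → S := fun n => (p n).1 with hJ
  set H : ℕ → ℝ := fun n => clockHold rate (p n) with hH
  set e : ℕ → Fin (m + 1) := fun n => clockEvent rate (p n) with he
  have hsucc : ∀ n, p (n + 1) = clockStep rate next (p n) := fun n =>
    Function.iterate_succ_apply' _ _ _
  have spec : ∀ n, (∀ i, 0 ≤ (p n).2 i 0) → 0 < rate (e n) (J n) ∧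
      ∀ i, rate i (J n) * (p n).2 (e n) 0 ≤ rate (e n) (J n) * (p n).2 i 0 := fun n h =>
    firstRing_spec (q := fun i => rate i (p n).1) (fun i => hrate i _) (hpos _) h
  have inv : ∀ n i, 0 ≤ (p n).2 i 0 ∧
      (p n).2 i 0 = ∑ k ∈ Finset.range (eventCount e i n + 1), w i k - internalTime rate J H i n ∧
      (p n).2 i 0 ≤ w i (eventCount e i n) ∧
      ∀ k, (p n).2 i (k + 1) = w i (eventCount e i n + (k + 1)) := by
    intro n
    induction n with
    | zero => intro i; simp [hp, eventCount, internalTime, hw]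
    | succ n ih =>
      intro i
      obtain ⟨h0, h1⟩ := spec n fun i => (ih i).1
      have hHn : H n = (p n).2 (e n) 0 / rate (e n) (J n) := rfl
      have hHnn : 0 ≤ H n := div_nonneg (ih _).1 h0.le
      have h2 : (p (n + 1)).2 i = if i = e n then shiftStream ((p n).2 (e n)) else
          ageStream (rate i (J n) * H n) ((p n).2 i) := by rw [hsucc]; rfl
      obtain ⟨a, b, c, d⟩ := ih i
      by_cases hi : i = e n
      · have hc : eventCount e i (n + 1) = eventCount e i n + 1 := by
          rw [eventCount_succ, if_pos hi.symm]
        have hA : internalTime rate J H i (n + 1) =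
            ∑ k ∈ Finset.range (eventCount e i n + 1), w i k := by
          rw [internalTime_succ, hHn, hi, mul_div_cancel₀ _ h0.ne', ← hi, b]; ring
        rw [h2, if_pos hi, hA, hc, ← hi]
        simp only [shiftStream_apply]
        refine ⟨by rw [d]; exact hw _ _, ?_, (d 0).le, fun k => ?_⟩
        · rw [Finset.sum_range_succ _ (eventCount e i n + 1), d]; ring
        · rw [d]; congr 1; ring
      · have hc : eventCount e i (n + 1) = eventCount e i n := by
          rw [eventCount_succ, if_neg (Ne.symm hi), add_zero]
        rw [h2, if_neg hi, hc, internalTime_succ]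
        simp only [ageStream, consStream_zero, consStream_succ, shiftStream_apply]
        refine ⟨?_, by rw [b]; ring, ?_, d⟩
        · have := h1 i
          rw [hHn, ← mul_div_assoc, sub_nonneg, div_le_iff₀ h0]
          linarith
        · have := mul_nonneg (hrate i (J n)) hHnn
          linarith
  have hS := fun n => spec n fun i => (inv n i).1
  refine ⟨fun n => div_nonneg (inv n _).1 (hS n).1.le, fun n => (hS n).1,
    fun n => congrArg Prod.fst (hsucc n), fun i n => ?_, fun i n => ?_⟩
  · obtain ⟨-, b, c, -⟩ := inv n i
    rw [Finset.sum_range_succ] at b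
    change _ ≤ internalTime rate J H i n
    linarith
  · obtain ⟨h0, h1⟩ := hS n
    have h2 : rate i (J n) * H n ≤ (p n).2 i 0 := by
      change rate i (J n) * ((p n).2 (e n) 0 / rate (e n) (J n)) ≤ _
      rw [← mul_div_assoc, div_le_iff₀ h0]
      linarith [h1 i]
    have h3 := (inv n i).2.1
    change internalTime rate J H i (n + 1) ≤ ∑ k ∈ Finset.range (eventCount e i n + 1), w i k
    rw [internalTime_succ]
    linarith

end ClockProcess

/-! ### The law of large numbers for the clocks -/

/-- Nonnegative clocks that satisfy the law of large numbers. -/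
def RegularClocks {m : ℕ} (w : Fin (m + 1) → ℕ → ℝ) : Prop :=
  (∀ i k, 0 ≤ w i k) ∧
    ∀ i, Tendsto (fun n : ℕ => (∑ k ∈ Finset.range n, w i k) / (n : ℝ)) atTop (𝓝 1)

theorem ae_nonneg_expMeasure_one : ∀ᵐ x ∂ProbabilityTheory.expMeasure 1, 0 ≤ x := by
  have h : MeasurableSet {x : ℝ | ¬ 0 ≤ x} :=
    (measurableSet_le measurable_const measurable_id).compl
  rw [ae_iff, ← lintegral_indicator_one h, lintegral_expMeasure_one _ (measurable_one.indicator h),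
    setLIntegral_congr_fun measurableSet_Ioi (g := fun _ => 0)]
  · simp
  · intro x (hx : 0 < x)
    simp [hx.le]

/-- The mean is the Gamma integral `Γ(2) = 1`. -/
theorem lintegral_id_expMeasure_one :
    ∫⁻ x, ENNReal.ofReal x ∂ProbabilityTheory.expMeasure 1 = 1 := by
  rw [lintegral_expMeasure_one _ (by fun_prop)]
  have h := Real.GammaIntegral_convergent (s := 2) (by norm_num)
  have h2 := Real.Gamma_eq_integral (s := 2) (by norm_num)
  rw [Real.Gamma_two] at h2
  rw [← ENNReal.ofReal_one, h2, ofReal_integral_eq_lintegral_ofReal h]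
  · refine setLIntegral_congr_fun measurableSet_Ioi fun x (hx : 0 < x) => ?_
    rw [← ENNReal.ofReal_mul (Real.exp_pos _).le]
    norm_num
  · refine (ae_restrict_iff' measurableSet_Ioi).2 (ae_of_all _ fun x (hx : 0 < x) => ?_)
    exact mul_nonneg (Real.exp_pos _).le (Real.rpow_nonneg hx.le _)

theorem integrable_id_expMeasure_one :
    Integrable (fun x : ℝ => x) (ProbabilityTheory.expMeasure 1) := by
  refine ⟨measurable_id.aestronglyMeasurable, ?_⟩
  rw [hasFiniteIntegral_iff_ofReal ae_nonneg_expMeasure_one, lintegral_id_expMeasure_one]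
  exact ENNReal.one_lt_top

theorem integral_id_expMeasure_one : ∫ x, x ∂ProbabilityTheory.expMeasure 1 = 1 := by
  rw [integral_eq_lintegral_of_nonneg_ae ae_nonneg_expMeasure_one
    measurable_id.aestronglyMeasurable, lintegral_id_expMeasure_one, ENNReal.toReal_one]

theorem ae_streamLaw_tendsto :
    ∀ᵐ x ∂streamLaw, Tendsto (fun n : ℕ => (∑ k ∈ Finset.range n, x k) / (n : ℝ)) atTop (𝓝 1) := by
  have hmp : ∀ k, MeasurePreserving (fun x : ℕ → ℝ => x k) streamLaw
      (ProbabilityTheory.expMeasure 1) := fun k =>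
    measurePreserving_eval_infinitePi (fun _ : ℕ => ProbabilityTheory.expMeasure 1) k
  have h := ProbabilityTheory.strong_law_ae_real (μ := streamLaw) (fun k x => x k)
    ((hmp 0).integrable_comp_of_integrable integrable_id_expMeasure_one)
    (fun i j hij => (ProbabilityTheory.iIndepFun_infinitePi
      (P := fun _ : ℕ => ProbabilityTheory.expMeasure 1) (X := fun _ x => x)
      fun _ => measurable_id).indepFun hij)
    (fun i => ⟨(measurable_pi_apply i).aemeasurable, (measurable_pi_apply 0).aemeasurable, by
      rw [(hmp i).map_eq, (hmp 0).map_eq]⟩)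
  have e : ∫ x : ℕ → ℝ, x 0 ∂streamLaw = 1 := by
    rw [← integral_id_expMeasure_one, ← (hmp 0).map_eq]
    exact (integral_map (μ := streamLaw) (φ := fun x : ℕ → ℝ => x 0) (f := fun x : ℝ => x)
      (measurable_pi_apply 0).aemeasurable aestronglyMeasurable_id).symm
  rw [e] at h
  exact h

theorem ae_regularClocks (m : ℕ) : ∀ᵐ w ∂clockLaw m, RegularClocks w := by
  have hmp : ∀ i, MeasurePreserving (fun w : Fin (m + 1) → ℕ → ℝ => w i) (clockLaw m) streamLaw :=
    fun i => measurePreserving_eval (fun _ : Fin (m + 1) => streamLaw) i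
  have hmp' : ∀ k, MeasurePreserving (fun x : ℕ → ℝ => x k) streamLaw
      (ProbabilityTheory.expMeasure 1) := fun k =>
    measurePreserving_eval_infinitePi (fun _ : ℕ => ProbabilityTheory.expMeasure 1) k
  have h1 : ∀ i k, ∀ᵐ w ∂clockLaw m, 0 ≤ w i k := fun i k =>
    ((hmp' k).comp (hmp i)).quasiMeasurePreserving.ae ae_nonneg_expMeasure_one
  have h2 : ∀ i, ∀ᵐ w ∂clockLaw m,
      Tendsto (fun n : ℕ => (∑ k ∈ Finset.range n, w i k) / (n : ℝ)) atTop (𝓝 1) := fun i =>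
    (hmp i).quasiMeasurePreserving.ae ae_streamLaw_tendsto
  filter_upwards [ae_all_iff.2 fun i => ae_all_iff.2 (h1 i), ae_all_iff.2 h2] with w h h'
  exact ⟨h, h'⟩

/-- If the partial sums of `x` satisfy the law of large numbers, then the renewal counts of `x`
are close to the identity. -/
theorem exists_abs_renewal_sub_le {x : ℕ → ℝ} (hx : ∀ k, 0 ≤ x k)
    (hlim : Tendsto (fun n : ℕ => (∑ k ∈ Finset.range n, x k) / (n : ℝ)) atTop (𝓝 1)) {δ : ℝ}
    (hδ : 0 < δ) :
    ∃ C : ℝ, 0 ≤ C ∧ ∀ (n : ℕ) (a : ℝ), ∑ k ∈ Finset.range n, x k ≤ a →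
      a ≤ ∑ k ∈ Finset.range (n + 1), x k → |n - a| ≤ δ * a + C := by
  -- The bound `1 / 2` allows solving `|S n - n| ≤ η n + c` for `n`, giving `n ≤ 2 (a + c)`; the
  -- bound `δ / 2` then turns `η n` into at most `δ (a + c)`.
  set η : ℝ := min (1 / 2) (δ / 2) with hη
  have hη0 : 0 < η := by positivity
  have hη1 : η ≤ 1 / 2 := min_le_left _ _
  have hη2 : η ≤ δ / 2 := min_le_right _ _
  obtain ⟨N, hN⟩ := eventually_atTop.1 (Metric.tendsto_nhds.1 hlim η hη0)
  set c : ℝ := ∑ k ∈ Finset.range N, x k + N with hc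
  have hc0 : 0 ≤ c := add_nonneg (Finset.sum_nonneg fun k _ => hx k) (Nat.cast_nonneg _)
  -- The law of large numbers covers `n ≥ N`; the constant `c` absorbs all smaller `n`.
  have hb : ∀ n : ℕ, |∑ k ∈ Finset.range n, x k - n| ≤ η * n + c := by
    intro n
    rcases le_total N n with h | h
    · have h1 := hN n h
      rcases Nat.eq_zero_or_pos n with h0 | h0
      · subst h0; simpa using hc0
      · have hn : (0 : ℝ) < n := by exact_mod_cast h0
        rw [Real.dist_eq, div_sub_one hn.ne', abs_div, abs_of_pos hn, div_lt_iff₀ hn] at h1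
        linarith
    · have h1 : ∑ k ∈ Finset.range n, x k ≤ ∑ k ∈ Finset.range N, x k :=
        Finset.sum_le_sum_of_subset_of_nonneg (Finset.range_subset_range.2 h) fun i _ _ => hx i
      have h2 : 0 ≤ ∑ k ∈ Finset.range n, x k := Finset.sum_nonneg fun k _ => hx k
      have h3 : (n : ℝ) ≤ N := by exact_mod_cast h
      have h4 : (0 : ℝ) ≤ n := Nat.cast_nonneg _
      have h5 : 0 ≤ η * n := by positivity
      rw [abs_le]; constructor <;> linarith
  refine ⟨(2 * δ + 4) * (c + 1), by positivity, fun n a h1 h2 => ?_⟩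
  have b1 := (abs_le.1 (hb n)).1
  have b2 := (abs_le.1 (hb (n + 1))).2
  push_cast at b2
  have h4 : (0 : ℝ) ≤ n := Nat.cast_nonneg _
  have ha : (n : ℝ) ≤ 2 * (a + c) := by nlinarith
  have h5 : η * n ≤ δ / 2 * (2 * (a + c)) := by
    calc η * n ≤ δ / 2 * n := by gcongr
      _ ≤ _ := by gcongr
  have h6 : 0 ≤ δ * c := by positivity
  rw [abs_le]; constructor <;> nlinarith

/-- Summing the constants over the finitely many clocks gives one constant for all. It depends on
the clocks and `δ` alone, hence serves every `r` simultaneously. -/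
theorem RegularClocks.exists_bound {m : ℕ} {w : Fin (m + 1) → ℕ → ℝ} (hw : RegularClocks w) :
    ∃ C : ℝ → ℝ, (∀ δ, 0 ≤ C δ) ∧ ∀ δ, 0 < δ → ∀ (i : Fin (m + 1)) (n : ℕ) (a : ℝ),
      ∑ k ∈ Finset.range n, w i k ≤ a → a ≤ ∑ k ∈ Finset.range (n + 1), w i k →
        |n - a| ≤ δ * a + C δ := by
  have h : ∀ δ : ℝ, ∃ C : ℝ, 0 ≤ C ∧ (0 < δ → ∀ (i : Fin (m + 1)) (n : ℕ) (a : ℝ),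
      ∑ k ∈ Finset.range n, w i k ≤ a → a ≤ ∑ k ∈ Finset.range (n + 1), w i k →
        |n - a| ≤ δ * a + C) := by
    intro δ
    by_cases hδ : 0 < δ
    · choose C hC0 hC using fun i => exists_abs_renewal_sub_le (hw.1 i) (hw.2 i) hδ
      refine ⟨∑ i, C i, Finset.sum_nonneg fun i _ => hC0 i, fun _ i n a h1 h2 => ?_⟩
      refine (hC i n a h1 h2).trans ?_
      have := Finset.single_le_sum (fun i _ => hC0 i) (Finset.mem_univ i)
      linarith
    · exact ⟨0, le_rfl, fun h => absurd h hδ⟩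
  choose C h0 h1 using h
  exact ⟨C, h0, h1⟩

/-! ### Grönwall's inequality in integral form -/

/-- The paths have jumps, so `D` is only integrable. Its primitive `G` is continuous and `G ≤ F`
with `F' = a + K G`; hence `a + K F` is differentiable, with derivative at most `K` times itself,
and the differential form of the inequality applies to it. -/
theorem le_mul_exp_of_le_add_integral {D : ℝ → ℝ} {a K T : ℝ} (ha : 0 ≤ a) (hK : 0 ≤ K)
    (hD : IntervalIntegrable D volume 0 T)
    (h : ∀ t ∈ Icc 0 T, D t ≤ a + K * ∫ s in (0)..t, D s) :
    ∀ t ∈ Icc 0 T, D t ≤ a * Real.exp (K * t) := by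
  intro t ht
  have hT : 0 ≤ T := ht.1.trans ht.2
  set D₁ : ℝ → ℝ := (Ioc 0 T).indicator D with hD₁
  have hint : Integrable D₁ := (integrable_indicator_iff measurableSet_Ioc).2
    ((intervalIntegrable_iff_integrableOn_Ioc_of_le hT).1 hD)
  have heq : ∀ t ∈ Icc 0 T, ∫ s in (0)..t, D s = ∫ s in (0)..t, D₁ s := by
    intro t ht
    rw [intervalIntegral.integral_of_le ht.1, intervalIntegral.integral_of_le ht.1]
    refine setIntegral_congr_fun measurableSet_Ioc fun s hs => ?_
    rw [hD₁, indicator_of_mem (show s ∈ Ioc 0 T from ⟨hs.1, hs.2.trans ht.2⟩)]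
  set G : ℝ → ℝ := fun t => ∫ s in (0)..t, D₁ s with hG
  have hGc : Continuous G := intervalIntegral.continuous_primitive (fun a b =>
    hint.intervalIntegrable) 0
  set F : ℝ → ℝ := fun t => ∫ s in (0)..t, (a + K * G s) with hF
  have hFd : ∀ t, HasDerivAt F (a + K * G t) t := fun t =>
    intervalIntegral.integral_hasDerivAt_right (Continuous.intervalIntegrable (by fun_prop) _ _)
      (Continuous.stronglyMeasurableAtFilter (by fun_prop) _ _)
      (Continuous.continuousAt (by fun_prop))
  have hGF : ∀ t ∈ Icc 0 T, G t ≤ F t := by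
    intro t ht
    refine intervalIntegral.integral_mono_on ht.1 hint.intervalIntegrable
      (Continuous.intervalIntegrable (by fun_prop) _ _) fun s hs => ?_
    have hs' : s ∈ Icc 0 T := ⟨hs.1, hs.2.trans ht.2⟩
    rcases hs.1.eq_or_lt with h0 | h0
    · have : D₁ s = 0 := by rw [hD₁, indicator_of_notMem]; simp [← h0]
      rw [this, ← h0]
      simp only [hG, intervalIntegral.integral_same, mul_zero, add_zero]
      exact ha
    · have : D₁ s = D s := by rw [hD₁, indicator_of_mem (show s ∈ Ioc 0 T from ⟨h0, hs'.2⟩)]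
      rw [this, hG]
      simp only
      rw [← heq s hs']
      exact h s hs'
  have hb := le_gronwallBound_of_liminf_deriv_right_le (f := fun t => a + K * F t)
    (f' := fun t => K * (a + K * G t)) (δ := a) (K := K) (ε := 0) (a := 0) (b := T)
    (fun t _ => ((hFd t).continuousAt.const_mul K |>.const_add a).continuousWithinAt)
    (fun t _ r hr => by
      exact ((((hFd t).const_mul K).const_add a).hasDerivWithinAt).liminf_right_slope_le hr)
    (by simp [hF])
    (fun t ht => by
      have := hGF t ⟨ht.1, ht.2.le⟩
      rw [add_zero]
      gcongr) t ht
  rw [gronwallBound_ε0, sub_zero] at hb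
  calc D t ≤ a + K * ∫ s in (0)..t, D s := h t ht
    _ = a + K * G t := by rw [heq t ht]
    _ ≤ a + K * F t := by have := hGF t ht; gcongr
    _ ≤ _ := hb

/-! ### Approximate solutions of the reflected fluid equation -/

/-- The unreflected pending invitations: the value at time `t` of the second coordinate of the
fluid equation without its reflection term. -/
def freeInvitations (lam β g ε w₀ : ℝ) (y w : ℝ → ℝ) (t : ℝ) : ℝ :=
  w₀ + ∫ s in (0)..t, (g * lam - g * β * w s - ε * y s)

/-- `(y, w)` solves on `[0, T]` the fluid equation with Skorokhod reflection of `w` at `0`, up to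
the error `η`: the regulator `w - freeInvitations` is close to the running maximum of
`max 0 (-freeInvitations)`. -/
structure NearFluid (lam β g ε y₀ w₀ T η : ℝ) (y w : ℝ → ℝ) : Prop where
  integrable_y : IntervalIntegrable y volume 0 T
  integrable_w : IntervalIntegrable w volume 0 T
  near_y : ∀ t ∈ Icc 0 T, |y t - (y₀ + ∫ s in (0)..t, (β * w s - lam))| ≤ η
  lower : ∀ t ∈ Icc 0 T, ∀ s ∈ Icc 0 t, max 0 (-freeInvitations lam β g ε w₀ y w s) - η ≤
    w t - freeInvitations lam β g ε w₀ y w t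
  upper : ∀ t ∈ Icc 0 T, ∃ s ∈ Icc 0 t, w t - freeInvitations lam β g ε w₀ y w t ≤
    max 0 (-freeInvitations lam β g ε w₀ y w s) + η

theorem IntervalIntegrable.mono_right_Icc {f : ℝ → ℝ} {T t : ℝ}
    (hf : IntervalIntegrable f volume 0 T) (ht : t ∈ Icc 0 T) :
    IntervalIntegrable f volume 0 t :=
  hf.mono_set (by rw [uIcc_of_le ht.1, uIcc_of_le (ht.1.trans ht.2)]; exact
    Icc_subset_Icc_right ht.2)

/-! ### Stability and limits of approximate solutions -/

section Stability

variable {lam β g ε y₀ w₀ T η : ℝ} {y w y' w' : ℝ → ℝ}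

/-- The drift is Lipschitz in `(y, w)`. The bound at `s` uses the integral up to a later `t`, so
that it controls running maxima over `[0, t]`. -/
theorem abs_freeInvitations_sub_le (hβ : 0 ≤ β) (hg : 0 ≤ g) (hε : 0 ≤ ε)
    (hy : IntervalIntegrable y volume 0 T) (hw : IntervalIntegrable w volume 0 T)
    (hy' : IntervalIntegrable y' volume 0 T) (hw' : IntervalIntegrable w' volume 0 T)
    {s t : ℝ} (hs : 0 ≤ s) (hst : s ≤ t) (ht : t ≤ T) :
    |freeInvitations lam β g ε w₀ y w s - freeInvitations lam β g ε w₀ y' w' s| ≤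
      (g * β + ε) * ∫ u in (0)..t, (|y u - y' u| + |w u - w' u|) := by
  have hsT : s ∈ Icc 0 T := ⟨hs, hst.trans ht⟩
  have htT : t ∈ Icc 0 T := ⟨hs.trans hst, ht⟩
  have I := fun {f : ℝ → ℝ} (hf : IntervalIntegrable f volume 0 T) => hf.mono_right_Icc hsT
  have I' := fun {f : ℝ → ℝ} (hf : IntervalIntegrable f volume 0 T) => hf.mono_right_Icc htT
  have hD : IntervalIntegrable (fun u => |y u - y' u| + |w u - w' u|) volume 0 t :=
    ((I' hy).sub (I' hy')).abs.add ((I' hw).sub (I' hw')).abs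
  simp only [freeInvitations]
  rw [add_sub_add_left_eq_sub, ← intervalIntegral.integral_sub,
    ← intervalIntegral.integral_const_mul]
  · refine (intervalIntegral.abs_integral_le_integral_abs hs).trans ?_
    have h1 : ∫ u in (0)..s, |g * lam - g * β * w u - ε * y u - (g * lam - g * β * w' u - ε * y' u)|
        ≤ ∫ u in (0)..s, (g * β + ε) * (|y u - y' u| + |w u - w' u|) := by
      refine intervalIntegral.integral_mono_on hs ?_ ?_ fun u hu => ?_
      · exact ((((intervalIntegrable_const.sub ((I hw).const_mul _)).sub ((I hy).const_mul _))).sub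
          ((intervalIntegrable_const.sub ((I hw').const_mul _)).sub ((I hy').const_mul _))).abs
      · exact (((I hy).sub (I hy')).abs.add ((I hw).sub (I hw')).abs).const_mul _
      · have e : g * lam - g * β * w u - ε * y u - (g * lam - g * β * w' u - ε * y' u) =
            -(g * β * (w u - w' u)) - ε * (y u - y' u) := by ring
        rw [e]
        refine (abs_sub _ _).trans ?_
        rw [abs_neg, abs_mul (g * β), abs_mul ε, abs_of_nonneg (by positivity : 0 ≤ g * β),
          abs_of_nonneg hε]
        have h1 := abs_nonneg (y u - y' u)
        have h2 := abs_nonneg (w u - w' u)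
        have h3 : 0 ≤ g * β := by positivity
        nlinarith [mul_nonneg h3 h1, mul_nonneg hε h2]
    refine h1.trans ?_
    refine intervalIntegral.integral_mono_interval le_rfl hs hst (ae_of_all _ fun u => ?_)
      (hD.const_mul _)
    have : 0 ≤ g * β + ε := by positivity
    simp only [Pi.zero_apply]
    positivity
  · exact (intervalIntegrable_const.sub ((I hw).const_mul _)).sub ((I hy).const_mul _)
  · exact (intervalIntegrable_const.sub ((I hw').const_mul _)).sub ((I hy').const_mul _)

theorem abs_integral_drift_sub_le (hβ : 0 ≤ β)
    (hy : IntervalIntegrable y volume 0 T) (hw : IntervalIntegrable w volume 0 T)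
    (hy' : IntervalIntegrable y' volume 0 T) (hw' : IntervalIntegrable w' volume 0 T)
    {t : ℝ} (ht : t ∈ Icc 0 T) :
    |(∫ s in (0)..t, (β * w s - lam)) - ∫ s in (0)..t, (β * w' s - lam)| ≤
      β * ∫ u in (0)..t, (|y u - y' u| + |w u - w' u|) := by
  have I := fun {f : ℝ → ℝ} (hf : IntervalIntegrable f volume 0 T) => hf.mono_right_Icc ht
  rw [← intervalIntegral.integral_sub (((I hw).const_mul _).sub intervalIntegrable_const)
    (((I hw').const_mul _).sub intervalIntegrable_const), ← intervalIntegral.integral_const_mul]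
  refine (intervalIntegral.abs_integral_le_integral_abs ht.1).trans ?_
  refine intervalIntegral.integral_mono_on ht.1 ?_ ?_ fun u hu => ?_
  · exact ((((I hw).const_mul _).sub intervalIntegrable_const).sub
      (((I hw').const_mul _).sub intervalIntegrable_const)).abs
  · exact (((I hy).sub (I hy')).abs.add ((I hw).sub (I hw')).abs).const_mul _
  · have e : β * w u - lam - (β * w' u - lam) = β * (w u - w' u) := by ring
    rw [e, abs_mul, abs_of_nonneg hβ]
    have := abs_nonneg (y u - y' u)
    gcongr
    linarith

/-- Approximate solutions of the fluid equation with the same initial value are close. -/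
theorem NearFluid.dist_le (hβ : 0 ≤ β) (hg : 0 ≤ g) (hε : 0 ≤ ε) {η₁ η₂ : ℝ}
    (h₁ : NearFluid lam β g ε y₀ w₀ T η₁ y w) (h₂ : NearFluid lam β g ε y₀ w₀ T η₂ y' w') :
    ∀ t ∈ Icc 0 T, |y t - y' t| + |w t - w' t| ≤
      2 * (η₁ + η₂) * Real.exp ((β + 2 * (g * β + ε)) * t) := by
  intro t₀ ht₀
  have hη₁ : 0 ≤ η₁ := (abs_nonneg _).trans (h₁.near_y t₀ ht₀)
  have hη₂ : 0 ≤ η₂ := (abs_nonneg _).trans (h₂.near_y t₀ ht₀)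
  refine le_mul_exp_of_le_add_integral (D := fun t => |y t - y' t| + |w t - w' t|) (T := T)
    (by positivity) (by positivity)
    ((h₁.integrable_y.sub h₂.integrable_y).abs.add (h₁.integrable_w.sub h₂.integrable_w).abs)
    ?_ t₀ ht₀
  intro t ht
  set I := ∫ u in (0)..t, (|y u - y' u| + |w u - w' u|) with hI
  have hU := fun s (hs : s ∈ Icc 0 t) => abs_le.1 (abs_freeInvitations_sub_le (lam := lam)
    (w₀ := w₀) hβ hg hε h₁.integrable_y h₁.integrable_w h₂.integrable_y h₂.integrable_w hs.1 hs.2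
    ht.2)
  rw [← hI] at hU
  have hdr := abs_integral_drift_sub_le (lam := lam) hβ h₁.integrable_y h₁.integrable_w
    h₂.integrable_y h₂.integrable_w ht
  rw [← hI] at hdr
  have hy : |y t - y' t| ≤ η₁ + η₂ + β * I := by
    have a1 := abs_le.1 (h₁.near_y t ht)
    have a2 := abs_le.1 (h₂.near_y t ht)
    have a3 := abs_le.1 hdr
    rw [abs_le]; constructor <;> linarith
  have hmax : ∀ {a b c : ℝ}, a - b ≤ c → 0 ≤ c → max 0 a ≤ max 0 b + c := by
    intro a b c h1 h2
    refine max_le ?_ ?_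
    · linarith [le_max_left 0 b]
    · linarith [le_max_right 0 b]
  have hκ : 0 ≤ (g * β + ε) * I := (abs_nonneg _).trans (abs_freeInvitations_sub_le (lam := lam)
    (w₀ := w₀) hβ hg hε h₁.integrable_y h₁.integrable_w h₂.integrable_y h₂.integrable_w ht.1 le_rfl
    ht.2)
  have htt : t ∈ Icc 0 t := ⟨ht.1, le_rfl⟩
  -- The near-maximizer of each solution is inserted into the lower bound of the other. The factor
  -- `2` arises because the free processes enter once at `t` and once through the running maxima.
  have hw : |w t - w' t| ≤ η₁ + η₂ + 2 * (g * β + ε) * I := by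
    obtain ⟨s₁, hs₁, b₁⟩ := h₁.upper t ht
    obtain ⟨s₂, hs₂, b₂⟩ := h₂.upper t ht
    have c₁ := h₁.lower t ht s₂ hs₂
    have c₂ := h₂.lower t ht s₁ hs₁
    have d₁ := hmax (a := -freeInvitations lam β g ε w₀ y w s₁)
      (b := -freeInvitations lam β g ε w₀ y' w' s₁) (c := (g * β + ε) * I)
      (by linarith [(hU s₁ hs₁).1]) hκ
    have d₂ := hmax (a := -freeInvitations lam β g ε w₀ y' w' s₂)
      (b := -freeInvitations lam β g ε w₀ y w s₂) (c := (g * β + ε) * I)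
      (by linarith [(hU s₂ hs₂).2]) hκ
    have e := hU t htt
    rw [abs_le]; constructor <;> linarith [e.1, e.2]
  calc _ ≤ (η₁ + η₂ + β * I) + (η₁ + η₂ + 2 * (g * β + ε) * I) := add_le_add hy hw
    _ = _ := by ring

/-- A uniformly small perturbation of an approximate solution is an approximate solution. -/
theorem NearFluid.perturb (hβ : 0 ≤ β) (hg : 0 ≤ g) (hε : 0 ≤ ε)
    (h : NearFluid lam β g ε y₀ w₀ T η y' w') (hy : IntervalIntegrable y volume 0 T)
    (hw : IntervalIntegrable w volume 0 T) (hyη : ∀ t ∈ Icc 0 T, |y t - y' t| ≤ η)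
    (hwη : ∀ t ∈ Icc 0 T, |w t - w' t| ≤ η) :
    NearFluid lam β g ε y₀ w₀ T (2 * (1 + (β + 2 * (g * β + ε)) * T) * η) y w := by
  rcases lt_or_ge T 0 with hT | hT
  · have : Icc 0 T = ∅ := Icc_eq_empty (not_le.2 hT)
    refine ⟨hy, hw, ?_, ?_, ?_⟩ <;> simp [this]
  have hη : 0 ≤ η := (abs_nonneg _).trans (h.near_y 0 ⟨le_rfl, hT⟩)
  have hI : ∀ t ∈ Icc 0 T, ∫ u in (0)..t, (|y u - y' u| + |w u - w' u|) ≤ 2 * η * T := by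
    intro t ht
    have h1 : ∫ u in (0)..t, (|y u - y' u| + |w u - w' u|) ≤ ∫ u in (0)..t, 2 * η := by
      refine intervalIntegral.integral_mono_on ht.1 ?_ intervalIntegrable_const fun u hu => ?_
      · exact ((hy.sub h.integrable_y).abs.add (hw.sub h.integrable_w).abs).mono_right_Icc ht
      · have hu' : u ∈ Icc 0 T := ⟨hu.1, hu.2.trans ht.2⟩
        linarith [hyη u hu', hwη u hu']
    rw [intervalIntegral.integral_const, sub_zero, smul_eq_mul] at h1
    have := mul_le_mul_of_nonneg_right ht.2 (by positivity : 0 ≤ 2 * η)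
    linarith
  have hU : ∀ t ∈ Icc 0 T, |freeInvitations lam β g ε w₀ y w t -
      freeInvitations lam β g ε w₀ y' w' t| ≤ (g * β + ε) * (2 * η * T) := fun t ht =>
    (abs_freeInvitations_sub_le hβ hg hε hy hw h.integrable_y h.integrable_w ht.1 le_rfl
      ht.2).trans (mul_le_mul_of_nonneg_left (hI t ht) (by positivity))
  have hκ : 0 ≤ (g * β + ε) * (2 * η * T) := by positivity
  have hbT : 0 ≤ β * (2 * η * T) := by positivity
  refine ⟨hy, hw, fun t ht => ?_, fun t ht s hs => ?_, fun t ht => ?_⟩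
  · have a1 := abs_le.1 (h.near_y t ht)
    have a2 := abs_le.1 (hyη t ht)
    have a3 := abs_le.1 ((abs_integral_drift_sub_le (lam := lam) hβ hy hw h.integrable_y
      h.integrable_w ht).trans (mul_le_mul_of_nonneg_left (hI t ht) hβ))
    rw [abs_le]; constructor <;> linarith
  · have a1 := h.lower t ht s hs
    have a2 := abs_le.1 (hwη t ht)
    have a3 := abs_le.1 (hU t ht)
    have a4 := abs_le.1 (hU s ⟨hs.1, hs.2.trans ht.2⟩)
    have a5 : max 0 (-freeInvitations lam β g ε w₀ y w s) ≤
        max 0 (-freeInvitations lam β g ε w₀ y' w' s) + (g * β + ε) * (2 * η * T) := by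
      refine max_le ?_ ?_
      · linarith [le_max_left 0 (-freeInvitations lam β g ε w₀ y' w' s)]
      · linarith [le_max_right 0 (-freeInvitations lam β g ε w₀ y' w' s)]
    linarith
  · obtain ⟨s, hs, a1⟩ := h.upper t ht
    refine ⟨s, hs, ?_⟩
    have a2 := abs_le.1 (hwη t ht)
    have a3 := abs_le.1 (hU t ht)
    have a4 := abs_le.1 (hU s ⟨hs.1, hs.2.trans ht.2⟩)
    have a5 : max 0 (-freeInvitations lam β g ε w₀ y' w' s) ≤
        max 0 (-freeInvitations lam β g ε w₀ y w s) + (g * β + ε) * (2 * η * T) := by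
      refine max_le ?_ ?_
      · linarith [le_max_left 0 (-freeInvitations lam β g ε w₀ y w s)]
      · linarith [le_max_right 0 (-freeInvitations lam β g ε w₀ y w s)]
    linarith

theorem continuousOn_freeInvitations (hy : IntervalIntegrable y volume 0 T)
    (hw : IntervalIntegrable w volume 0 T) (hT : 0 ≤ T) :
    ContinuousOn (freeInvitations lam β g ε w₀ y w) (Icc 0 T) := by
  have h := intervalIntegral.continuousOn_primitive_interval
    (f := fun s => g * lam - g * β * w s - ε * y s) (a := 0) (b := T) (μ := volume)
    ((intervalIntegrable_iff_integrableOn_Icc_of_le hT).1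
      ((intervalIntegrable_const.sub (hw.const_mul _)).sub (hy.const_mul _)) |>.mono_set
      (by rw [uIcc_of_le hT]))
  rw [uIcc_of_le hT] at h
  exact continuousOn_const.add h

/-- The witness in `upper` depends on `η`; a maximizer of the continuous function `max 0 (-U)` on
the compact `[0, t]` serves for all `η` at once. -/
theorem NearFluid.of_forall_pos (hy : IntervalIntegrable y volume 0 T)
    (hw : IntervalIntegrable w volume 0 T)
    (h : ∀ η, 0 < η → NearFluid lam β g ε y₀ w₀ T η y w) :
    NearFluid lam β g ε y₀ w₀ T 0 y w := by
  refine ⟨hy, hw, fun t ht => ?_, fun t ht s hs => ?_, fun t ht => ?_⟩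
  · exact le_of_forall_pos_le_add fun η hη => by simpa using (h η hη).near_y t ht
  · exact le_of_forall_pos_le_add fun η hη => by linarith [(h η hη).lower t ht s hs]
  · have hc : ContinuousOn (fun s => max 0 (-freeInvitations lam β g ε w₀ y w s)) (Icc 0 t) :=
      continuousOn_const.sup (continuousOn_freeInvitations (hy.mono_right_Icc ht)
        (hw.mono_right_Icc ht) ht.1).neg
    obtain ⟨s, hs, hmax⟩ := isCompact_Icc.exists_isMaxOn (nonempty_Icc.2 ht.1) hc
    refine ⟨s, hs, le_of_forall_pos_le_add fun η hη => ?_⟩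
    obtain ⟨s', hs', h'⟩ := (h η hη).upper t ht
    have := hmax hs'
    simp only [mem_ofPred_eq] at this
    linarith

/-- A sequence of approximate solutions with vanishing errors converges to an exact solution. -/
theorem exists_nearFluid_zero (hβ : 0 ≤ β) (hg : 0 ≤ g) (hε : 0 ≤ ε) {Y W : ℕ → ℝ → ℝ}
    (h : ∀ T η, 0 ≤ T → 0 < η → ∀ᶠ n in atTop, NearFluid lam β g ε y₀ w₀ T η (Y n) (W n)) :
    ∃ y w : ℝ → ℝ, ∀ T, 0 ≤ T → NearFluid lam β g ε y₀ w₀ T 0 y w := by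
  have key : ∀ T η, 0 ≤ T → 0 < η → ∃ N, ∀ m ≥ N, ∀ n ≥ N, ∀ t ∈ Icc 0 T,
      |Y m t - Y n t| + |W m t - W n t| ≤ η := by
    intro T η hT hη
    set K := Real.exp ((β + 2 * (g * β + ε)) * T) with hK
    have hK0 : 0 < K := Real.exp_pos _
    obtain ⟨N, hN⟩ := eventually_atTop.1 (h T (η / (4 * K)) hT (by positivity))
    refine ⟨N, fun m hm n hn t ht => ((hN m hm).dist_le hβ hg hε (hN n hn) t ht).trans ?_⟩
    have : Real.exp ((β + 2 * (g * β + ε)) * t) ≤ K :=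
      Real.exp_le_exp.2 (mul_le_mul_of_nonneg_left ht.2 (by positivity))
    calc 2 * (η / (4 * K) + η / (4 * K)) * Real.exp ((β + 2 * (g * β + ε)) * t)
        ≤ 2 * (η / (4 * K) + η / (4 * K)) * K := by gcongr
      _ = η := by field_simp; ring
  have hcy : ∀ t, 0 ≤ t → ∃ a, Tendsto (fun n => Y n t) atTop (𝓝 a) := fun t ht => by
    refine cauchySeq_tendsto_of_complete (Metric.cauchySeq_iff'.2 fun η hη => ?_)
    obtain ⟨N, hN⟩ := key t (η / 2) ht (by positivity)
    refine ⟨N, fun n hn => ?_⟩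
    have := hN n hn N le_rfl t ⟨ht, le_rfl⟩
    rw [Real.dist_eq]
    linarith [abs_nonneg (W n t - W N t)]
  have hcw : ∀ t, 0 ≤ t → ∃ a, Tendsto (fun n => W n t) atTop (𝓝 a) := fun t ht => by
    refine cauchySeq_tendsto_of_complete (Metric.cauchySeq_iff'.2 fun η hη => ?_)
    obtain ⟨N, hN⟩ := key t (η / 2) ht (by positivity)
    refine ⟨N, fun n hn => ?_⟩
    have := hN n hn N le_rfl t ⟨ht, le_rfl⟩
    rw [Real.dist_eq]
    linarith [abs_nonneg (Y n t - Y N t)]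
  choose! y hy using hcy
  choose! w hw using hcw
  have unif : ∀ T η, 0 ≤ T → 0 < η → ∃ N, ∀ n ≥ N, ∀ t ∈ Icc 0 T,
      |y t - Y n t| ≤ η ∧ |w t - W n t| ≤ η := by
    intro T η hT hη
    obtain ⟨N, hN⟩ := key T η hT hη
    refine ⟨N, fun n hn t ht => ⟨?_, ?_⟩⟩
    · refine le_of_tendsto (((hy t ht.1).sub_const (Y n t)).abs)
        (eventually_atTop.2 ⟨N, fun m hm => ?_⟩)
      linarith [hN m hm n hn t ht, abs_nonneg (W m t - W n t)]
    · refine le_of_tendsto (((hw t ht.1).sub_const (W n t)).abs)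
        (eventually_atTop.2 ⟨N, fun m hm => ?_⟩)
      linarith [hN m hm n hn t ht, abs_nonneg (Y m t - Y n t)]
  -- The limit is measurable as a pointwise limit and integrable because it stays within `1` of an
  -- integrable function.
  have hint : ∀ {f : ℝ → ℝ} {F : ℕ → ℝ → ℝ} {T : ℝ}, 0 ≤ T →
      (∀ᶠ n in atTop, IntervalIntegrable (F n) volume 0 T) →
      (∀ t ∈ Icc 0 T, Tendsto (fun n => F n t) atTop (𝓝 (f t))) →
      (∃ N, ∀ n ≥ N, ∀ t ∈ Icc 0 T, |f t - F n t| ≤ 1) → IntervalIntegrable f volume 0 T := by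
    intro f F T hT hF hlim hclose
    obtain ⟨N, hN⟩ := eventually_atTop.1 hF
    obtain ⟨N', hN'⟩ := hclose
    simp only [intervalIntegrable_iff_integrableOn_Ioc_of_le hT] at hN ⊢
    have hmeas : AEStronglyMeasurable f (volume.restrict (Ioc 0 T)) := by
      refine aestronglyMeasurable_of_tendsto_ae (u := atTop) (f := fun n => F (n + N))
        (fun n => (hN (n + N) (by omega)).aestronglyMeasurable)
        ((ae_restrict_iff' measurableSet_Ioc).2 (ae_of_all _ fun t ht => ?_))
      exact (hlim t ⟨ht.1.le, ht.2⟩).comp (tendsto_add_atTop_nat N)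
    have hk := hN (max N N') (le_max_left _ _)
    refine Integrable.mono' (hk.abs.add (integrable_const 1)) hmeas
      ((ae_restrict_iff' measurableSet_Ioc).2 (ae_of_all _ fun t ht => ?_))
    have h1 := hN' (max N N') (le_max_right _ _) t ⟨ht.1.le, ht.2⟩
    have h2 := abs_add_le (f t - F (max N N') t) (F (max N N') t)
    rw [sub_add_cancel] at h2
    rw [Real.norm_eq_abs]
    simp only [Pi.add_apply]
    linarith
  refine ⟨y, w, fun T hT => ?_⟩
  have iy : IntervalIntegrable y volume 0 T := by
    obtain ⟨N, hN⟩ := unif T 1 hT one_pos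
    exact hint hT ((h T 1 hT one_pos).mono fun n hn => hn.integrable_y) (fun t ht => hy t ht.1)
      ⟨N, fun n hn t ht => (hN n hn t ht).1⟩
  have iw : IntervalIntegrable w volume 0 T := by
    obtain ⟨N, hN⟩ := unif T 1 hT one_pos
    exact hint hT ((h T 1 hT one_pos).mono fun n hn => hn.integrable_w) (fun t ht => hw t ht.1)
      ⟨N, fun n hn t ht => (hN n hn t ht).2⟩
  refine NearFluid.of_forall_pos iy iw fun η hη => ?_
  -- The factor by which `NearFluid.perturb` enlarges the error; an approximant of accuracy `η / c`
  -- yields `η` for the limit.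
  set c := 2 * (1 + (β + 2 * (g * β + ε)) * T) with hc
  have hc0 : 0 < c := by positivity
  obtain ⟨N, hN⟩ := unif T (η / c) hT (by positivity)
  obtain ⟨N', hN'⟩ := eventually_atTop.1 (h T (η / c) hT (by positivity))
  have := (hN' (max N N') (le_max_right _ _)).perturb hβ hg hε iy iw
    (fun t ht => (hN _ (le_max_left _ _) t ht).1) (fun t ht => (hN _ (le_max_left _ _) t ht).2)
  rwa [← hc, mul_div_cancel₀ _ hc0.ne'] at this

end Stability

/-! ### Regular points -/

theorem locallyLipschitzOn_Ici_of_forall {f : ℝ → ℝ}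
    (h : ∀ T, 0 ≤ T → ∃ K, LipschitzOnWith K f (Icc 0 T)) : LocallyLipschitzOn (Ici 0) f := by
  intro t ht
  obtain ⟨K, hK⟩ := h (t + 1) (by linarith [mem_Ici.1 ht])
  refine ⟨K, Icc 0 (t + 1), ?_, hK⟩
  have : Ici 0 ∩ Iio (t + 1) ⊆ Icc 0 (t + 1) := fun s hs => ⟨hs.1, (mem_Iio.1 hs.2).le⟩
  exact mem_of_superset (inter_mem_nhdsWithin _ (Iio_mem_nhds (by linarith))) this

theorem LocallyLipschitzOn.exists_lipschitzOnWith_Icc {f : ℝ → ℝ}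
    (h : LocallyLipschitzOn (Ici 0) f) (T : ℝ) : ∃ K, LipschitzOnWith K f (Icc 0 T) :=
  (h.mono Icc_subset_Ici_self).exists_lipschitzOnWith_of_compact isCompact_Icc

theorem LocallyLipschitzOn.comp_prodMk_Ici {f g : ℝ → ℝ} {F : ℝ × ℝ → ℝ}
    (hF : LipschitzWith 1 F) (hf : LocallyLipschitzOn (Ici 0) f)
    (hg : LocallyLipschitzOn (Ici 0) g) : LocallyLipschitzOn (Ici 0) fun t => F (f t, g t) := by
  refine locallyLipschitzOn_Ici_of_forall fun T _ => ?_
  obtain ⟨K, hK⟩ := hf.exists_lipschitzOnWith_Icc T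
  obtain ⟨K', hK'⟩ := hg.exists_lipschitzOnWith_Icc T
  exact ⟨_, hF.comp_lipschitzOnWith (hK.prodMk hK')⟩

theorem LocallyLipschitzOn.finset_sup' {κ : Type*} {f : κ → ℝ → ℝ}
    (hf : ∀ k, LocallyLipschitzOn (Ici 0) (f k)) (A : Finset κ) (hA : A.Nonempty) :
    LocallyLipschitzOn (Ici 0) fun t => A.sup' hA fun k => f k t := by
  induction hA using Finset.Nonempty.cons_induction with
  | singleton a => simpa using hf a
  | cons a s ha hs ih =>
    simp only [Finset.sup'_cons hs]
    exact (hf a).comp_prodMk_Ici (F := fun p => max p.1 p.2) lipschitzWith_max ih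

theorem LocallyLipschitzOn.finset_inf' {κ : Type*} {f : κ → ℝ → ℝ}
    (hf : ∀ k, LocallyLipschitzOn (Ici 0) (f k)) (A : Finset κ) (hA : A.Nonempty) :
    LocallyLipschitzOn (Ici 0) fun t => A.inf' hA fun k => f k t := by
  induction hA using Finset.Nonempty.cons_induction with
  | singleton a => simpa using hf a
  | cons a s ha hs ih =>
    simp only [Finset.inf'_cons hs]
    exact (hf a).comp_prodMk_Ici (F := fun p => min p.1 p.2) lipschitzWith_min ih

theorem LocallyLipschitzOn.ae_differentiableAt_Ici {f : ℝ → ℝ}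
    (hf : LocallyLipschitzOn (Ici 0) f) :
    ∀ᵐ t ∂(volume.restrict (Ici (0 : ℝ))), DifferentiableAt ℝ f t := by
  have h : ∀ n : ℕ, ∀ᵐ t : ℝ, t ∈ Icc 0 (n : ℝ) → DifferentiableWithinAt ℝ f (Icc 0 (n : ℝ)) t := by
    intro n
    obtain ⟨K, hK⟩ := hf.exists_lipschitzOnWith_Icc n
    exact hK.ae_differentiableWithinAt_of_mem_of_real
  have h0 : ∀ᵐ t : ℝ, t ≠ 0 := by simp [ae_iff]
  rw [ae_restrict_iff' measurableSet_Ici]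
  filter_upwards [ae_all_iff.2 h, h0] with t ht h0 (hpos : 0 ≤ t)
  obtain ⟨n, hn⟩ := exists_nat_gt t
  exact (ht n ⟨hpos, hn.le⟩).differentiableAt (Icc_mem_nhds (lt_of_le_of_ne hpos h0.symm) hn)

/-- The maxima and minima of subfamilies are finitely many locally Lipschitz functions, each
differentiable almost everywhere. -/
theorem ae_isRegularPoint {κ : Type*} [Finite κ] {f : κ → ℝ → ℝ}
    (hf : ∀ k, LocallyLipschitzOn (Ici 0) (f k)) :
    ∀ᵐ t ∂(volume.restrict (Ici (0 : ℝ))), IsRegularPoint f t := by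
  have h0 : ∀ᵐ t ∂(volume.restrict (Ici (0 : ℝ))), 0 < t := by
    have : ∀ᵐ t : ℝ, t ≠ 0 := by simp [ae_iff]
    rw [ae_restrict_iff' measurableSet_Ici]
    filter_upwards [this] with t h0 (hpos : 0 ≤ t)
    exact lt_of_le_of_ne hpos h0.symm
  have h1 : ∀ A : Finset κ, ∀ᵐ t ∂(volume.restrict (Ici (0 : ℝ))), ∀ hA : A.Nonempty,
      DifferentiableAt ℝ (fun u => A.sup' hA fun k => f k u) t ∧
      DifferentiableAt ℝ (fun u => A.inf' hA fun k => f k u) t := by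
    intro A
    by_cases hA : A.Nonempty
    · filter_upwards [(LocallyLipschitzOn.finset_sup' hf A hA).ae_differentiableAt_Ici,
        (LocallyLipschitzOn.finset_inf' hf A hA).ae_differentiableAt_Ici] with t h h' _
      exact ⟨h, h'⟩
    · exact ae_of_all _ fun t h => absurd h hA
  filter_upwards [h0, ae_all_iff.2 h1] with t h h'
  exact ⟨h, h'⟩

theorem IsRegularPoint.differentiableAt {κ : Type*} {f : κ → ℝ → ℝ} {t : ℝ}
    (h : IsRegularPoint f t) (k : κ) : DifferentiableAt ℝ (f k) t := by
  simpa using (h.2 {k} (Finset.singleton_nonempty k)).1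

/-! ### Exact solutions are fluid trajectories -/

section Exact

variable {lam β g ε y₀ w₀ : ℝ} {y w : ℝ → ℝ}

/-- The derivatives are known almost everywhere and can be integrated, so `w = U + R` with `R`
nondecreasing and growing only on `{w = 0}`. With `w ≥ 0` this characterizes `R` as the running
maximum of `max 0 (-U)`. -/
theorem IsFluidTrajectory.nearFluid {x : ℝ → ℝ} (h : IsFluidTrajectory lam β g ε y x) (T : ℝ)
    (hT : 0 ≤ T) (hβ : 0 < β) :
    NearFluid lam β g ε (y 0) (x 0 + lam / β) T 0 y (fun t => x t + lam / β) := by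
  set w : ℝ → ℝ := fun t => x t + lam / β with hw
  have hreg : ∀ᵐ t : ℝ, 0 ≤ t → IsRegularPoint ![y, x] t := by
    have := ae_isRegularPoint (f := ![y, x]) (by
      intro k
      fin_cases k
      exacts [h.locallyLipschitz_y, h.locallyLipschitz_x])
    rwa [ae_restrict_iff' measurableSet_Ici] at this
  have hxβ : ∀ t, β * x t = β * w t - lam := fun t => by simp only [hw]; field_simp; ring
  have hyd : ∀ᵐ t : ℝ, 0 ≤ t → deriv y t = β * w t - lam := by
    filter_upwards [hreg] with t ht h0
    rcases (h.bound t h0).lt_or_eq with h1 | h1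
    · rw [(h.interior t (ht h0) h1).1.deriv, hxβ]
    · rw [(h.boundary t (ht h0) h1.symm).1.deriv, ← hxβ, ← h1]; field_simp
  -- The reflection rate: on the boundary `max d 0 = d + max (-d) 0` with the free drift `d = g *
  -- lam - ε * y t`.
  set L : ℝ → ℝ := fun t => if w t = 0 then max (ε * y t - g * lam) 0 else 0 with hL
  have hxd : ∀ᵐ t : ℝ, 0 ≤ t → deriv x t = (g * lam - g * β * w t - ε * y t) + L t := by
    filter_upwards [hreg] with t ht h0
    rcases (h.bound t h0).lt_or_eq with h1 | h1
    · have hw0 : w t ≠ 0 := by simp only [hw]; intro h2; linarith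
      rw [(h.interior t (ht h0) h1).2.deriv, hL]
      simp only [hw0, if_false]
      linear_combination (-g) * hxβ t
    · have hw0 : w t = 0 := by simp only [hw]; linarith
      rw [(h.boundary t (ht h0) h1.symm).2.deriv, hL]
      simp only [hw0, if_true]
      rcases le_total (g * lam - ε * y t) 0 with h2 | h2
      · rw [max_eq_right h2, max_eq_left (by linarith)]; ring
      · rw [max_eq_left h2, max_eq_right (by linarith)]; ring
  have ac : ∀ {f : ℝ → ℝ}, LocallyLipschitzOn (Ici 0) f → ∀ t, 0 ≤ t →
      AbsolutelyContinuousOnInterval f 0 t := by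
    intro f hf t ht
    obtain ⟨K, hK⟩ := hf.exists_lipschitzOnWith_Icc t
    rw [← uIcc_of_le ht] at hK
    exact hK.absolutelyContinuousOnInterval
  have hyc : ContinuousOn y (Ici 0) := h.locallyLipschitz_y.continuousOn
  have hwc : ContinuousOn w (Ici 0) := h.locallyLipschitz_x.continuousOn.add continuousOn_const
  have int : ∀ {f : ℝ → ℝ} {a b : ℝ}, ContinuousOn f (Ici 0) → 0 ≤ a → 0 ≤ b →
      IntervalIntegrable f volume a b := fun hf ha hb =>
    (hf.mono fun s hs => (le_min ha hb).trans hs.1).intervalIntegrable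
  have hsub : ∀ {a b s : ℝ}, 0 ≤ a → 0 ≤ b → s ∈ uIoc a b → 0 ≤ s := fun ha hb hs =>
    (le_min ha hb).trans hs.1.le
  have hfree : ∀ {a b : ℝ}, 0 ≤ a → 0 ≤ b →
      IntervalIntegrable (fun t => g * lam - g * β * w t - ε * y t) volume a b := fun ha hb =>
    (intervalIntegrable_const.sub ((int hwc ha hb).const_mul _)).sub ((int hyc ha hb).const_mul _)
  have hLi : ∀ {a b : ℝ}, 0 ≤ a → 0 ≤ b → IntervalIntegrable L volume a b := by
    intro a b ha hb
    have hx0 : ∀ c, 0 ≤ c → IntervalIntegrable (deriv x) volume 0 c := fun c hc =>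
      (ac h.locallyLipschitz_x c hc).intervalIntegrable_deriv
    refine (((hx0 a ha).symm.trans (hx0 b hb)).sub (hfree ha hb)).congr_ae ?_
    refine (ae_restrict_iff' measurableSet_uIoc).2 ?_
    filter_upwards [hxd] with s hs hs'
    simp only [hs (hsub ha hb hs')]
    ring
  set R : ℝ → ℝ := fun t => ∫ s in (0)..t, L s with hR
  have hLnn : ∀ s, 0 ≤ L s := fun s => by
    simp only [hL]; split_ifs
    exacts [le_max_right _ _, le_rfl]
  have hwU : ∀ t, 0 ≤ t → w t - freeInvitations lam β g ε (w 0) y w t = R t := by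
    intro t ht
    have h1 := (ac h.locallyLipschitz_x t ht).integral_deriv_eq_sub
    have h2 : ∫ s in (0)..t, deriv x s =
        ∫ s in (0)..t, ((g * lam - g * β * w s - ε * y s) + L s) := by
      refine intervalIntegral.integral_congr_ae ?_
      filter_upwards [hxd] with s hs hs'
      exact hs (hsub le_rfl ht hs')
    rw [intervalIntegral.integral_add (hfree le_rfl ht) (hLi le_rfl ht)] at h2
    simp only [freeInvitations, hR]
    have : w t - w 0 = x t - x 0 := by simp only [hw]; ring
    linarith
  have hRmono : ∀ s t, 0 ≤ s → s ≤ t → R s ≤ R t := fun s t hs hst =>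
    intervalIntegral.integral_mono_interval le_rfl hs hst (ae_of_all _ hLnn)
      (hLi le_rfl (hs.trans hst))
  have hR0 : R 0 = 0 := intervalIntegral.integral_same
  have hwnn : ∀ t, 0 ≤ t → 0 ≤ w t := fun t ht => by
    have := h.bound t ht
    simp only [hw]; linarith
  refine ⟨int hyc le_rfl hT, int hwc le_rfl hT, fun t ht => ?_, fun t ht s hs => ?_, fun t ht => ?_⟩
  · have h1 := (ac h.locallyLipschitz_y t ht.1).integral_deriv_eq_sub
    have h2 : ∫ s in (0)..t, deriv y s = ∫ s in (0)..t, (β * w s - lam) := by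
      refine intervalIntegral.integral_congr_ae ?_
      filter_upwards [hyd] with s hs hs'
      exact hs (hsub le_rfl ht.1 hs')
    rw [← h2, h1]; simp
  · change max 0 (-freeInvitations lam β g ε (w 0) y w s) - 0 ≤ w t -
      freeInvitations lam β g ε (w 0) y w t
    rw [hwU t ht.1, sub_zero]
    refine max_le ?_ ?_
    · rw [← hR0]; exact hRmono 0 t le_rfl ht.1
    · have h1 := hwU s hs.1
      have h2 := hRmono s t hs.1 hs.2
      linarith [hwnn s hs.1]
  · change ∃ s ∈ Icc 0 t, w t - freeInvitations lam β g ε (w 0) y w t ≤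
      max 0 (-freeInvitations lam β g ε (w 0) y w s) + 0
    simp only [hwU t ht.1, add_zero]
    by_cases hz : ∃ s ∈ Icc 0 t, w s = 0
    · have hcl : IsCompact {s | s ∈ Icc 0 t ∧ w s = 0} := by
        have := (hwc.mono Icc_subset_Ici_self : ContinuousOn w (Icc 0 t)).preimage_isClosed_of_isClosed
          isClosed_Icc (isClosed_singleton (x := (0 : ℝ)))
        exact isCompact_Icc.of_isClosed_subset this inter_subset_left
      -- The witness is the last zero of `w` before `t`: after it `R` is constant, and at it `R s =
      -- -U s`.
      obtain ⟨s, hs, hmax⟩ := hcl.exists_isGreatest (by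
        obtain ⟨s, hs, hs'⟩ := hz; exact ⟨s, hs, hs'⟩)
      refine ⟨s, hs.1, ?_⟩
      have h1 : R t = R s := by
        have h2 : R t - R s = ∫ u in s..t, L u :=
          intervalIntegral.integral_interval_sub_left (hLi le_rfl ht.1) (hLi le_rfl hs.1.1)
        have h3 : ∫ u in s..t, L u = ∫ u in s..t, (0 : ℝ) := by
          refine intervalIntegral.integral_congr_ae (ae_of_all _ fun u hu => ?_)
          rw [uIoc_of_le hs.1.2] at hu
          have : w u ≠ 0 := fun hu0 => absurd (hmax ⟨⟨hs.1.1.trans hu.1.le, hu.2⟩, hu0⟩)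
            (not_le.2 hu.1)
          simp [hL, this]
        rw [h3, intervalIntegral.integral_zero] at h2
        linarith
      rw [h1, ← hwU s hs.1.1, hs.2, zero_sub]
      exact le_max_right _ _
    · push Not at hz
      refine ⟨0, ⟨le_rfl, ht.1⟩, ?_⟩
      have : R t = 0 := by
        have h3 : R t = ∫ u in (0)..t, (0 : ℝ) := by
          refine intervalIntegral.integral_congr_ae (ae_of_all _ fun u hu => ?_)
          rw [uIoc_of_le ht.1] at hu
          simp [hL, hz u ⟨hu.1.le, hu.2⟩]
        rw [h3, intervalIntegral.integral_zero]
      rw [this]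
      exact le_max_left _ _

/-- The running maximum `R = w - U` inherits a Lipschitz constant from `U` and is locally constant
where `w > 0`, which gives the interior equation. On the boundary a derivative of `x` must vanish,
because `x` has a minimum there. -/
theorem isFluidTrajectory_of_nearFluid (hβ : 0 < β)
    (hw₀ : 0 ≤ w₀) (h : ∀ T, 0 ≤ T → NearFluid lam β g ε y₀ w₀ T 0 y w) :
    IsFluidTrajectory lam β g ε y (fun t => w t - lam / β) ∧ y 0 = y₀ ∧ w 0 = w₀ := by
  set U := freeInvitations lam β g ε w₀ y w with hU
  set R : ℝ → ℝ := fun t => w t - U t with hR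
  have hint_y := fun T hT => (h T hT).integrable_y
  have hint_w := fun T hT => (h T hT).integrable_w
  have hyeq : ∀ t, 0 ≤ t → y t = y₀ + ∫ s in (0)..t, (β * w s - lam) := fun t ht => by
    have := abs_nonpos_iff.1 ((h t ht).near_y t ⟨ht, le_rfl⟩)
    linarith
  have hlow : ∀ s t, 0 ≤ s → s ≤ t → max 0 (-U s) ≤ R t := fun s t hs hst => by
    have := (h t (hs.trans hst)).lower t ⟨hs.trans hst, le_rfl⟩ s ⟨hs, hst⟩
    rwa [sub_zero] at this
  have hup : ∀ t, 0 ≤ t → ∃ s ∈ Icc 0 t, R t ≤ max 0 (-U s) := fun t ht => by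
    have := (h t ht).upper t ⟨ht, le_rfl⟩
    simp only [add_zero] at this
    exact this
  have hRnn : ∀ t, 0 ≤ t → 0 ≤ R t := fun t ht => (le_max_left _ _).trans (hlow t t ht le_rfl)
  have hRmono : ∀ s t, 0 ≤ s → s ≤ t → R s ≤ R t := fun s t hs hst => by
    obtain ⟨u, hu, h1⟩ := hup s hs
    exact h1.trans (hlow u t hu.1 (hu.2.trans hst))
  have hwnn : ∀ t, 0 ≤ t → 0 ≤ w t := fun t ht => by
    have h1 := (le_max_right _ _).trans (hlow t t ht le_rfl)
    have h2 : R t = w t - U t := rfl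
    linarith
  have hy0 : y 0 = y₀ := by simpa using hyeq 0 le_rfl
  have hU0 : U 0 = w₀ := by simp [hU, freeInvitations]
  have hw0 : w 0 = w₀ := by
    obtain ⟨s, hs, h1⟩ := hup 0 le_rfl
    have hs0 : s = 0 := le_antisymm hs.2 hs.1
    rw [hs0, hU0, max_eq_left (by linarith)] at h1
    have h2 := hRnn 0 le_rfl
    simp only [hR, hU0] at h1 h2
    linarith
  have hUc : ∀ T, 0 ≤ T → ContinuousOn U (Icc 0 T) := fun T hT =>
    continuousOn_freeInvitations (hint_y T hT) (hint_w T hT) hT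
  have hbound : ∀ T, 0 ≤ T → ∃ B, 0 ≤ B ∧ ∀ t ∈ Icc 0 T, |y t| ≤ B ∧ |w t| ≤ B := by
    intro T hT
    obtain ⟨B₁, hB₁⟩ := isCompact_Icc.exists_bound_of_continuousOn (hUc T hT)
    have hyc : ContinuousOn y (Icc 0 T) := by
      have h1 := intervalIntegral.continuousOn_primitive_interval
        (f := fun s => β * w s - lam) (a := 0) (b := T) (μ := volume)
        ((intervalIntegrable_iff_integrableOn_Icc_of_le hT).1
          (((hint_w T hT).const_mul _).sub intervalIntegrable_const) |>.mono_set
          (by rw [uIcc_of_le hT]))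
      rw [uIcc_of_le hT] at h1
      exact (continuousOn_const.add h1).congr fun t ht => hyeq t ht.1
    obtain ⟨B₂, hB₂⟩ := isCompact_Icc.exists_bound_of_continuousOn hyc
    have h0 : (0 : ℝ) ∈ Icc 0 T := ⟨le_rfl, hT⟩
    have hB₁0 : 0 ≤ B₁ := (norm_nonneg _).trans (hB₁ 0 h0)
    refine ⟨max (2 * B₁) B₂, le_max_of_le_left (by linarith), fun t ht =>
      ⟨(hB₂ t ht).trans (le_max_right _ _), le_max_of_le_left ?_⟩⟩
    obtain ⟨s, hs, h1⟩ := hup t ht.1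
    have h2 := abs_le.1 (hB₁ s ⟨hs.1, hs.2.trans ht.2⟩)
    have h3 := abs_le.1 (hB₁ t ht)
    have h4 : max 0 (-U s) ≤ B₁ := max_le hB₁0 (by linarith)
    have h5 : R t = w t - U t := rfl
    rw [abs_of_nonneg (hwnn t ht.1)]
    linarith
  have hprim : ∀ {f : ℝ → ℝ} {T B : ℝ}, IntervalIntegrable f volume 0 T →
      (∀ t ∈ Icc 0 T, |f t| ≤ B) → ∀ s t, 0 ≤ s → s ≤ t → t ≤ T →
      |(∫ u in (0)..t, f u) - ∫ u in (0)..s, f u| ≤ B * (t - s) := by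
    intro f T B hf hB s t hs hst htT
    rw [intervalIntegral.integral_interval_sub_left (hf.mono_right_Icc ⟨hs.trans hst, htT⟩)
      (hf.mono_right_Icc ⟨hs, hst.trans htT⟩)]
    have := intervalIntegral.norm_integral_le_of_norm_le_const (a := s) (b := t) (f := f) (C := B)
      (fun u hu => by
        rw [uIoc_of_le hst] at hu
        exact hB u ⟨hs.trans hu.1.le, hu.2.trans htT⟩)
    rwa [abs_of_nonneg (sub_nonneg.2 hst)] at this
  have hlip : ∀ {f : ℝ → ℝ} {T K : ℝ}, 0 ≤ K →
      (∀ s t, 0 ≤ s → s ≤ t → t ≤ T → |f t - f s| ≤ K * (t - s)) →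
      LipschitzOnWith (Real.toNNReal K) f (Icc 0 T) := by
    intro f T K hK hf
    refine LipschitzOnWith.of_dist_le_mul fun s hs t ht => ?_
    rw [Real.coe_toNNReal K hK]
    rcases le_total s t with hst | hst
    · rw [dist_comm, Real.dist_eq, dist_comm, Real.dist_eq, abs_of_nonneg (sub_nonneg.2 hst)]
      exact hf s t hs.1 hst ht.2
    · rw [Real.dist_eq, Real.dist_eq, abs_of_nonneg (sub_nonneg.2 hst)]
      exact hf t s ht.1 hst hs.2
  have hyL : LocallyLipschitzOn (Ici 0) y := by
    refine locallyLipschitzOn_Ici_of_forall fun T hT => ?_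
    obtain ⟨B, hB0, hB⟩ := hbound T hT
    refine ⟨_, hlip (K := β * B + |lam|) (by positivity) fun s t hs hst htT => ?_⟩
    rw [hyeq s hs, hyeq t (hs.trans hst), add_sub_add_left_eq_sub]
    refine hprim (((hint_w T hT).const_mul _).sub intervalIntegrable_const) (fun u hu => ?_)
      s t hs hst htT
    refine (abs_sub _ _).trans ?_
    rw [abs_mul, abs_of_pos hβ]
    have := (hB u hu).2
    gcongr
  have hUL : ∀ T, 0 ≤ T → ∃ K, 0 ≤ K ∧
      ∀ s t, 0 ≤ s → s ≤ t → t ≤ T → |U t - U s| ≤ K * (t - s) := by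
    intro T hT
    obtain ⟨B, hB0, hB⟩ := hbound T hT
    refine ⟨|g * lam| + |g * β| * B + |ε| * B, by positivity, fun s t hs hst htT => ?_⟩
    simp only [hU, freeInvitations, add_sub_add_left_eq_sub]
    refine hprim ((intervalIntegrable_const.sub ((hint_w T hT).const_mul _)).sub
      ((hint_y T hT).const_mul _)) (fun u hu => ?_) s t hs hst htT
    refine (abs_sub _ _).trans (add_le_add ((abs_sub _ _).trans (add_le_add le_rfl ?_)) ?_)
    · rw [abs_mul (g * β)]
      have := (hB u hu).2
      gcongr
    · rw [abs_mul]
      have := (hB u hu).1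
      gcongr
  have hwL : LocallyLipschitzOn (Ici 0) w := by
    refine locallyLipschitzOn_Ici_of_forall fun T hT => ?_
    obtain ⟨K, hK0, hK⟩ := hUL T hT
    refine ⟨_, hlip (K := 2 * K) (by positivity) fun s t hs hst htT => ?_⟩
    have h1 : R t - R s ≤ K * (t - s) := by
      obtain ⟨u, hu, h1⟩ := hup t (hs.trans hst)
      have h0 : 0 ≤ K * (t - s) := mul_nonneg hK0 (sub_nonneg.2 hst)
      rcases le_total u s with hus | hus
      · linarith [hlow u s hu.1 hus]
      · have h2 := (abs_le.1 (hK s u hs hus (hu.2.trans htT))).1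
        have h3 := (le_max_right _ _).trans (hlow s s hs le_rfl)
        have h4 := hRnn s hs
        have h5 : K * (u - s) ≤ K * (t - s) := by gcongr; exact hu.2
        have h6 : max 0 (-U u) ≤ R s + K * (t - s) := max_le (by linarith) (by linarith)
        linarith
    have h2 := hRmono s t hs hst
    have h3 := abs_le.1 (hK s t hs hst htT)
    have h4 : R t = w t - U t := rfl
    have h5 : R s = w s - U s := rfl
    rw [abs_le]; constructor <;> linarith [h3.1, h3.2]
  have hyc : ∀ t, 0 < t → ContinuousAt y t := fun t ht =>
    hyL.continuousOn.continuousAt (Ici_mem_nhds ht)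
  have hwc : ∀ t, 0 < t → ContinuousAt w t := fun t ht =>
    hwL.continuousOn.continuousAt (Ici_mem_nhds ht)
  have hft : ∀ {f : ℝ → ℝ}, ContinuousOn f (Ici 0) → ∀ t, 0 < t →
      HasDerivAt (fun t => ∫ s in (0)..t, f s) (f t) t := by
    intro f hf t ht
    refine intervalIntegral.integral_hasDerivAt_right
      (hf.mono fun s hs => (le_min le_rfl ht.le).trans hs.1).intervalIntegrable ?_
      (hf.continuousAt (Ici_mem_nhds ht))
    exact ⟨Ici 0, Ici_mem_nhds ht, hf.aestronglyMeasurable measurableSet_Ici⟩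
  have hyd : ∀ t, 0 < t → HasDerivAt y (β * w t - lam) t := by
    intro t ht
    refine ((hft (f := fun s => β * w s - lam) (by
      have := hwL.continuousOn; fun_prop) t ht).const_add y₀).congr_of_eventuallyEq ?_
    filter_upwards [Ioi_mem_nhds ht] with s hs using hyeq s (mem_Ioi.1 hs).le
  have hUd : ∀ t, 0 < t → HasDerivAt U (g * lam - g * β * w t - ε * y t) t := fun t ht =>
    (hft (f := fun s => g * lam - g * β * w s - ε * y s) (by
      have := hwL.continuousOn; have := hyL.continuousOn; fun_prop) t ht).const_add w₀
  refine ⟨⟨hyL, ?_, fun t ht => ?_, fun t hreg hpos => ?_, fun t hreg hzero => ?_⟩, hy0, hw0⟩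
  · simpa [sub_eq_add_neg] using hyL.comp_prodMk_Ici (F := fun p => p.2 + -(lam / β)) (by
      simpa using (LipschitzWith.prod_snd (α := ℝ) (β := ℝ)).add
        (LipschitzWith.const (-(lam / β)))) hwL
  · linarith [hwnn t ht]
  · have ht := hreg.1
    have hwt : 0 < w t := by linarith
    have e1 : β * (w t - lam / β) = β * w t - lam := by field_simp
    refine ⟨by rw [e1]; exact hyd t ht, ?_⟩
    have hev : ∀ᶠ s in 𝓝 t, 0 < w s ∧ 0 < s :=
      ((hwc t ht).eventually (lt_mem_nhds hwt)).and (lt_mem_nhds ht)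
    obtain ⟨δ, hδ, hball⟩ := Metric.eventually_nhds_iff_ball.1 hev
    -- Where `w > 0`, `-U s = R s - w s < R s`, so no new record of `-U` is set there.
    have hconst : ∀ a b, a ∈ Metric.ball t δ → b ∈ Metric.ball t δ → a ≤ b → R a = R b := by
      intro a b ha hb hab
      have ha0 := (hball a ha).2.le
      refine le_antisymm (hRmono a b ha0 hab) ?_
      obtain ⟨s, hs, h1⟩ := hup b (ha0.trans hab)
      rcases le_total s a with hsa | hsa
      · exact h1.trans (hlow s a hs.1 hsa)
      · have hsb : s ∈ Metric.ball t δ := by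
          rw [Real.ball_eq_Ioo] at *
          exact ⟨ha.1.trans_le hsa, hs.2.trans_lt hb.2⟩
        have h2 := (hball s hsb).1
        have h3 : R s = w s - U s := rfl
        have h4 := hRmono s b hs.1 hs.2
        rcases max_cases 0 (-U s) with h5 | h5
        · linarith [hRnn a ha0]
        · linarith
    have hR' : ∀ᶠ s in 𝓝 t, w s - lam / β = U s + (R t - lam / β) := by
      filter_upwards [Metric.ball_mem_nhds t hδ] with s hs
      have : R s = R t := by
        rcases le_total s t with h1 | h1
        · exact hconst s t hs (Metric.mem_ball_self hδ) h1
        · exact (hconst t s (Metric.mem_ball_self hδ) hs h1).symm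
      have h3 : R s = w s - U s := rfl
      linarith
    have h1 := ((hUd t ht).add_const (R t - lam / β)).congr_of_eventuallyEq hR'
    have e2 : -(g * β * (w t - lam / β)) - ε * y t = g * lam - g * β * w t - ε * y t := by
      field_simp; ring
    rw [e2]; exact h1
  · have ht := hreg.1
    have hwt : w t = 0 := by linarith
    have hdiff : DifferentiableAt ℝ (fun t => w t - lam / β) t := hreg.differentiableAt 1
    have hmin : IsLocalMin (fun t => w t - lam / β) t := by
      filter_upwards [Ioi_mem_nhds ht] with s hs
      have := hwnn s (mem_Ioi.1 hs).le
      linarith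
    have hd0 := hmin.deriv_eq_zero
    refine ⟨by have := hyd t ht; rwa [hwt, mul_zero, zero_sub] at this, ?_⟩
    -- If the free drift were positive, `U` would be smaller just before `t`; since `R` is
    -- nondecreasing, `w` would be negative there. Hence the prescribed boundary derivative is `0`,
    -- as the minimum requires.
    have hneg : g * lam - ε * y t ≤ 0 := by
      by_contra! hcon
      have hUt := hUd t ht
      rw [hwt, mul_zero, sub_zero] at hUt
      have hev : ∀ᶠ s in 𝓝[<] t, U s < U t := by
        have h1 := (hasDerivWithinAt_iff_tendsto_slope' (s := Iio t) (by simp)).1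
          hUt.hasDerivWithinAt
        filter_upwards [h1.eventually (lt_mem_nhds hcon), self_mem_nhdsWithin] with s hs hst
        rw [slope_comm, slope_def_field] at hs
        have : 0 < t - s := sub_pos.2 hst
        have := (div_pos_iff_of_pos_right this).1 hs
        linarith
      obtain ⟨s, hs1, hs2, hs3⟩ := (hev.and ((Ioo_mem_nhdsLT ht : Ioo 0 t ∈ 𝓝[<] t))).exists
      have h1 := hRmono s t hs2.le hs3.le
      have h2 := hwnn s hs2.le
      have h3 : R s = w s - U s := rfl
      have h4 : R t = w t - U t := rfl
      linarith
    rw [max_eq_right hneg, ← hd0]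
    exact hdiff.hasDerivAt

end Exact

/-! ### The invitation scheme as a chain driven by four clocks -/

/-- The rates of arrivals, acceptances, effective additional events for `Y > 0`, and additional
events for `Y < 0`. -/
def eventRate (Λ β ε : ℝ) : Fin (3 + 1) → ℤ × ℕ → ℝ :=
  ![fun _ => Λ, fun s => β * s.2, fun s => if s.2 = 0 then 0 else ε * max (s.1 : ℝ) 0,
    fun s => ε * max (-(s.1 : ℝ)) 0]

/-- The effects of arrivals, acceptances, and additional events. -/
def eventNext (γ : ℕ) : Fin (3 + 1) → ℤ × ℕ → ℤ × ℕ :=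
  ![afterArrival γ, afterAcceptance γ, afterAdditional, afterAdditional]

theorem eventRate_nonneg {Λ β ε : ℝ} (hΛ : 0 ≤ Λ) (hβ : 0 ≤ β) (hε : 0 ≤ ε) (i : Fin (3 + 1))
    (s : ℤ × ℕ) : 0 ≤ eventRate Λ β ε i s := by
  fin_cases i
  · exact hΛ
  · exact mul_nonneg hβ (Nat.cast_nonneg _)
  · change 0 ≤ if s.2 = 0 then (0 : ℝ) else ε * max (s.1 : ℝ) 0
    split_ifs
    exacts [le_rfl, mul_nonneg hε (le_max_right _ _)]
  · exact mul_nonneg hε (le_max_right _ _)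

theorem sum_eventRate_pos {Λ β ε : ℝ} (hΛ : 0 < Λ) (hβ : 0 ≤ β) (hε : 0 ≤ ε) (s : ℤ × ℕ) :
    0 < ∑ i, eventRate Λ β ε i s :=
  lt_of_lt_of_le (show 0 < eventRate Λ β ε 0 s from hΛ)
    (Finset.single_le_sum (fun i _ => eventRate_nonneg hΛ.le hβ hε i s) (Finset.mem_univ 0))

/-- Arrivals and acceptances always change `Y`. An additional event leaves the state fixed only if
`Y = 0`, or `Y > 0` and `X = 0`, and then both additional clocks have rate `0`; otherwise exactly
one of them runs, at rate `ε |Y|`. -/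
theorem eventJumpRate_eq_invitationRate (Λ β ε : ℝ) (γ : ℕ) :
    eventJumpRate (eventRate Λ β ε) (eventNext γ) = invitationRate Λ β ε γ := by
  classical
  funext s s'
  obtain ⟨a, n⟩ := s
  have e : eventJumpRate (eventRate Λ β ε) (eventNext γ) (a, n) s' =
      (if s' = afterArrival γ (a, n) then Λ else 0) +
      (if s' = afterAcceptance γ (a, n) then β * (n : ℝ) else 0) +
      (if s' = afterAdditional (a, n) then if n = 0 then 0 else ε * max (a : ℝ) 0 else 0) +
      (if s' = afterAdditional (a, n) then ε * max (-(a : ℝ)) 0 else 0) := by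
    rw [eventJumpRate, Fin.sum_univ_four]; congr
  rw [e, invitationRate]
  by_cases h : s' = (a, n)
  · have h1 : s' ≠ afterArrival γ (a, n) := by
      rw [h]; intro h'; have := congrArg Prod.fst h'; simp [afterArrival] at this; omega
    have h2 : s' ≠ afterAcceptance γ (a, n) := by
      rw [h]; intro h'; have := congrArg Prod.fst h'; simp [afterAcceptance] at this
    rw [if_pos h, if_neg h1, if_neg h2]
    by_cases h3 : s' = afterAdditional (a, n)
    · rw [if_pos h3, if_pos h3]
      have h4 := congrArg Prod.snd (h.symm.trans h3)
      simp only [afterAdditional] at h4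
      rcases lt_trichotomy a 0 with ha | ha | ha
      · rw [if_pos ha] at h4; omega
      · simp [ha]
      · rw [if_neg (not_lt.2 ha.le), if_pos ha] at h4
        have hn : n = 0 := by omega
        have : (0 : ℝ) < a := by exact_mod_cast ha
        rw [if_pos hn, max_eq_right (by linarith)]; simp
    · rw [if_neg h3, if_neg h3]; simp
  · rw [if_neg h, add_assoc]
    congr 1
    by_cases h3 : s' = afterAdditional (a, n)
    · rw [if_pos h3, if_pos h3, if_pos h3]
      rcases lt_trichotomy a 0 with ha | ha | ha
      · have : (a : ℝ) < 0 := by exact_mod_cast ha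
        rw [max_eq_right this.le, max_eq_left (by linarith), abs_of_neg this]; simp
      · simp [ha]
      · have h0 : (0 : ℝ) < a := by exact_mod_cast ha
        have hn : n ≠ 0 := by
          rintro rfl
          exact h (by rw [h3]; simp [afterAdditional, ha, not_lt.2 ha.le])
        rw [if_neg hn, max_eq_left h0.le, max_eq_right (by linarith), abs_of_pos h0]; simp
    · rw [if_neg h3, if_neg h3, if_neg h3]; simp

/-- A positive rate excludes the degenerate branches, so truncated subtraction and the sign test
disappear from the effects. -/
theorem event_cases {Λ β ε : ℝ} (γ : ℕ) {j : Fin (3 + 1)} {s : ℤ × ℕ}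
    (h : 0 < eventRate Λ β ε j s) :
    (j = 0 ∧ eventNext γ j s = (s.1 - 1, s.2 + γ)) ∨
    (j = 1 ∧ 0 < s.2 ∧ eventNext γ j s = (s.1 + 1, s.2 - min γ s.2)) ∨
    (j = 2 ∧ 0 < s.2 ∧ eventNext γ j s = (s.1, s.2 - 1)) ∨
    (j = 3 ∧ eventNext γ j s = (s.1, s.2 + 1)) := by
  fin_cases j
  · left; exact ⟨rfl, rfl⟩
  · right; left
    refine ⟨rfl, Nat.pos_of_ne_zero fun h0 => ?_, rfl⟩
    change 0 < β * (s.2 : ℝ) at h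
    simp [h0] at h
  · right; right; left
    change 0 < if s.2 = 0 then (0 : ℝ) else ε * max (s.1 : ℝ) 0 at h
    have h0 : s.2 ≠ 0 := fun h0 => by simp [h0] at h
    rw [if_neg h0] at h
    have h1 : 0 < s.1 := by
      by_contra! hle
      have : (s.1 : ℝ) ≤ 0 := by exact_mod_cast hle
      simp [max_eq_right this] at h
    refine ⟨rfl, Nat.pos_of_ne_zero h0, ?_⟩
    change afterAdditional s = _
    simp [afterAdditional, h1, not_lt.2 h1.le]
  · right; right; right
    change 0 < ε * max (-(s.1 : ℝ)) 0 at h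
    have h1 : s.1 < 0 := by
      by_contra! hle
      have : (0 : ℝ) ≤ s.1 := by exact_mod_cast hle
      rw [max_eq_right (by linarith)] at h
      simp at h
    refine ⟨rfl, ?_⟩
    change afterAdditional s = _
    simp [afterAdditional, h1]

/-! ### Balance equations, a priori bound and non-explosion -/

section Path

variable {Λ β ε : ℝ} {γ : ℕ} {w : Fin (3 + 1) → ℕ → ℝ} {J : ℕ → ℤ × ℕ} {H : ℕ → ℝ}
  {e : ℕ → Fin (3 + 1)}

/-- The total shortfall of the first `n` jumps: an acceptance with `X < γ` removes only `X`
invitations. -/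
def shortfall (γ : ℕ) (J : ℕ → ℤ × ℕ) (e : ℕ → Fin (3 + 1)) (n : ℕ) : ℝ :=
  ∑ k ∈ Finset.range n, if e k = 1 then (γ : ℝ) - min γ (J k).2 else 0

theorem IsClockPath.queue_eq (h : IsClockPath (eventRate Λ β ε) (eventNext γ) w J H e)
    (n : ℕ) :
    ((J n).1 : ℝ) = (J 0).1 - eventCount e 0 n + eventCount e 1 n := by
  induction n with
  | zero => simp [eventCount]
  | succ n ih =>
    rw [h.state_succ, eventCount_succ, eventCount_succ]
    rcases event_cases γ (h.rate_pos n) with ⟨hj, hn⟩ | ⟨hj, -, hn⟩ | ⟨hj, -, hn⟩ | ⟨hj, hn⟩ <;>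
    · rw [hn, hj]
      simp
      linarith

theorem IsClockPath.invitations_eq (h : IsClockPath (eventRate Λ β ε) (eventNext γ) w J H e)
    (n : ℕ) :
    ((J n).2 : ℝ) = (J 0).2 + γ * eventCount e 0 n - γ * eventCount e 1 n + shortfall γ J e n -
      eventCount e 2 n + eventCount e 3 n := by
  induction n with
  | zero => simp [eventCount, shortfall]
  | succ n ih =>
    rw [h.state_succ, eventCount_succ, eventCount_succ, eventCount_succ, eventCount_succ, shortfall,
      Finset.sum_range_succ, ← shortfall]
    rcases event_cases γ (h.rate_pos n) with ⟨hj, hn⟩ | ⟨hj, h0, hn⟩ | ⟨hj, h0, hn⟩ | ⟨hj, hn⟩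
    · rw [hn, hj]; simp; linarith
    · rw [hn, hj]; simp [Nat.cast_sub (min_le_right γ (J n).2)]; linarith
    · rw [hn, hj]; simp [Nat.cast_sub (Nat.succ_le_of_lt h0)]; linarith
    · rw [hn, hj]; simp; linarith

/-- Acceptances occur only at `X > 0`, so each removes at least one invitation. Thus the acceptances
and removals are controlled by the arrivals and additions alone, which makes the a priori bound
independent of `β`. -/
theorem IsClockPath.invitations_add_le
    (h : IsClockPath (eventRate Λ β ε) (eventNext γ) w J H e) (hγ : 0 < γ)
    (n : ℕ) :
    (J n).2 + eventCount e 1 n + eventCount e 2 n ≤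
      (J 0).2 + γ * eventCount e 0 n + eventCount e 3 n := by
  induction n with
  | zero => simp [eventCount]
  | succ n ih =>
    rw [h.state_succ, eventCount_succ, eventCount_succ, eventCount_succ, eventCount_succ]
    rcases event_cases γ (h.rate_pos n) with ⟨hj, hn⟩ | ⟨hj, h0, hn⟩ | ⟨hj, h0, hn⟩ | ⟨hj, hn⟩
    · rw [hn, hj]; simp [mul_add]; omega
    · rw [hn, hj]; simp; omega
    · rw [hn, hj]; simp; omega
    · rw [hn, hj]; simp; omega

/-- The value at the time `u` after the `n`-th jump of the integral of the step function with
values `h`. -/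
def stepIntegral (h H : ℕ → ℝ) (n : ℕ) (u : ℝ) : ℝ :=
  ∑ k ∈ Finset.range n, h k * H k + h n * u

theorem stepIntegral_zero (h H : ℕ → ℝ) (n : ℕ) :
    stepIntegral h H n 0 = ∑ k ∈ Finset.range n, h k * H k := by simp [stepIntegral]

theorem stepIntegral_self (h H : ℕ → ℝ) (n : ℕ) :
    stepIntegral h H n (H n) = stepIntegral h H (n + 1) 0 := by
  simp [stepIntegral, Finset.sum_range_succ]

theorem intervalIntegral_jumpIndex {H : ℕ → ℝ} (hH : ∀ n, 0 ≤ H n) (h : ℕ → ℝ) (n : ℕ) {u : ℝ}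
    (hu : u ∈ Icc 0 (H n)) :
    IntervalIntegrable (fun s => h (jumpIndex H s)) volume 0 (∑ k ∈ Finset.range n, H k + u) ∧
      ∫ s in (0)..(∑ k ∈ Finset.range n, H k + u), h (jumpIndex H s) = stepIntegral h H n u := by
  have hloc : ∀ n, ∀ u ∈ Icc 0 (H n), ∀ᵐ s : ℝ,
      s ∈ uIoc (∑ k ∈ Finset.range n, H k) (∑ k ∈ Finset.range n, H k + u) →
      h (jumpIndex H s) = h n := by
    intro n u hu
    -- At the right endpoint the path may already have jumped; this single point is negligible.
    have : ∀ᵐ s : ℝ, s ≠ ∑ k ∈ Finset.range (n + 1), H k := by simp [ae_iff]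
    filter_upwards [this] with s hs hs'
    rw [uIoc_of_le (by linarith [hu.1])] at hs'
    rw [jumpIndex_eq hH hs'.1.le]
    refine lt_of_le_of_ne (hs'.2.trans ?_) hs
    rw [Finset.sum_range_succ]
    linarith [hu.2]
  have hpiece : ∀ n, ∀ u ∈ Icc 0 (H n),
      IntervalIntegrable (fun s => h (jumpIndex H s)) volume (∑ k ∈ Finset.range n, H k)
        (∑ k ∈ Finset.range n, H k + u) ∧
      ∫ s in (∑ k ∈ Finset.range n, H k)..(∑ k ∈ Finset.range n, H k + u), h (jumpIndex H s) =
        h n * u := by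
    intro n u hu
    constructor
    · refine (intervalIntegrable_const (c := h n)).congr_ae
        ((ae_restrict_iff' measurableSet_uIoc).2 ?_)
      filter_upwards [hloc n u hu] with s hs hs' using (hs hs').symm
    · rw [intervalIntegral.integral_congr_ae (hloc n u hu), intervalIntegral.integral_const,
        smul_eq_mul]
      ring
  induction n generalizing u with
  | zero =>
    have := hpiece 0 u hu
    simpa [stepIntegral] using this
  | succ n ih =>
    obtain ⟨h1, h2⟩ := ih ⟨hH n, le_rfl⟩
    rw [← Finset.sum_range_succ] at h1 h2
    obtain ⟨h3, h4⟩ := hpiece (n + 1) u hu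
    refine ⟨h1.trans h3, ?_⟩
    rw [← intervalIntegral.integral_add_adjacent_intervals h1 h3, h2, h4, stepIntegral_self]
    simp [stepIntegral]

theorem jumpIndex_spec {H : ℕ → ℝ}
    (htop : Tendsto (fun n => ∑ k ∈ Finset.range n, H k) atTop atTop) {t : ℝ} (ht : 0 ≤ t) :
    ∑ k ∈ Finset.range (jumpIndex H t), H k ≤ t ∧
      t < ∑ k ∈ Finset.range (jumpIndex H t + 1), H k := by
  have hne : ({n | t < ∑ i ∈ Finset.range (n + 1), H i} : Set ℕ).Nonempty :=
    ((tendsto_add_atTop_nat 1).eventually (htop.eventually_gt_atTop t)).exists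
  refine ⟨?_, Nat.sInf_mem hne⟩
  rcases Nat.eq_zero_or_pos (jumpIndex H t) with h0 | h0
  · rw [h0]; simpa using ht
  · by_contra! hlt
    have h1 : jumpIndex H t ≤ jumpIndex H t - 1 := Nat.sInf_le (by
      rw [mem_ofPred_eq, Nat.sub_add_cancel h0]; exact hlt)
    omega

/-- Discrete Grönwall: each step multiplies the right-hand bound by at most `1 + c * H n ≤ exp (c *
H n)`. -/
theorem le_mul_exp_of_le_add_sum {v H : ℕ → ℝ} {a c : ℝ} (ha : 0 ≤ a) (hc : 0 ≤ c)
    (hv0 : ∀ n, 0 ≤ v n)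
    (hH : ∀ n, 0 ≤ H n)
    {N : ℕ} (hv : ∀ n ≤ N, v n ≤ a + c * ∑ k ∈ Finset.range n, v k * H k) (n : ℕ) (hn : n ≤ N) :
    a + c * ∑ k ∈ Finset.range n, v k * H k ≤ a * Real.exp (c * ∑ k ∈ Finset.range n, H k) := by
  induction n with
  | zero => simp
  | succ n ih =>
    have h1 := ih (by omega)
    have h2 := hv n (by omega)
    set W := a + c * ∑ k ∈ Finset.range n, v k * H k with hW
    have h3 : a + c * ∑ k ∈ Finset.range (n + 1), v k * H k = W + c * (v n * H n) := by
      rw [Finset.sum_range_succ, hW]; ring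
    rw [h3, Finset.sum_range_succ, mul_add, Real.exp_add]
    have h4 : W + c * (v n * H n) ≤ W * (1 + c * H n) := by
      have := mul_le_mul_of_nonneg_left h2 (mul_nonneg hc (hH n))
      linarith
    have hW0 : 0 ≤ W := add_nonneg ha (mul_nonneg hc (Finset.sum_nonneg fun k _ =>
      mul_nonneg (hv0 k) (hH k)))
    refine h4.trans ?_
    rw [← mul_assoc a]
    refine mul_le_mul h1 ?_ ?_ ?_
    · linarith [Real.add_one_le_exp (c * H n)]
    · have := mul_nonneg hc (hH n); positivity
    · positivity

/-- The bound on the states and on the number of jumps up to time `T`. -/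
def pathBound (Λ ε : ℝ) (γ : ℕ) (C T : ℝ) (s : ℤ × ℕ) : ℝ :=
  (|(s.1 : ℝ)| + s.2 + (1 + γ) * (2 * Λ * T + C) + C) * Real.exp (2 * ε * T)

theorem pathBound_nonneg {C T : ℝ} (hΛ : 0 ≤ Λ) (hC : 0 ≤ C) (hT : 0 ≤ T) (s : ℤ × ℕ) :
    0 ≤ pathBound Λ ε γ C T s := by
  unfold pathBound; positivity

/-- Throughout the `n`-th holding interval the internal time lies between two consecutive partial
sums of the clock, so the renewal estimate applies. -/
theorem IsClockPath.abs_eventCount_sub_le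
    {rate : Fin (3 + 1) → ℤ × ℕ → ℝ} {next : Fin (3 + 1) → ℤ × ℕ → ℤ × ℕ}
    (h : IsClockPath rate next w J H e) (hrate : ∀ i s, 0 ≤ rate i s) {δ C : ℝ}
    (hC : ∀ (i : Fin (3 + 1)) (n : ℕ) (a : ℝ), ∑ k ∈ Finset.range n, w i k ≤ a →
      a ≤ ∑ k ∈ Finset.range (n + 1), w i k → |n - a| ≤ δ * a + C)
    (i : Fin (3 + 1)) (n : ℕ) {u : ℝ} (hu : u ∈ Icc 0 (H n)) :
    |eventCount e i n - stepIntegral (fun k => rate i (J k)) H n u| ≤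
      δ * stepIntegral (fun k => rate i (J k)) H n u + C := by
  refine hC i _ _ ((h.clock_le i n).trans ?_) (le_trans ?_ (h.le_clock i n))
  · exact le_add_of_nonneg_right (mul_nonneg (hrate i _) hu.1)
  · rw [internalTime_succ]
    exact add_le_add le_rfl (mul_le_mul_of_nonneg_left hu.2 (hrate i _))

/-- The a priori bound on the states and on the number of jumps. -/
theorem IsClockPath.le_pathBound (h : IsClockPath (eventRate Λ β ε) (eventNext γ) w J H e)
    (hΛ : 0 ≤ Λ) (hβ : 0 ≤ β) (hε : 0 ≤ ε) (hγ : 0 < γ) {C T : ℝ} (hC0 : 0 ≤ C)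
    (hC : ∀ (i : Fin (3 + 1)) (n : ℕ) (a : ℝ), ∑ k ∈ Finset.range n, w i k ≤ a →
      a ≤ ∑ k ∈ Finset.range (n + 1), w i k → |n - a| ≤ 1 * a + C)
    {n : ℕ} (hn : ∑ k ∈ Finset.range n, H k ≤ T) :
    |((J n).1 : ℝ)| ≤ pathBound Λ ε γ C T (J 0) ∧ ((J n).2 : ℝ) ≤ pathBound Λ ε γ C T (J 0) ∧
      (n : ℝ) ≤ 4 * pathBound Λ ε γ C T (J 0) := by
  have hτ : ∀ m ≤ n, ∑ k ∈ Finset.range m, H k ≤ T := fun m hm =>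
    (Finset.sum_le_sum_of_subset_of_nonneg (Finset.range_subset_range.2 hm)
      fun k _ _ => h.hold_nonneg k).trans hn
  have hT : 0 ≤ T := by simpa using hτ 0 (Nat.zero_le _)
  set a : ℝ := |((J 0).1 : ℝ)| + (J 0).2 + (1 + γ) * (2 * Λ * T + C) + C with ha
  have ha0 : 0 ≤ a := by positivity
  -- The factor `2` is `1 + δ` with `δ = 1`.
  have hcount : ∀ i m, (eventCount e i m : ℝ) ≤ 2 * (∑ k ∈ Finset.range m,
      eventRate Λ β ε i (J k) * H k) + C := by
    intro i m
    have h1 := (abs_le.1 (h.abs_eventCount_sub_le (eventRate_nonneg hΛ hβ hε) hC i m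
      (u := 0) ⟨le_rfl, h.hold_nonneg m⟩)).2
    rw [stepIntegral_zero] at h1
    linarith
  have hmain : ∀ m ≤ n, |((J 0).1 : ℝ)| + (J 0).2 + (1 + γ) * eventCount e 0 m + eventCount e 3 m ≤
      a + 2 * ε * ∑ k ∈ Finset.range m, |((J k).1 : ℝ)| * H k := by
    intro m hm
    have h0 := hcount 0 m
    have h3 := hcount 3 m
    have e0 : ∑ k ∈ Finset.range m, eventRate Λ β ε 0 (J k) * H k ≤ Λ * T := by
      calc _ = Λ * ∑ k ∈ Finset.range m, H k := by rw [Finset.mul_sum]; rfl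
        _ ≤ _ := mul_le_mul_of_nonneg_left (hτ m hm) hΛ
    have e3 : ∑ k ∈ Finset.range m, eventRate Λ β ε 3 (J k) * H k ≤
        ε * ∑ k ∈ Finset.range m, |((J k).1 : ℝ)| * H k := by
      rw [Finset.mul_sum]
      refine Finset.sum_le_sum fun k _ => ?_
      rw [← mul_assoc]
      refine mul_le_mul_of_nonneg_right ?_ (h.hold_nonneg k)
      exact mul_le_mul_of_nonneg_left (max_le (neg_le_abs _) (abs_nonneg _)) hε
    have h4 : (1 + (γ : ℝ)) * eventCount e 0 m ≤ (1 + γ) * (2 * Λ * T + C) := by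
      gcongr; linarith
    rw [ha]
    linarith
  have hx : ∀ m, ((J m).2 : ℝ) + eventCount e 1 m + eventCount e 2 m ≤
      (J 0).2 + γ * eventCount e 0 m + eventCount e 3 m := fun m => by
    exact_mod_cast h.invitations_add_le hγ m
  -- `|Y|` is at most its initial value plus arrivals plus acceptances. Replacing the acceptances
  -- through `hx` leaves only arrivals and additions, and the latter occur at rate at most `ε |Y|`:
  -- this closes the Grönwall loop.
  have hy : ∀ m, |((J m).1 : ℝ)| ≤
      |((J 0).1 : ℝ)| + (J 0).2 + (1 + γ) * eventCount e 0 m + eventCount e 3 m := by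
    intro m
    rw [h.queue_eq m]
    have h1 := hx m
    have h2 : (0 : ℝ) ≤ eventCount e 0 m := Nat.cast_nonneg _
    have h3 : (0 : ℝ) ≤ eventCount e 1 m := Nat.cast_nonneg _
    have h4 : (0 : ℝ) ≤ eventCount e 2 m := Nat.cast_nonneg _
    have h5 : (0 : ℝ) ≤ (J m).2 := Nat.cast_nonneg _
    have h6 := abs_le.1 (le_refl |((J 0).1 : ℝ)|)
    have h7 : (0 : ℝ) ≤ γ * eventCount e 0 m := by positivity
    have h8 : (0 : ℝ) ≤ eventCount e 3 m := Nat.cast_nonneg _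
    have h9 : (0 : ℝ) ≤ (J 0).2 := Nat.cast_nonneg _
    rw [abs_le]; constructor <;> linarith [h6.1, h6.2]
  have hg := le_mul_exp_of_le_add_sum (v := fun k => |((J k).1 : ℝ)|) (c := 2 * ε) ha0
    (by positivity) (fun k => abs_nonneg _) h.hold_nonneg (N := n)
    (fun m hm => (hy m).trans (hmain m hm)) n le_rfl
  have hb : |((J 0).1 : ℝ)| + (J 0).2 + (1 + γ) * eventCount e 0 n + eventCount e 3 n ≤
      pathBound Λ ε γ C T (J 0) := by
    refine (hmain n le_rfl).trans (hg.trans ?_)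
    rw [pathBound, ← ha]
    have := mul_le_mul_of_nonneg_left hn (by positivity : 0 ≤ 2 * ε)
    gcongr
  have h1 := hx n
  have h2 : (0 : ℝ) ≤ eventCount e 0 n := Nat.cast_nonneg _
  have h3 : (0 : ℝ) ≤ eventCount e 1 n := Nat.cast_nonneg _
  have h4 : (0 : ℝ) ≤ eventCount e 2 n := Nat.cast_nonneg _
  have h5 : (0 : ℝ) ≤ (J n).2 := Nat.cast_nonneg _
  have h6 := abs_nonneg ((J 0).1 : ℝ)
  have h7 : (0 : ℝ) ≤ γ * eventCount e 0 n := by positivity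
  have h8 : (0 : ℝ) ≤ eventCount e 3 n := Nat.cast_nonneg _
  have h9 : (0 : ℝ) ≤ (J 0).2 := Nat.cast_nonneg _
  refine ⟨(hy n).trans hb, by linarith, ?_⟩
  have hs : (n : ℝ) = eventCount e 0 n + eventCount e 1 n + eventCount e 2 n + eventCount e 3 n := by
    conv_lhs => rw [← sum_eventCount e n]
    rw [Fin.sum_univ_four]
    push_cast
    rfl
  rw [hs]
  linarith

/-- If the jump times stayed below `T`, the a priori bound would bound every jump index by one
constant. -/
theorem IsClockPath.tendsto_jumpTimes (h : IsClockPath (eventRate Λ β ε) (eventNext γ) w J H e)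
    (hΛ : 0 ≤ Λ) (hβ : 0 ≤ β) (hε : 0 ≤ ε) (hγ : 0 < γ) {C : ℝ} (hC0 : 0 ≤ C)
    (hC : ∀ (i : Fin (3 + 1)) (n : ℕ) (a : ℝ), ∑ k ∈ Finset.range n, w i k ≤ a →
      a ≤ ∑ k ∈ Finset.range (n + 1), w i k → |n - a| ≤ 1 * a + C) :
    Tendsto (fun n => ∑ k ∈ Finset.range n, H k) atTop atTop := by
  refine tendsto_atTop_atTop_of_monotone (fun m n hmn => ?_) fun T => ?_
  · exact Finset.sum_le_sum_of_subset_of_nonneg (Finset.range_subset_range.2 hmn)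
      fun k _ _ => h.hold_nonneg k
  · by_contra! hcon
    obtain ⟨n, hn⟩ := exists_nat_gt (4 * pathBound Λ ε γ C T (J 0))
    exact absurd (h.le_pathBound hΛ hβ hε hγ hC0 hC (hcon n).le).2.2 (not_le.2 hn)

end Path

/-! ### The regulator and the approximate reflected equation -/

section Reflection

variable {Λ β ε : ℝ} {γ : ℕ} {w : Fin (3 + 1) → ℕ → ℝ} {J : ℕ → ℤ × ℕ} {H : ℕ → ℝ}
  {e : ℕ → Fin (3 + 1)}

theorem jumpIndex_mono {H : ℕ → ℝ} (hH : ∀ n, 0 ≤ H n)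
    (htop : Tendsto (fun n => ∑ k ∈ Finset.range n, H k) atTop atTop) {s t : ℝ} (hs : 0 ≤ s)
    (hst : s ≤ t) : jumpIndex H s ≤ jumpIndex H t := by
  by_contra! hlt
  have h1 := (jumpIndex_spec htop hs).1
  have h2 := (jumpIndex_spec htop (hs.trans hst)).2
  have h3 : ∑ k ∈ Finset.range (jumpIndex H t + 1), H k ≤ ∑ k ∈ Finset.range (jumpIndex H s), H k :=
    Finset.sum_le_sum_of_subset_of_nonneg (Finset.range_subset_range.2 hlt) fun k _ _ => hH k
  linarith

/-- The rate of the suppressed additional events. -/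
def idleRate (ε : ℝ) (s : ℤ × ℕ) : ℝ := if s.2 = 0 then ε * max (s.1 : ℝ) 0 else 0

theorem idleRate_nonneg (hε : 0 ≤ ε) (s : ℤ × ℕ) : 0 ≤ idleRate ε s := by
  unfold idleRate
  split_ifs
  exacts [mul_nonneg hε (le_max_right _ _), le_rfl]

theorem shortfall_term_nonneg (γ : ℕ) (J : ℕ → ℤ × ℕ) (e : ℕ → Fin (3 + 1)) (k : ℕ) :
    0 ≤ if e k = 1 then (γ : ℝ) - min γ (J k).2 else 0 := by
  split_ifs
  exacts [sub_nonneg.2 (Nat.cast_le.2 (min_le_left _ _)), le_rfl]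

/-- The regulator that keeps the number of pending invitations nonnegative, at the time `u` after
the `n`-th jump. -/
def regulator (ε : ℝ) (γ : ℕ) (J : ℕ → ℤ × ℕ) (H : ℕ → ℝ) (e : ℕ → Fin (3 + 1)) (n : ℕ) (u : ℝ) :
    ℝ := shortfall γ J e n + stepIntegral (fun k => idleRate ε (J k)) H n u

/-- The drift of the number of pending invitations, without regulation. -/
def invitationDrift (Λ β ε : ℝ) (γ : ℕ) (s : ℤ × ℕ) : ℝ := γ * Λ - γ * β * s.2 - ε * s.1

/-- Split `Y` into positive and negative parts; the idle rate restores the removals suppressed at `X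
= 0`, so that the drift becomes linear. -/
theorem invitationDrift_eq (Λ β ε : ℝ) (γ : ℕ) (s : ℤ × ℕ) :
    invitationDrift Λ β ε γ s = γ * eventRate Λ β ε 0 s - γ * eventRate Λ β ε 1 s -
      eventRate Λ β ε 2 s + eventRate Λ β ε 3 s - idleRate ε s := by
  have h : (s.1 : ℝ) = max (s.1 : ℝ) 0 - max (-(s.1 : ℝ)) 0 := by
    rcases le_total (s.1 : ℝ) 0 with h | h
    · rw [max_eq_right h, max_eq_left (by linarith)]; ring
    · rw [max_eq_left h, max_eq_right (by linarith)]; ring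
  have h2 : eventRate Λ β ε 2 s + idleRate ε s = ε * max (s.1 : ℝ) 0 := by
    change (if s.2 = 0 then 0 else ε * max (s.1 : ℝ) 0) + idleRate ε s = _
    unfold idleRate
    split_ifs <;> simp
  have h0 : eventRate Λ β ε 0 s = Λ := rfl
  have h1 : eventRate Λ β ε 1 s = β * s.2 := rfl
  have h3 : eventRate Λ β ε 3 s = ε * max (-(s.1 : ℝ)) 0 := rfl
  rw [h0, h1, h3, invitationDrift]
  linear_combination h2 - ε * h

/-- Replacing the four counts in the balance equation by their internal times costs `D` each, with
weights `γ, γ, 1, 1`. -/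
theorem abs_invitations_sub_le (h : IsClockPath (eventRate Λ β ε) (eventNext γ) w J H e)
    {n : ℕ} {u D : ℝ}
    (hD : ∀ i, |eventCount e i n - stepIntegral (fun k => eventRate Λ β ε i (J k)) H n u| ≤ D) :
    |((J n).2 : ℝ) - ((J 0).2 + stepIntegral (fun k => invitationDrift Λ β ε γ (J k)) H n u) -
      regulator ε γ J H e n u| ≤ (2 * γ + 2) * D := by
  have h1 : stepIntegral (fun k => invitationDrift Λ β ε γ (J k)) H n u =
      γ * stepIntegral (fun k => eventRate Λ β ε 0 (J k)) H n u -
      γ * stepIntegral (fun k => eventRate Λ β ε 1 (J k)) H n u -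
      stepIntegral (fun k => eventRate Λ β ε 2 (J k)) H n u +
      stepIntegral (fun k => eventRate Λ β ε 3 (J k)) H n u -
      stepIntegral (fun k => idleRate ε (J k)) H n u := by
    simp only [stepIntegral, invitationDrift_eq, sub_mul, add_mul, Finset.sum_sub_distrib,
      Finset.sum_add_distrib, mul_add, Finset.mul_sum, mul_assoc]
    ring
  rw [h1, h.invitations_eq n, regulator]
  have d0 := abs_le.1 (hD 0)
  have d1 := abs_le.1 (hD 1)
  have d2 := abs_le.1 (hD 2)
  have d3 := abs_le.1 (hD 3)
  have hγ : (0 : ℝ) ≤ γ := Nat.cast_nonneg _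
  have e0 := mul_le_mul_of_nonneg_left d0.1 hγ
  have e0' := mul_le_mul_of_nonneg_left d0.2 hγ
  have e1 := mul_le_mul_of_nonneg_left d1.1 hγ
  have e1' := mul_le_mul_of_nonneg_left d1.2 hγ
  rw [abs_le]; constructor <;> linarith [d2.1, d2.2, d3.1, d3.2]

/-- Up to a bounded error, the regulator does not exceed the running maximum of the negative part
of the unregulated process `F`. -/
theorem regulator_le (h : IsClockPath (eventRate Λ β ε) (eventNext γ) w J H e) (hγ : 0 < γ)
    {T D : ℝ} (hD0 : 0 ≤ D) {F : ℝ → ℝ}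
    (hF : ∀ n u, u ∈ Icc 0 (H n) → ∑ k ∈ Finset.range n, H k + u ≤ T →
      |((J n).2 : ℝ) - F (∑ k ∈ Finset.range n, H k + u) - regulator ε γ J H e n u| ≤ D)
    {n : ℕ} {u : ℝ} (hu : u ∈ Icc 0 (H n)) (hT : ∑ k ∈ Finset.range n, H k + u ≤ T) :
    ∃ s ∈ Icc 0 (∑ k ∈ Finset.range n, H k + u),
      regulator ε γ J H e n u ≤ max 0 (-F s) + γ + D := by
  have hτ : ∀ n, 0 ≤ ∑ k ∈ Finset.range n, H k := fun n =>
    Finset.sum_nonneg fun k _ => h.hold_nonneg k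
  have hstart : ∀ n, ∑ k ∈ Finset.range n, H k ≤ T → ∃ s ∈ Icc 0 (∑ k ∈ Finset.range n, H k),
      regulator ε γ J H e n 0 ≤ max 0 (-F s) + γ + D := by
    intro n
    induction n with
    | zero =>
      intro _
      refine ⟨0, by simp, ?_⟩
      have : regulator ε γ J H e 0 0 = 0 := by simp [regulator, shortfall, stepIntegral]
      rw [this]
      have := le_max_left 0 (-F 0)
      positivity
    | succ n ih =>
      intro hn
      -- With few invitations left, the regulator is within `γ + D` of `-F` at this very time.
      -- Otherwise it did not grow in the last step, and the old witness remains valid.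
      by_cases hx : (J (n + 1)).2 ≤ γ
      · refine ⟨_, ⟨hτ _, le_rfl⟩, ?_⟩
        have h1 := (abs_le.1 (hF (n + 1) 0 ⟨le_rfl, h.hold_nonneg _⟩ (by simpa using hn))).1
        rw [add_zero] at h1
        have h2 : ((J (n + 1)).2 : ℝ) ≤ γ := by exact_mod_cast hx
        have h3 := le_max_right 0 (-F (∑ k ∈ Finset.range (n + 1), H k))
        linarith
      · push Not at hx
        have hle : ∑ k ∈ Finset.range n, H k ≤ ∑ k ∈ Finset.range (n + 1), H k := by
          rw [Finset.sum_range_succ]; linarith [h.hold_nonneg n]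
        obtain ⟨s, hs, h1⟩ := ih (hle.trans hn)
        refine ⟨s, ⟨hs.1, hs.2.trans hle⟩, ?_⟩
        -- One event adds at most `γ`, so a state above `γ` cannot follow `X = 0`; and a short
        -- acceptance would have ended at `X = 0`.
        have hpos : (J n).2 ≠ 0 ∧ (e n = 1 → γ ≤ (J n).2) := by
          rw [h.state_succ] at hx
          rcases event_cases γ (h.rate_pos n) with
            ⟨hj, hn⟩ | ⟨hj, h0, hn⟩ | ⟨hj, h0, hn⟩ | ⟨hj, hn⟩ <;> rw [hn] at hx <;>
            simp only at hx <;> refine ⟨by omega, fun hj' => ?_⟩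
          · rw [hj] at hj'; exact absurd hj' (by decide)
          · omega
          · rw [hj] at hj'; exact absurd hj' (by decide)
          · rw [hj] at hj'; exact absurd hj' (by decide)
        have h2 : regulator ε γ J H e (n + 1) 0 = regulator ε γ J H e n 0 := by
          rw [regulator, regulator, ← stepIntegral_self, shortfall, Finset.sum_range_succ,
            ← shortfall]
          have e1 : (if e n = 1 then (γ : ℝ) - min γ (J n).2 else 0) = 0 := by
            split_ifs with h3
            · rw [min_eq_left (by exact_mod_cast hpos.2 h3), sub_self]
            · rfl
          rw [e1]
          simp [stepIntegral, idleRate, hpos.1]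
        rw [h2]; exact h1
  by_cases hx : (J n).2 = 0
  · refine ⟨_, ⟨add_nonneg (hτ n) hu.1, le_rfl⟩, ?_⟩
    have h1 := (abs_le.1 (hF n u hu hT)).1
    rw [hx] at h1
    have h3 := le_max_right 0 (-F (∑ k ∈ Finset.range n, H k + u))
    have h4 : (0 : ℝ) ≤ γ := Nat.cast_nonneg _
    push_cast at h1
    linarith
  · obtain ⟨s, hs, h1⟩ := hstart n (by linarith [hu.1])
    refine ⟨s, ⟨hs.1, hs.2.trans (by linarith [hu.1])⟩, ?_⟩
    have h2 : regulator ε γ J H e n u = regulator ε γ J H e n 0 := by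
      simp [regulator, stepIntegral, idleRate, hx]
    rw [h2]; exact h1

theorem regulator_mono (h : IsClockPath (eventRate Λ β ε) (eventNext γ) w J H e) (hε : 0 ≤ ε)
    {m n : ℕ} (hmn : m ≤ n) {u v : ℝ} (hu : u ∈ Icc 0 (H m)) (hv : v ∈ Icc 0 (H n))
    (hle : ∑ k ∈ Finset.range m, H k + u ≤ ∑ k ∈ Finset.range n, H k + v) :
    regulator ε γ J H e m u ≤ regulator ε γ J H e n v := by
  refine add_le_add ?_ ?_
  · exact Finset.sum_le_sum_of_subset_of_nonneg (Finset.range_subset_range.2 hmn)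
      fun k _ _ => shortfall_term_nonneg γ J e k
  · have h1 := intervalIntegral_jumpIndex h.hold_nonneg (fun k => idleRate ε (J k)) m hu
    have h2 := intervalIntegral_jumpIndex h.hold_nonneg (fun k => idleRate ε (J k)) n hv
    rw [← h1.2, ← h2.2]
    refine intervalIntegral.integral_mono_interval le_rfl ?_ hle
      (ae_of_all _ fun s => idleRate_nonneg hε _) h2.1
    exact add_nonneg (Finset.sum_nonneg fun k _ => h.hold_nonneg k) hu.1

theorem regulator_nonneg (h : IsClockPath (eventRate Λ β ε) (eventNext γ) w J H e) (hε : 0 ≤ ε)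
    {n : ℕ} {u : ℝ} (hu : u ∈ Icc 0 (H n)) : 0 ≤ regulator ε γ J H e n u :=
  add_nonneg (Finset.sum_nonneg fun k _ => shortfall_term_nonneg γ J e k)
    (add_nonneg (Finset.sum_nonneg fun k _ => mul_nonneg (idleRate_nonneg hε _) (h.hold_nonneg k))
      (mul_nonneg (idleRate_nonneg hε _) hu.1))

/-- The scaled path is an approximate solution of the reflected fluid equation. -/
theorem IsClockPath.nearFluid {lam r : ℝ} (hr : 0 < r)
    (h : IsClockPath (eventRate (lam * r) β ε) (eventNext γ) w J H e) (hε : 0 ≤ ε) (hγ : 0 < γ)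
    (htop : Tendsto (fun n => ∑ k ∈ Finset.range n, H k) atTop atTop) {T D : ℝ} (hT : 0 ≤ T)
    (hD0 : 0 ≤ D)
    (hD : ∀ i n u, u ∈ Icc 0 (H n) → ∑ k ∈ Finset.range n, H k + u ≤ T →
      |eventCount e i n - stepIntegral (fun k => eventRate (lam * r) β ε i (J k)) H n u| ≤ D)
    (y₀ w₀ : ℝ) :
    NearFluid lam β γ ε y₀ w₀ T (|r⁻¹ * (J 0).1 - y₀| + 2 * |r⁻¹ * (J 0).2 - w₀| +
        r⁻¹ * (2 * ((2 * γ + 2) * D) + γ))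
      (fun t => r⁻¹ * (J (jumpIndex H t)).1) (fun t => r⁻¹ * (J (jumpIndex H t)).2) := by
  set ρ := r⁻¹ with hρdef
  have hρ : 0 < ρ := inv_pos.2 hr
  have hρr : ρ * r = 1 := inv_mul_cancel₀ hr.ne'
  set Y : ℝ → ℝ := fun t => ρ * (J (jumpIndex H t)).1 with hY
  set X : ℝ → ℝ := fun t => ρ * (J (jumpIndex H t)).2 with hX
  set E := (2 * (γ : ℝ) + 2) * D with hE
  have hE0 : 0 ≤ E := by positivity
  have hDE : 2 * D ≤ E := by
    have : 0 ≤ (γ : ℝ) * D := by positivity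
    rw [hE]; linarith
  have spec : ∀ t, 0 ≤ t → ∃ n u, n = jumpIndex H t ∧ u ∈ Icc 0 (H n) ∧
      t = ∑ k ∈ Finset.range n, H k + u := by
    intro t ht
    obtain ⟨h1, h2⟩ := jumpIndex_spec htop ht
    rw [Finset.sum_range_succ] at h2
    exact ⟨_, t - ∑ k ∈ Finset.range (jumpIndex H t), H k, rfl, ⟨by linarith, by linarith⟩, by ring⟩
  have hint := fun (f : ℕ → ℝ) (t : ℝ) (ht : 0 ≤ t) =>
    show IntervalIntegrable (fun s => f (jumpIndex H s)) volume 0 t by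
      obtain ⟨n, u, -, hu, rfl⟩ := spec t ht
      exact (intervalIntegral_jumpIndex h.hold_nonneg f n hu).1
  have hval := fun (f : ℕ → ℝ) (n : ℕ) (u : ℝ) (hu : u ∈ Icc 0 (H n)) =>
    (intervalIntegral_jumpIndex h.hold_nonneg f n hu).2
  have hscale : ∀ (f : ℕ → ℝ) n u, stepIntegral (fun k => ρ * f k) H n u =
      ρ * stepIntegral f H n u := by
    intro f n u
    simp only [stepIntegral, mul_add, Finset.mul_sum, mul_assoc]
  set F : ℝ → ℝ := fun t => (J 0).2 +
    ∫ s in (0)..t, invitationDrift (lam * r) β ε γ (J (jumpIndex H s)) with hF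
  have hfree : ∀ t, 0 ≤ t → freeInvitations lam β γ ε w₀ Y X t = w₀ + ρ * (F t - (J 0).2) := by
    intro t ht
    obtain ⟨n, u, -, hu, rfl⟩ := spec t ht
    have e1 : ∀ s, (γ : ℝ) * lam - γ * β * X s - ε * Y s =
        (fun k => ρ * invitationDrift (lam * r) β ε γ (J k)) (jumpIndex H s) := by
      intro s
      simp only [hX, hY, invitationDrift]
      linear_combination (-(γ : ℝ) * lam) * hρr
    simp only [freeInvitations, e1, hF]
    rw [hval (fun k => ρ * invitationDrift (lam * r) β ε γ (J k)) n u hu,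
      hval (fun k => invitationDrift (lam * r) β ε γ (J k)) n u hu, hscale]
    ring
  have hFM : ∀ n u, u ∈ Icc 0 (H n) → ∑ k ∈ Finset.range n, H k + u ≤ T →
      |((J n).2 : ℝ) - F (∑ k ∈ Finset.range n, H k + u) - regulator ε γ J H e n u| ≤ E := by
    intro n u hu hT
    have := abs_invitations_sub_le h (fun i => hD i n u hu hT)
    rw [hF]
    simp only
    rw [hval (fun k => invitationDrift (lam * r) β ε γ (J k)) n u hu]
    exact this
  have hγ0 : (0 : ℝ) ≤ γ := Nat.cast_nonneg _
  have hργ : 0 ≤ ρ * γ := by positivity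
  have hρE : 0 ≤ ρ * E := by positivity
  have ha := abs_le.1 (le_refl |ρ * ((J 0).2 : ℝ) - w₀|)
  have ha0 := abs_nonneg (ρ * ((J 0).1 : ℝ) - y₀)
  refine ⟨hint (fun k => ρ * (J k).1) T hT, hint (fun k => ρ * (J k).2) T hT, fun t ht => ?_,
    fun t ht s hs => ?_, fun t ht => ?_⟩
  · obtain ⟨n, u, hn, hu, htu⟩ := spec t ht.1
    have h0 := abs_le.1 (hD 0 n u hu (htu ▸ ht.2))
    have h1 := abs_le.1 (hD 1 n u hu (htu ▸ ht.2))
    have e1 : ∀ s, β * X s - lam = (fun k => ρ * (eventRate (lam * r) β ε 1 (J k) -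
        eventRate (lam * r) β ε 0 (J k))) (jumpIndex H s) := by
      intro s
      change β * (ρ * (J (jumpIndex H s)).2) - lam = ρ * (β * (J (jumpIndex H s)).2 - lam * r)
      linear_combination lam * hρr
    have e2 : stepIntegral (fun k => eventRate (lam * r) β ε 1 (J k) -
        eventRate (lam * r) β ε 0 (J k)) H n u =
        stepIntegral (fun k => eventRate (lam * r) β ε 1 (J k)) H n u -
        stepIntegral (fun k => eventRate (lam * r) β ε 0 (J k)) H n u := by
      simp only [stepIntegral, sub_mul, Finset.sum_sub_distrib]; ring
    have e3 : Y t = ρ * (J n).1 := by rw [hY, hn]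
    simp only [e1, e3]
    rw [htu, hval (fun k => ρ * (eventRate (lam * r) β ε 1 (J k) -
      eventRate (lam * r) β ε 0 (J k))) n u hu, hscale, e2, h.queue_eq n]
    have b0 := abs_le.1 (le_refl |ρ * ((J 0).1 : ℝ) - y₀|)
    have c1 := mul_le_mul_of_nonneg_left h0.1 hρ.le
    have c2 := mul_le_mul_of_nonneg_left h0.2 hρ.le
    have c3 := mul_le_mul_of_nonneg_left h1.1 hρ.le
    have c4 := mul_le_mul_of_nonneg_left h1.2 hρ.le
    have c5 := mul_le_mul_of_nonneg_left hDE hρ.le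
    have c6 := abs_nonneg (ρ * ((J 0).2 : ℝ) - w₀)
    rw [abs_le]; constructor <;> linarith [b0.1, b0.2]
  -- Lower bound: since `X ≥ 0`, `-F s` is at most the regulator at `s` plus `E`, hence at most the
  -- later regulator at `t` plus `E`.
  · obtain ⟨n, u, hn, hu, htu⟩ := spec t ht.1
    obtain ⟨m, v, hm, hv, hsv⟩ := spec s hs.1
    have hmn : m ≤ n := by rw [hm, hn]; exact jumpIndex_mono h.hold_nonneg htop hs.1 hs.2
    have hL := regulator_mono (γ := γ) h hε hmn hv hu (by rw [← hsv, ← htu]; exact hs.2)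
    have hL0 := mul_nonneg hρ.le (regulator_nonneg (γ := γ) h hε hu)
    have h1 := abs_le.1 (hFM n u hu (htu ▸ ht.2))
    have h2 := abs_le.1 (hFM m v hv (hsv ▸ hs.2.trans ht.2))
    rw [← htu] at h1
    rw [← hsv] at h2
    have e3 : X t = ρ * (J n).2 := by rw [hX, hn]
    rw [hfree t ht.1, hfree s hs.1, e3]
    have h3 : (0 : ℝ) ≤ (J m).2 := Nat.cast_nonneg _
    have c1 := mul_le_mul_of_nonneg_left h1.1 hρ.le
    have c2 := mul_le_mul_of_nonneg_left (show -F s ≤ regulator ε γ J H e n u + E by linarith) hρ.le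
    refine sub_le_iff_le_add.2 (max_le ?_ ?_)
    · linarith [ha.1, ha.2]
    · linarith [ha.1, ha.2]
  · obtain ⟨n, u, hn, hu, htu⟩ := spec t ht.1
    obtain ⟨s, hs, h1⟩ := regulator_le h hγ hE0 hFM hu (htu ▸ ht.2)
    rw [← htu] at hs
    refine ⟨s, hs, ?_⟩
    have h2 := abs_le.1 (hFM n u hu (htu ▸ ht.2))
    rw [← htu] at h2
    have e3 : X t = ρ * (J n).2 := by rw [hX, hn]
    rw [hfree t ht.1, hfree s hs.1, e3]
    have c1 := mul_le_mul_of_nonneg_left h2.2 hρ.le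
    have c2 := mul_le_mul_of_nonneg_left h1 hρ.le
    -- The initial discrepancy of the invitations enters here at time `s` and again through the free
    -- process at `t`, whence its factor `2` in the total error.
    have c3 : ρ * max 0 (-F s) ≤ max 0 (-(w₀ + ρ * (F s - (J 0).2))) + |ρ * ((J 0).2 : ℝ) - w₀| := by
      rw [mul_max_of_nonneg _ _ hρ.le, mul_zero]
      refine max_le ?_ ?_
      · have := le_max_left 0 (-(w₀ + ρ * (F s - (J 0).2)))
        have := abs_nonneg (ρ * ((J 0).2 : ℝ) - w₀)
        positivity
      · have := le_max_right 0 (-(w₀ + ρ * (F s - (J 0).2)))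
        linarith [ha.1, ha.2]
    linarith [ha.1, ha.2]

end Reflection

/-! ### Convergence of the scaled paths -/

theorem NearFluid.mono {lam β g ε y₀ w₀ T η η' : ℝ} {y w : ℝ → ℝ}
    (h : NearFluid lam β g ε y₀ w₀ T η y w) (hη : η ≤ η') :
    NearFluid lam β g ε y₀ w₀ T η' y w := by
  refine ⟨h.integrable_y, h.integrable_w, fun t ht => (h.near_y t ht).trans hη,
    fun t ht s hs => (sub_le_sub_left hη _).trans (h.lower t ht s hs), fun t ht => ?_⟩
  obtain ⟨s, hs, h1⟩ := h.upper t ht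
  exact ⟨s, hs, h1.trans (add_le_add_right hη _)⟩

section Convergence

variable {Λ β ε : ℝ} {γ : ℕ} {w : Fin (3 + 1) → ℕ → ℝ} {J : ℕ → ℤ × ℕ} {H : ℕ → ℝ}
  {e : ℕ → Fin (3 + 1)}

/-- A bound on all event rates up to time `T`. -/
def rateBound (Λ β ε : ℝ) (γ : ℕ) (C T : ℝ) (s : ℤ × ℕ) : ℝ :=
  Λ + (β + ε) * pathBound Λ ε γ C T s

/-- Bounds the internal times up to `T`, and with them the renewal error, in terms of the initial
state alone. -/
theorem IsClockPath.stepIntegral_rate_le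
    (h : IsClockPath (eventRate Λ β ε) (eventNext γ) w J H e)
    (hΛ : 0 ≤ Λ) (hβ : 0 ≤ β) (hε : 0 ≤ ε) (hγ : 0 < γ) {C T : ℝ} (hC0 : 0 ≤ C)
    (hC : ∀ (i : Fin (3 + 1)) (n : ℕ) (a : ℝ), ∑ k ∈ Finset.range n, w i k ≤ a →
      a ≤ ∑ k ∈ Finset.range (n + 1), w i k → |n - a| ≤ 1 * a + C)
    (i : Fin (3 + 1)) {n : ℕ} {u : ℝ} (hu : u ∈ Icc 0 (H n))
    (hT : ∑ k ∈ Finset.range n, H k + u ≤ T) :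
    stepIntegral (fun k => eventRate Λ β ε i (J k)) H n u ≤ rateBound Λ β ε γ C T (J 0) * T := by
  set B := pathBound Λ ε γ C T (J 0) with hB
  have hT0 : 0 ≤ T := le_trans (add_nonneg (Finset.sum_nonneg fun k _ => h.hold_nonneg k) hu.1) hT
  have hB0 : 0 ≤ B := pathBound_nonneg hΛ hC0 hT0 _
  have hQ0 : 0 ≤ rateBound Λ β ε γ C T (J 0) := by unfold rateBound; positivity
  have hrate : ∀ k ≤ n, eventRate Λ β ε i (J k) ≤ rateBound Λ β ε γ C T (J 0) := by
    intro k hk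
    have hk' : ∑ k ∈ Finset.range k, H k ≤ T :=
      (Finset.sum_le_sum_of_subset_of_nonneg (Finset.range_subset_range.2 hk)
        fun k _ _ => h.hold_nonneg k).trans (by linarith [hu.1])
    obtain ⟨h1, h2, -⟩ := h.le_pathBound hΛ hβ hε hγ hC0 hC hk'
    have e1 : β * ((J k).2 : ℝ) ≤ β * B := mul_le_mul_of_nonneg_left h2 hβ
    have e2 : ε * max ((J k).1 : ℝ) 0 ≤ ε * B :=
      mul_le_mul_of_nonneg_left (max_le ((le_abs_self _).trans h1) hB0) hε
    have e3 : ε * max (-((J k).1 : ℝ)) 0 ≤ ε * B :=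
      mul_le_mul_of_nonneg_left (max_le ((neg_le_abs _).trans h1) hB0) hε
    have e4 : 0 ≤ β * B := by positivity
    have e5 : 0 ≤ ε * B := by positivity
    rw [rateBound, ← hB, add_mul]
    fin_cases i
    · change Λ ≤ _; linarith
    · change β * ((J k).2 : ℝ) ≤ _; linarith
    · change (if (J k).2 = 0 then 0 else ε * max ((J k).1 : ℝ) 0) ≤ _
      split_ifs <;> linarith
    · change ε * max (-((J k).1 : ℝ)) 0 ≤ _; linarith
  calc stepIntegral (fun k => eventRate Λ β ε i (J k)) H n u
      ≤ ∑ k ∈ Finset.range n, rateBound Λ β ε γ C T (J 0) * H k +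
          rateBound Λ β ε γ C T (J 0) * u := by
        refine add_le_add (Finset.sum_le_sum fun k hk => ?_) ?_
        · exact mul_le_mul_of_nonneg_right (hrate k (Finset.mem_range.1 hk).le) (h.hold_nonneg k)
        · exact mul_le_mul_of_nonneg_right (hrate n le_rfl) hu.1
    _ = rateBound Λ β ε γ C T (J 0) * (∑ k ∈ Finset.range n, H k + u) := by
        rw [← Finset.mul_sum]; ring
    _ ≤ _ := mul_le_mul_of_nonneg_left hT hQ0

/-- The path of the invitation scheme driven by the clocks `w`. -/
def invitationPath (Λ β ε : ℝ) (γ : ℕ) (s₀ : ℤ × ℕ) (w : Fin (3 + 1) → ℕ → ℝ) (t : ℝ) : ℤ × ℕ :=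
  clockChain (eventRate Λ β ε) (eventNext γ) s₀
    (jumpIndex (fun n => clockHolding (eventRate Λ β ε) (eventNext γ) s₀ n w) t) w

theorem RegularClocks.tendsto_jumpTimes (hw : RegularClocks w) (hΛ : 0 < Λ) (hβ : 0 ≤ β)
    (hε : 0 ≤ ε) (hγ : 0 < γ) (s₀ : ℤ × ℕ) :
    Tendsto (fun n => ∑ k ∈ Finset.range n,
      clockHolding (eventRate Λ β ε) (eventNext γ) s₀ k w) atTop atTop := by
  obtain ⟨C, hC0, hC⟩ := hw.exists_bound
  exact (isClockPath_clockChain _ (eventNext γ) (eventRate_nonneg hΛ.le hβ hε)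
    (sum_eventRate_pos hΛ hβ hε) s₀ hw.1).tendsto_jumpTimes hΛ.le hβ hε hγ (hC0 1) (hC 1 one_pos)

/-- For fixed clocks the unscaled error is `δ` times a quantity of order `r`, plus a constant.
Dividing by `r` leaves a multiple of `δ` in the limit, and `δ` is arbitrary. -/
theorem eventually_nearFluid {ι : Type*} {l : Filter ι} {lam : ℝ} (hlam : 0 < lam) (hβ : 0 < β)
    (hε : 0 < ε) (hγ : 0 < γ) (hw : RegularClocks w) {r : ι → ℝ} (hr : ∀ i, 0 < r i)
    (hr_lim : Tendsto r l atTop) {s₀ : ι → ℤ × ℕ} {y₀ w₀ : ℝ}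
    (hy₀ : Tendsto (fun i => (r i)⁻¹ * ((s₀ i).1 : ℝ)) l (𝓝 y₀))
    (hw₀ : Tendsto (fun i => (r i)⁻¹ * ((s₀ i).2 : ℝ)) l (𝓝 w₀)) {T η : ℝ} (hT : 0 ≤ T)
    (hη : 0 < η) :
    ∀ᶠ i in l, NearFluid lam β γ ε y₀ w₀ T η
      (fun t => (r i)⁻¹ * (invitationPath (lam * r i) β ε γ (s₀ i) w t).1)
      (fun t => (r i)⁻¹ * (invitationPath (lam * r i) β ε γ (s₀ i) w t).2) := by
  obtain ⟨C, hC0, hC⟩ := hw.exists_bound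
  -- `δ * K` is the limit of the error bound of `IsClockPath.nearFluid`: the scaled rate bound with
  -- all terms of order `1 / r` removed.
  set K := 2 * ((2 * (γ : ℝ) + 2) * ((lam + (β + ε) *
    ((|y₀| + w₀ + (1 + γ) * (2 * lam * T)) * Real.exp (2 * ε * T))) * T)) with hK
  obtain ⟨δ, hδ, hδK⟩ : ∃ δ : ℝ, 0 < δ ∧ δ * K < η := by
    refine ⟨η / (|K| + 1), by positivity, ?_⟩
    have h1 : K < |K| + 1 := by linarith [le_abs_self K]
    calc η / (|K| + 1) * K < η / (|K| + 1) * (|K| + 1) := by gcongr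
      _ = η := by field_simp
  have hΛ : ∀ i, 0 < lam * r i := fun i => mul_pos hlam (hr i)
  set D : ι → ℝ := fun i => δ * (rateBound (lam * r i) β ε γ (C 1) T (s₀ i) * T) + C δ with hD
  have hinv : Tendsto (fun i => (r i)⁻¹) l (𝓝 0) := tendsto_inv_atTop_zero.comp hr_lim
  have herr : Tendsto (fun i => |(r i)⁻¹ * (s₀ i).1 - y₀| + 2 * |(r i)⁻¹ * (s₀ i).2 - w₀| +
      (r i)⁻¹ * (2 * ((2 * γ + 2) * D i) + γ)) l (𝓝 (δ * K)) := by
    have e : ∀ i, (r i)⁻¹ * (2 * ((2 * γ + 2) * D i) + γ) =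
        2 * ((2 * γ + 2) * (δ * ((lam + (β + ε) * ((|(r i)⁻¹ * (s₀ i).1| + (r i)⁻¹ * (s₀ i).2 +
          (1 + γ) * (2 * lam * T + (r i)⁻¹ * C 1) + (r i)⁻¹ * C 1) * Real.exp (2 * ε * T))) * T) +
          (r i)⁻¹ * C δ)) + (r i)⁻¹ * γ := by
      intro i
      have h1 : (r i)⁻¹ * r i = 1 := inv_mul_cancel₀ (hr i).ne'
      rw [abs_mul, abs_of_pos (inv_pos.2 (hr i))]
      simp only [hD, rateBound, pathBound]
      linear_combination (2 * ((2 * γ + 2) * (δ * ((lam + (β + ε) * (((1 + γ) * (2 * lam * T)) *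
        Real.exp (2 * ε * T))) * T)))) * h1
    simp only [e]
    have h1 := (hy₀.sub_const y₀).abs
    have h2 := ((hw₀.sub_const w₀).abs).const_mul 2
    have h3 := ((((((((hy₀.abs.add hw₀).add (((hinv.mul_const (C 1)).const_add
      (2 * lam * T)).const_mul (1 + (γ : ℝ)))).add (hinv.mul_const (C 1))).mul_const
      (Real.exp (2 * ε * T))).const_mul (β + ε)).const_add lam).mul_const T).const_mul δ)
    have h4 := ((((h3.add (hinv.mul_const (C δ))).const_mul (2 * (γ : ℝ) + 2)).const_mul 2).add
      (hinv.mul_const (γ : ℝ)))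
    have h5 := (h1.add h2).add h4
    convert h5 using 2
    rw [hK]
    simp only [sub_self, abs_zero, mul_zero, zero_mul, add_zero, zero_add]
    ring
  filter_upwards [herr.eventually (gt_mem_nhds hδK)] with i hi
  have hpath := isClockPath_clockChain _ (eventNext γ) (eventRate_nonneg (hΛ i).le hβ.le hε.le)
    (sum_eventRate_pos (hΛ i) hβ.le hε.le) (s₀ i) hw.1
  have hQ0 : 0 ≤ rateBound (lam * r i) β ε γ (C 1) T (s₀ i) := by
    have := (hΛ i).le
    have := pathBound_nonneg (γ := γ) (ε := ε) (hΛ i).le (hC0 1) hT (s₀ i)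
    unfold rateBound; positivity
  have hD0 : 0 ≤ D i := by
    have := hC0 δ
    simp only [hD]; positivity
  refine (hpath.nearFluid (hr i) hε.le hγ
    (hw.tendsto_jumpTimes (hΛ i) hβ.le hε.le hγ (s₀ i)) hT hD0 ?_ y₀ w₀).mono hi.le
  intro j n u hu hT'
  refine (hpath.abs_eventCount_sub_le (eventRate_nonneg (hΛ i).le hβ.le hε.le) (hC δ hδ) j n
    hu).trans ?_
  have := hpath.stepIntegral_rate_le (hΛ i).le hβ.le hε.le hγ (hC0 1) (hC 1 one_pos) j hu hT'
  have := mul_le_mul_of_nonneg_left this hδ.le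
  simp only [hD]
  exact add_le_add this le_rfl

theorem tendsto_inv_mul_int_floor (a : ℝ) :
    Tendsto (fun n : ℕ => ((n : ℝ) + 1)⁻¹ * (⌊((n : ℝ) + 1) * a⌋ : ℝ)) atTop (𝓝 a) := by
  have h0 : Tendsto (fun n : ℕ => a - ((n : ℝ) + 1)⁻¹) atTop (𝓝 a) := by
    simpa using (tendsto_one_div_add_atTop_nhds_zero_nat (𝕜 := ℝ)).const_sub a
  refine tendsto_of_tendsto_of_tendsto_of_le_of_le h0 tendsto_const_nhds (fun n => ?_) fun n => ?_
  · have hn : (0 : ℝ) < n + 1 := by positivity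
    have h1 := (Int.sub_one_lt_floor (((n : ℝ) + 1) * a)).le
    have h2 := mul_le_mul_of_nonneg_left h1 (inv_pos.2 hn).le
    rwa [mul_sub, mul_one, inv_mul_cancel_left₀ hn.ne'] at h2
  · have hn : (0 : ℝ) < n + 1 := by positivity
    have h2 := mul_le_mul_of_nonneg_left (Int.floor_le (((n : ℝ) + 1) * a)) (inv_pos.2 hn).le
    rwa [inv_mul_cancel_left₀ hn.ne'] at h2

/-- Existence of the solution of the reflected fluid equation. -/
theorem exists_nearFluid {lam : ℝ} (hlam : 0 < lam) (hβ : 0 < β) (hε : 0 < ε) (hγ : 0 < γ)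
    (y₀ : ℝ) {w₀ : ℝ} (hw₀ : 0 ≤ w₀) :
    ∃ y w : ℝ → ℝ, ∀ T, 0 ≤ T → NearFluid lam β γ ε y₀ w₀ T 0 y w := by
  -- A single realization obeying the strong law suffices: the chains with `r = n + 1` and rounded
  -- initial states are approximate solutions with vanishing error.
  obtain ⟨v, hv⟩ := (ae_regularClocks 3).exists
  have hr : ∀ n : ℕ, (0 : ℝ) < n + 1 := fun n => by positivity
  have h2 : Tendsto (fun n : ℕ => ((n : ℝ) + 1)⁻¹ * ((⌊((n : ℝ) + 1) * w₀⌋.toNat : ℕ) : ℝ)) atTop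
      (𝓝 w₀) := by
    refine (tendsto_inv_mul_int_floor w₀).congr fun n => ?_
    have : 0 ≤ ⌊((n : ℝ) + 1) * w₀⌋ := Int.floor_nonneg.2 (mul_nonneg (hr n).le hw₀)
    congr 1
    exact_mod_cast (Int.toNat_of_nonneg this).symm
  exact exists_nearFluid_zero hβ.le (Nat.cast_nonneg _) hε.le fun T η hT hη =>
    eventually_nearFluid (s₀ := fun n : ℕ => (⌊((n : ℝ) + 1) * y₀⌋, ⌊((n : ℝ) + 1) * w₀⌋.toNat))
      hlam hβ hε hγ hv hr (tendsto_atTop_add_const_right _ _ tendsto_natCast_atTop_atTop)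
      (tendsto_inv_mul_int_floor y₀) h2 hT hη

end Convergence

end

/-! ### The fluid limit -/

theorem theorem1 {ι : Type*} (l : Filter ι) (lam β ε : ℝ) (γ : ℕ)
    (hlam : 0 < lam) (hβ : 0 < β) (hγ : 0 < γ) (hε : 0 < ε) (hεγ : ε < (γ : ℝ) ^ 2 * β / 4)
    -- the scaling parameters and the deterministic initial states of the systems
    (r : ι → ℝ) (hr : ∀ i, 0 < r i) (hr_lim : Tendsto r l atTop)
    (s₀ : ι → ℤ × ℕ) (y₀ x₀ : ℝ) (hx₀ : -(lam / β) ≤ x₀)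
    (hs₀ : Tendsto (fun i => fluidScale lam β (r i) (s₀ i)) l (𝓝 (y₀, x₀))) :
    ∃ y x : ℝ → ℝ,
      -- the fluid trajectory started from the limit of the initial states, and its uniqueness
      IsFluidTrajectory lam β γ ε y x ∧ y 0 = y₀ ∧ x 0 = x₀ ∧
      (∀ᵐ t ∂(volume.restrict (Ici (0 : ℝ))), IsRegularPoint ![y, x] t) ∧
      (∀ y' x' : ℝ → ℝ, IsFluidTrajectory lam β γ ε y' x' → y' 0 = y₀ → x' 0 = x₀ →
        EqOn y' y (Ici 0) ∧ EqOn x' x (Ici 0)) ∧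
      -- the processes on a common probability space, and their convergence
      ∃ (Ω : Type) (_ : MeasurableSpace Ω) (μ : Measure Ω) (Z : ι → ℝ≥0 → Ω → ℤ × ℕ),
        IsProbabilityMeasure μ ∧
        (∀ i, IsCTMC μ (invitationRate (lam * r i) β ε γ) (s₀ i) (Z i)) ∧
        ∀ᵐ ω ∂μ, ∀ K : Set ℝ≥0, IsCompact K →
          TendstoUniformlyOn (fun i t => fluidScale lam β (r i) (Z i t ω))
            (fun t => (y t, x t)) l K := by
  have hγ0 : (0 : ℝ) ≤ γ := Nat.cast_nonneg _
  have hw₀ : 0 ≤ x₀ + lam / β := by linarith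
  obtain ⟨y, w, hyw⟩ := exists_nearFluid hlam hβ hε hγ y₀ hw₀
  obtain ⟨htraj, hy0, hw0⟩ := isFluidTrajectory_of_nearFluid hβ hw₀ hyw
  have hΛ : ∀ i, 0 < lam * r i := fun i => mul_pos hlam (hr i)
  refine ⟨y, fun t => w t - lam / β, htraj, hy0, by simp [hw0], ae_isRegularPoint ?_, ?_,
    Fin (3 + 1) → ℕ → ℝ, inferInstance, clockLaw 3,
    fun i => clockProcess (eventRate (lam * r i) β ε) (eventNext γ) (s₀ i), inferInstance, ?_, ?_⟩
  · intro k
    fin_cases k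
    exacts [htraj.locallyLipschitz_y, htraj.locallyLipschitz_x]
  -- Both trajectories solve the reflected equation with error `0` and the same initial values, so
  -- the stability estimate bounds their distance by `0`.
  · intro y' x' h' hy' hx'
    have heq : ∀ t, 0 ≤ t → y' t = y t ∧ x' t + lam / β = w t := by
      intro t ht
      have h1 := h'.nearFluid t ht hβ
      rw [hy', hx'] at h1
      have h2 := h1.dist_le hβ.le hγ0 hε.le (hyw t ht) t ⟨ht, le_rfl⟩
      rw [add_zero, mul_zero, zero_mul] at h2
      have h3 := abs_nonneg (y' t - y t)
      have h4 := abs_nonneg (x' t + lam / β - w t)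
      exact ⟨sub_eq_zero.1 (abs_nonpos_iff.1 (by linarith)),
        sub_eq_zero.1 (abs_nonpos_iff.1 (by linarith))⟩
    exact ⟨fun t ht => (heq t ht).1, fun t ht => eq_sub_of_add_eq (heq t ht).2⟩
  · intro i
    rw [← eventJumpRate_eq_invitationRate]
    refine isCTMC_clockProcess _ _ (eventRate_nonneg (hΛ i).le hβ.le hε.le)
      (sum_eventRate_pos (hΛ i) hβ.le hε.le) _ ?_ ?_
    · filter_upwards [ae_regularClocks 3] with v hv
      exact (isClockPath_clockChain _ (eventNext γ) (eventRate_nonneg (hΛ i).le hβ.le hε.le)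
        (sum_eventRate_pos (hΛ i) hβ.le hε.le) (s₀ i) hv.1).hold_nonneg
    · filter_upwards [ae_regularClocks 3] with v hv
      exact hv.tendsto_jumpTimes (hΛ i) hβ.le hε.le hγ (s₀ i)
  · filter_upwards [ae_regularClocks 3] with v hv K hK
    obtain ⟨T, hT⟩ := hK.bddAbove
    have hlimy : Tendsto (fun i => (r i)⁻¹ * ((s₀ i).1 : ℝ)) l (𝓝 y₀) :=
      (continuous_fst.tendsto _).comp hs₀
    have hscale : ∀ i (n : ℕ), (r i)⁻¹ * ((n : ℝ) - lam * r i / β) = (r i)⁻¹ * n - lam / β := by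
      intro i n
      have := (hr i).ne'
      field_simp
    have hlimx : Tendsto (fun i => (r i)⁻¹ * ((s₀ i).2 : ℝ)) l (𝓝 (x₀ + lam / β)) := by
      refine (((continuous_snd.tendsto _).comp hs₀).add_const (lam / β)).congr fun i => ?_
      simp [fluidScale, hscale]
    rw [Metric.tendstoUniformlyOn_iff]
    intro δ hδ
    -- The largest Grönwall factor on `[0, T]`; the accuracy `δ / (4 * c)` for the chain yields a
    -- distance of at most `δ / 2`.
    set c := Real.exp ((β + 2 * (γ * β + ε)) * T) with hc
    have hc0 : 0 < c := Real.exp_pos _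
    filter_upwards [eventually_nearFluid hlam hβ hε hγ hv hr hr_lim hlimy hlimx T.2
      (show 0 < δ / (4 * c) by positivity)] with i hi t ht
    have htT : (t : ℝ) ≤ T := NNReal.coe_le_coe.2 (hT ht)
    have h1 := (hyw T T.2).dist_le hβ.le hγ0 hε.le hi t ⟨t.2, htT⟩
    have h2 : Real.exp ((β + 2 * (γ * β + ε)) * t) ≤ c :=
      Real.exp_le_exp.2 (mul_le_mul_of_nonneg_left htT (by positivity))
    have h3 : 2 * (0 + δ / (4 * c)) * Real.exp ((β + 2 * (γ * β + ε)) * t) ≤ δ / 2 := by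
      calc _ ≤ 2 * (0 + δ / (4 * c)) * c := by gcongr
        _ = δ / 2 := by field_simp; ring
    set z := invitationPath (lam * r i) β ε γ (s₀ i) v t with hz
    have hZ : clockProcess (eventRate (lam * r i) β ε) (eventNext γ) (s₀ i) t v = z := rfl
    have h4 := abs_nonneg (y t - (r i)⁻¹ * z.1)
    have h5 := abs_nonneg (w t - (r i)⁻¹ * z.2)
    rw [hZ, fluidScale, hscale, Prod.dist_eq, max_lt_iff, Real.dist_eq, Real.dist_eq]
    refine ⟨by linarith, ?_⟩
    rw [sub_sub_sub_cancel_right]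
    linarith
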